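/- \textbf{Setting.} Let $\Gamma$ be a (possibly infinite) group with identity $\varepsilon$, let $\Gamma_1$ be a normal subgroup of $\Gamma$, and let $\mathcal{A}$ be a collection of subgroups of $\Gamma$ so that $\{\Gamma_1\}\cup\mathcal{A}$ is a partition of $\Gamma$ (every non-identity element of $\Gamma$ is in exactly one group in $\{\Gamma_1\}\cup\mathcal{A}$), each $A\in\mathcal{A}$ is malnormal ($\gamma^{-1}A\gamma\cap A=\{\varepsilon\}$ for all $\gamma\in\Gamma-A$), and every conjugate of a group in $\mathcal{A}$ is in $\mathcal{A}$. The partition is \emph{nontrivial} if $\{\Gamma_1\}\cup\mathcal{A}$ contains at least two nontrivial groups. A \emph{$\Gamma$-gain graph} $(G,\psi)$ is a finite graph $G$ (loops and parallel edges allowed) with a function $\psi$ from the oriented edges $(e,u,v)$ of $G$ to $\Gamma$ so that $\psi(e,u,v)=\psi(e,v,u)^{-1}$ whenever $u\neq v$. The value $\psi(W)$ of a walk $W$ is the product, in order, of the values of its oriented edges, and a cycle is \emph{$\psi$-balanced} if some simple closed walk on it has value $\varepsilon$. For $\eta\colon V(G)\to\Gamma$ let $\psi^\eta(e,u,v)=\eta(u)^{-1}\psi(e,u,v)\eta(v)$,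 and for $X\subseteq E(G)$ let $\psi(X)$ be the set of values of all orientations of edges in $X$. Let $\psi/\Gamma_1$ be the $(\Gamma/\Gamma_1)$-gain function induced by $\Gamma\to\Gamma/\Gamma_1$. The frame matroid $F(G,\psi/\Gamma_1)$ is the matroid on $E(G)$ whose circuits are the $(\psi/\Gamma_1)$-balanced cycles, and the theta graphs, tight handcuffs and loose handcuffs that contain no $(\psi/\Gamma_1)$-balanced cycle. Let $\mathcal{C}$ be the set of circuits $C$ of $N=F(G,\psi/\Gamma_1)$ so that either $C$ is a $\psi$-balanced cycle, or $C$ is a handcuff or theta graph and there are $\eta\colon V(G)\to\Gamma$ and $A\in\mathcal{A}$ with $\psi^\eta(C)\subseteq A$. Then $M(\Gamma,\Gamma_1,\mathcal{A},G,\psi)$ is the matroid on $E(G)$ in which the rank of $X\subseteq E(G)$ is $r_N(X)$ if every circuit of $N|X$ is in $\mathcal{C}$, and $r_N(X)+1$ otherwise. Let $\mathcal{M}(\Gamma,\Gamma_1,\mathcal{A})$ be the class of matroids isomorphic to $M(\Gamma,\Gamma_1,\mathcal{A},G,\psi)$ for some $\Gamma$-gain graph $(G,\psi)$. \textbf{Theorem.}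 Suppose that $\Gamma_1$ is nontrivial if the partition $\{\Gamma_1\}\cup\mathcal{A}$ is nontrivial. If $\Gamma/\Gamma_1$ is trivial or isomorphic to a group in $\mathcal{A}$, then $\mathcal{M}(\Gamma,\Gamma_1,\mathcal{A})$ is closed under minors. In particular (and without any of these additional assumptions), $\mathcal{M}(\Gamma,\Gamma_1,\mathcal{A})$ is closed under minors whenever $\Gamma$ is finite. -/

import Mathlib

universe u v

namespace GainGraph

/-! ### Group partitions -/

section Partition

variable {Γ : Type v} [Group Γ]

/-- `A` is malnormal: for every `g ∉ A` the conjugate `g⁻¹ A g` meets `A` only in the identity. -/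
def IsMalnormal (A : Subgroup Γ) : Prop :=
  ∀ g : Γ, g ∉ A → ∀ a ∈ A, g⁻¹ * a * g ∈ A → a = 1

/-- A collection `P` of subgroups is a partition of `Γ` if every non-identity element of `Γ` is in
exactly one member of `P`. -/
def IsGroupPartition (P : Set (Subgroup Γ)) : Prop :=
  ∀ g : Γ, g ≠ 1 → ∃! H : Subgroup Γ, H ∈ P ∧ g ∈ H

/-- A partition is nontrivial if it contains at least two nontrivial groups. -/
def IsNontrivialPartition (P : Set (Subgroup Γ)) : Prop :=
  ∃ H ∈ P, ∃ K ∈ P, H ≠ K ∧ H ≠ ⊥ ∧ K ≠ ⊥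

/-- `{Γ₁} ∪ 𝒜` is a Frobenius partition of the (possibly infinite) group `Γ`. -/
structure IsFrobeniusPartition (Γ₁ : Subgroup Γ) (𝒜 : Set (Subgroup Γ)) : Prop where
  normal : Γ₁.Normal
  partition : IsGroupPartition (insert Γ₁ 𝒜)
  malnormal : ∀ A ∈ 𝒜, IsMalnormal A
  conj_mem : ∀ A ∈ 𝒜, ∀ g : Γ, A.map (MulAut.conj g).toMonoidHom ∈ 𝒜

end Partition

/-! ### Walks, cycles, theta graphs and handcuffs in a multigraph -/

section Graphs

variable {V E : Type*}

/-- Walks `v₁, e₁, v₂, …, e_k, v_{k+1}` of `G`, indexed by their first and last vertex. -/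
inductive Walk (G : Graph V E) : V → V → Type _
  | nil (x : V) (hx : x ∈ G.vertexSet) : Walk G x x
  | cons {x y z : V} (e : E) (h : G.IsLink e x y) (W : Walk G y z) : Walk G x z

namespace Walk

variable {G : Graph V E}

/-- The list `v₁, …, v_{k+1}` of vertices of a walk. -/
def vertices : {x y : V} → Walk G x y → List V
  | _, _, nil x _ => [x]
  | x, _, cons _ _ W => x :: W.vertices

/-- The list `e₁, …, e_k` of edges of a walk. -/
def edges : {x y : V} → Walk G x y → List E
  | _, _, nil _ _ => []
  | _, _, cons e _ W => e :: W.edges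

/-- The set of edges of a walk. -/
def edgeSet {x y : V} (W : Walk G x y) : Set E := {e | e ∈ W.edges}

/-- A path is a walk without repeated vertices. -/
def IsPath {x y : V} (W : Walk G x y) : Prop := W.vertices.Nodup

/-- A simple closed walk: at least one edge, no repeated edge, and no repeated vertex apart from
the first vertex being equal to the last one. A loop gives a simple closed walk with one edge, and
two parallel edges give one with two edges. -/
def IsSimpleClosed {x : V} (W : Walk G x x) : Prop :=
  W.edges ≠ [] ∧ W.edges.Nodup ∧ W.vertices.tail.Nodup

end Walk

/-- The set of vertices incident with an edge in `X`. -/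
def vertexSetOf (G : Graph V E) (X : Set E) : Set V := {x | ∃ e ∈ X, G.Inc e x}

/-- `C` is (the edge set of) a cycle of `G`. -/
def IsCycle (G : Graph V E) (C : Set E) : Prop :=
  ∃ (x : V) (W : Walk G x x), W.IsSimpleClosed ∧ W.edgeSet = C

/-- Two walks from `x` to `y` are internally disjoint: they share no edge, and no vertex apart
from `x` and `y`. -/
def InternallyDisjoint {G : Graph V E} {x y : V} (P Q : Walk G x y) : Prop :=
  Disjoint P.edgeSet Q.edgeSet ∧ ∀ z, z ∈ P.vertices → z ∈ Q.vertices → z = x ∨ z = y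

/-- `C` is (the edge set of) a theta subgraph of `G`: three internally disjoint paths between two
distinct vertices. -/
def IsTheta (G : Graph V E) (C : Set E) : Prop :=
  ∃ (x y : V) (P Q R : Walk G x y), x ≠ y ∧ P.IsPath ∧ Q.IsPath ∧ R.IsPath ∧
    InternallyDisjoint P Q ∧ InternallyDisjoint P R ∧ InternallyDisjoint Q R ∧
    C = P.edgeSet ∪ Q.edgeSet ∪ R.edgeSet

/-- `C` is (the edge set of) a tight handcuff of `G`: two edge-disjoint cycles with exactly one
common vertex. -/
def IsTightHandcuff (G : Graph V E) (C : Set E) : Prop :=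
  ∃ D₁ D₂ : Set E, IsCycle G D₁ ∧ IsCycle G D₂ ∧ Disjoint D₁ D₂ ∧
    (∃ x, vertexSetOf G D₁ ∩ vertexSetOf G D₂ = {x}) ∧ C = D₁ ∪ D₂

/-- `C` is (the edge set of) a loose handcuff of `G`: two vertex-disjoint cycles with a minimal
path connecting them. -/
def IsLooseHandcuff (G : Graph V E) (C : Set E) : Prop :=
  ∃ D₁ D₂ : Set E, IsCycle G D₁ ∧ IsCycle G D₂ ∧
    Disjoint (vertexSetOf G D₁) (vertexSetOf G D₂) ∧
    ∃ (x y : V) (P : Walk G x y), P.IsPath ∧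
      {z | z ∈ P.vertices} ∩ vertexSetOf G D₁ = {x} ∧
      {z | z ∈ P.vertices} ∩ vertexSetOf G D₂ = {y} ∧
      C = D₁ ∪ D₂ ∪ P.edgeSet

/-- `C` is a handcuff, tight or loose. -/
def IsHandcuff (G : Graph V E) (C : Set E) : Prop := IsTightHandcuff G C ∨ IsLooseHandcuff G C

end Graphs

/-! ### Gain functions -/

/-- A `Δ`-gain function on `G`. The oriented edges of `G` are the triples `(e, x, y)` with
`G.IsLink e x y`; the values at all other triples are irrelevant. A loop has one orientation, whose
value is arbitrary. -/
structure GainFunction {V E : Type*} (G : Graph V E) (Δ : Type*) [Group Δ] where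
  gain : E → V → V → Δ
  gain_symm : ∀ ⦃e : E⦄ ⦃x y : V⦄, G.IsLink e x y → x ≠ y → gain e x y = (gain e y x)⁻¹

namespace GainFunction

variable {V E : Type*} {G : Graph V E} {Δ : Type*} [Group Δ]

/-- The value of a walk: the product, in order, of the gains of its oriented edges. -/
def walkGain (ψ : GainFunction G Δ) : {x y : V} → Walk G x y → Δ
  | _, _, .nil _ _ => 1
  | x, _, .cons (y := y) e _ W => ψ.gain e x y * ψ.walkGain W

/-- `C` is a `ψ`-balanced cycle: there is a simple closed walk on `C` with value `1`. -/
def IsBalancedCycle (ψ : GainFunction G Δ) (C : Set E) : Prop :=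
  ∃ (x : V) (W : Walk G x x), W.IsSimpleClosed ∧ W.edgeSet = C ∧ ψ.walkGain W = 1

/-- Switching: `ψ^η (e, x, y) = η(x)⁻¹ ψ(e, x, y) η(y)`. -/
def switch (ψ : GainFunction G Δ) (η : V → Δ) : GainFunction G Δ where
  gain e x y := (η x)⁻¹ * ψ.gain e x y * η y
  gain_symm e x y h hne := by rw [ψ.gain_symm h hne]; group

/-- The set `ψ(X)` of the gains of all orientations of edges in `X`. -/
def gainSet (ψ : GainFunction G Δ) (X : Set E) : Set Δ :=
  {g | ∃ e ∈ X, ∃ x y : V, G.IsLink e x y ∧ ψ.gain e x y = g}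

/-- The `(Δ/N)`-gain function `ψ/N`. -/
def quotient (ψ : GainFunction G Δ) (N : Subgroup Δ) [N.Normal] : GainFunction G (Δ ⧸ N) where
  gain e x y := QuotientGroup.mk' N (ψ.gain e x y)
  gain_symm e x y h hne := by rw [ψ.gain_symm h hne, map_inv]

/-- `C` is a circuit of the frame matroid of `(G, ψ)`: a balanced cycle, or a theta graph or a
tight or loose handcuff all of whose cycles are unbalanced. -/
def IsFrameCircuit (ψ : GainFunction G Δ) (C : Set E) : Prop :=
  ψ.IsBalancedCycle C ∨
    ((IsTheta G C ∨ IsHandcuff G C) ∧ ∀ D ⊆ C, IsCycle G D → ¬ ψ.IsBalancedCycle D)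

/-- `N` is the frame matroid `F(G, ψ)`, the matroid on `E(G)` with the above circuits. -/
def IsFrameMatroid (ψ : GainFunction G Δ) (N : Matroid E) : Prop :=
  N.E = G.edgeSet ∧ ∀ C : Set E, N.IsCircuit C ↔ ψ.IsFrameCircuit C

/-- The linear class `𝒞(Γ, Γ₁, 𝒜, G, ψ)` of circuits of `F(G, ψ/Γ₁)`. -/
def linearClass (ψ : GainFunction G Δ) (Γ₁ : Subgroup Δ) [Γ₁.Normal] (𝒜 : Set (Subgroup Δ)) :
    Set (Set E) :=
  {C | (ψ.quotient Γ₁).IsFrameCircuit C ∧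
    (ψ.IsBalancedCycle C ∨
      ((IsHandcuff G C ∨ IsTheta G C) ∧
        ∃ η : V → Δ, ∃ A ∈ 𝒜, (ψ.switch η).gainSet C ⊆ (A : Set Δ)))}

open Classical in
/-- `M` is the matroid `M(Γ, Γ₁, 𝒜, G, ψ)`: the elementary lift of the frame matroid
`N = F(G, ψ/Γ₁)` whose rank function is `r_N(X)` if each circuit of `N|X` is in the linear class,
and `r_N(X) + 1` otherwise. (The matroids `N` and `M` are uniquely determined by `(G, ψ)`.) -/
def IsLiftMatroid (ψ : GainFunction G Δ) (Γ₁ : Subgroup Δ) [Γ₁.Normal] (𝒜 : Set (Subgroup Δ))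
    (M : Matroid E) : Prop :=
  ∃ N : Matroid E, (ψ.quotient Γ₁).IsFrameMatroid N ∧ M.E = G.edgeSet ∧
    ∀ X ⊆ G.edgeSet, M.eRk X =
      if ∀ C ⊆ X, N.IsCircuit C → C ∈ ψ.linearClass Γ₁ 𝒜 then N.eRk X else N.eRk X + 1

end GainFunction

/-! ### The class of matroids -/

/-- `M` and `N` are isomorphic: some bijection between their ground sets preserves independence in
both directions. -/
def IsIsomorphic {ι κ : Type*} (M : Matroid ι) (N : Matroid κ) : Prop :=
  ∃ f : M.E ≃ N.E, ∀ I : Set M.E,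
    M.Indep (Subtype.val '' I) ↔ N.Indep (Subtype.val '' (f '' I))

/-- Membership in the class `ℳ(Γ, Γ₁, 𝒜)`: `M` is isomorphic to `M(Γ, Γ₁, 𝒜, G, ψ)` for some
`Γ`-gain graph `(G, ψ)`, where `G` is a finite multigraph. -/
def MemClass {Γ : Type v} [Group Γ] (Γ₁ : Subgroup Γ) [Γ₁.Normal] (𝒜 : Set (Subgroup Γ))
    ⦃ι : Type u⦄ (M : Matroid ι) : Prop :=
  ∃ (V E : Type) (G : Graph V E) (ψ : GainFunction G Γ) (M₀ : Matroid E),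
    G.vertexSet.Finite ∧ G.edgeSet.Finite ∧ ψ.IsLiftMatroid Γ₁ 𝒜 M₀ ∧ IsIsomorphic M M₀

/-- A class of matroids is minor-closed if it contains every minor of each of its members. -/
def IsMinorClosed (P : ∀ ⦃ι : Type u⦄, Matroid ι → Prop) : Prop :=
  ∀ ⦃ι : Type u⦄ (M N : Matroid ι), P M → N.IsMinor M → P N

end GainGraph

/-! Everything is expressed through the groupoid of walks. Fix one orientation of each edge; `Conn X
x g y` then says that some walk in `X` from `x` to `y` has value `g`. Both ingredients of the lift
matroid can be read off from this groupoid. An edge is in the closure of `X` in the frame matroid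
`N` over `Γ ⧸ Γ₁` iff its gain is the value of a walk in `X` between its ends, or both ends have a
nontrivial closed walk value (`isFrameMatroid_iff`). All circuits of `N|X` are in the linear class
iff `X` is coherent: at each vertex the closed walk values lie in one group that is trivial or is a
member of `𝒜` meeting `Γ₁` trivially (`mem_linearClass_of_coherent`,
`coherent_of_forall_mem_linearClass`). The harder direction adds edges one at a time; malnormality
forces the values of all old walks between the ends of a new edge into the group given by a circuit
through it.

Deletion only restricts the set of arrows. When `e` is not a loop of `N`, contracting it requires
new arrows whose closure and coherence on `X` agree with the old ones on `insert e X`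
(`contract_of_not_inClosure`). A link is switched to gain 1 and its ends are identified. A loop at
`v` with gain `a ∉ Γ₁` has `a` in a unique `A ∈ 𝒜`. A link from `v` with gain `h` becomes a loop at
its other end with gain `h⁻¹ * a * h`; by malnormality the member of `𝒜` containing this element
still determines the coset `Ah`. Every other loop at `v` gets gain 1 if its gain is in `A`, and
otherwise a fixed nontrivial element of `Γ₁`; this is where `Γ₁ ≠ ⊥` is needed. A loop with
nontrivial gain in `Γ₁` makes every set containing it incoherent, so contracting it leaves the frame
matroid `N ＼ {e}`. Embedding `Γ ⧸ Γ₁` in an admissible group represents that matroid by gains for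
which all sets are coherent; this is where the hypothesis on the quotient is needed. A loop with
gain 1 is a loop of the matroid.

For finite `Γ` both hypotheses follow by counting. The conjugates of a nontrivial malnormal `A`
cover at least half of `Γ` by nonidentity elements, so there is no room for a second conjugacy class
outside `Γ₁`. Hence the index of `A` is at most the order of `Γ₁`, and `A` maps isomorphically onto
`Γ ⧸ Γ₁`. -/

namespace GainGraph

open Set

/-! ### Operations on walks -/

namespace Walk

variable {V E : Type*} {G : Graph V E}

/-- The concatenation of two walks. -/
def append : {x y z : V} → Walk G x y → Walk G y z → Walk G x z
  | _, _, _, nil _ _, W => W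
  | _, _, _, cons e h U, W => cons e h (U.append W)

/-- The reverse of a walk. -/
def reverse : {x y : V} → Walk G x y → Walk G y x
  | _, _, nil x hx => nil x hx
  | _, _, cons e h W => W.reverse.append (cons e h.symm (nil _ h.left_mem))

theorem start_mem_vertices {x y : V} (W : Walk G x y) : x ∈ W.vertices := by
  cases W <;> simp [vertices]

theorem end_mem_vertices {x y : V} (W : Walk G x y) : y ∈ W.vertices := by
  induction W with
  | nil => simp [vertices]
  | cons e h W ih => simp [vertices, ih]

theorem start_mem {x y : V} (W : Walk G x y) : x ∈ G.vertexSet := by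
  cases W with
  | nil _ hx => exact hx
  | cons e h W => exact h.left_mem

theorem vertices_eq_cons {x y : V} (W : Walk G x y) : W.vertices = x :: W.vertices.tail := by
  cases W <;> rfl

theorem mem_vertices_iff {x y u : V} (W : Walk G x y) :
    u ∈ W.vertices ↔ u = x ∨ u ∈ W.vertices.tail := by
  conv_lhs => rw [W.vertices_eq_cons]
  simp

theorem vertices_append_tail {x y z : V} (U : Walk G x y) (W : Walk G y z) :
    (U.append W).vertices.tail = U.vertices.tail ++ W.vertices.tail := by
  induction U with
  | nil => rfl
  | cons e h U ih =>
    simp only [append, vertices, List.tail_cons]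
    rw [vertices_eq_cons, ih, U.vertices_eq_cons]
    rfl

theorem vertices_append {x y z : V} (U : Walk G x y) (W : Walk G y z) :
    (U.append W).vertices = U.vertices ++ W.vertices.tail := by
  rw [vertices_eq_cons, vertices_append_tail, U.vertices_eq_cons]
  rfl

theorem mem_vertices_append {x y z u : V} (U : Walk G x y) (W : Walk G y z) :
    u ∈ (U.append W).vertices ↔ u ∈ U.vertices ∨ u ∈ W.vertices := by
  rw [vertices_append, List.mem_append, W.mem_vertices_iff]
  have := U.end_mem_vertices
  grind

theorem edges_append {x y z : V} (U : Walk G x y) (W : Walk G y z) :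
    (U.append W).edges = U.edges ++ W.edges := by
  induction U with
  | nil => rfl
  | cons e h U ih => simp [append, edges, ih]

theorem vertices_reverse {x y : V} (W : Walk G x y) : W.reverse.vertices = W.vertices.reverse := by
  induction W with
  | nil => rfl
  | cons e h W ih => simp [reverse, vertices_append, vertices, ih]

theorem edges_reverse {x y : V} (W : Walk G x y) : W.reverse.edges = W.edges.reverse := by
  induction W with
  | nil => rfl
  | cons e h W ih => simp [reverse, edges_append, edges, ih]

@[simp] theorem mem_edgeSet {x y : V} {W : Walk G x y} {e : E} : e ∈ W.edgeSet ↔ e ∈ W.edges :=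
  Iff.rfl

@[simp] theorem edgeSet_nil (x : V) (hx : x ∈ G.vertexSet) : (nil x hx).edgeSet = ∅ := by
  ext; simp [edges]

@[simp] theorem edgeSet_cons {x y z : V} (e : E) (h : G.IsLink e x y) (W : Walk G y z) :
    (cons e h W).edgeSet = insert e W.edgeSet := by
  ext; simp [edges]

@[simp] theorem edgeSet_append {x y z : V} (U : Walk G x y) (W : Walk G y z) :
    (U.append W).edgeSet = U.edgeSet ∪ W.edgeSet := by
  ext; simp [edges_append]

@[simp] theorem edgeSet_reverse {x y : V} (W : Walk G x y) : W.reverse.edgeSet = W.edgeSet := by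
  ext; simp [edges_reverse]

theorem IsPath.reverse {x y : V} {W : Walk G x y} (h : W.IsPath) : W.reverse.IsPath := by
  simpa [IsPath, vertices_reverse] using h

theorem mem_vertices_of_isLink {x y u v : V} {e : E} {W : Walk G x y} (he : e ∈ W.edges)
    (h : G.IsLink e u v) : u ∈ W.vertices := by
  induction W with
  | nil => simp [edges] at he
  | cons f hf W ih =>
    simp only [edges, List.mem_cons] at he
    rcases he with rfl | he
    · rcases h.left_eq_or_eq hf with rfl | rfl
      · simp [vertices]
      · simp [vertices, W.start_mem_vertices]
    · simp [vertices, ih he]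

theorem mem_edgeSet_graph {x y : V} {e : E} {W : Walk G x y} (he : e ∈ W.edges) :
    e ∈ G.edgeSet := by
  induction W with
  | nil => simp [edges] at he
  | cons f hf W ih =>
    simp only [edges, List.mem_cons] at he
    rcases he with rfl | he
    · exact hf.edge_mem
    · exact ih he

theorem edgeSet_subset {x y : V} (W : Walk G x y) : W.edgeSet ⊆ G.edgeSet :=
  fun _ h => mem_edgeSet_graph h

theorem mem_vertexSetOf_iff {x y u : V} (W : Walk G x y) (hW : W.edges ≠ []) :
    u ∈ vertexSetOf G W.edgeSet ↔ u ∈ W.vertices := by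
  constructor
  · rintro ⟨e, he, v, hv⟩
    exact mem_vertices_of_isLink he hv
  · intro hu
    induction W with
    | nil => simp [edges] at hW
    | cons f hf W ih =>
      simp only [vertices, List.mem_cons] at hu
      rcases hu with rfl | hu
      · exact ⟨f, by simp, hf.inc_left⟩
      · by_cases h : W.edges = []
        · cases W with
          | nil =>
            simp only [vertices, List.mem_singleton] at hu
            exact ⟨f, by simp, hu ▸ hf.inc_right⟩
          | cons => simp [edges] at h
        · obtain ⟨e, he, hi⟩ := ih h hu
          exact ⟨e, by simp_all, hi⟩

theorem vertexSetOf_edgeSet {x y : V} (W : Walk G x y) (hW : W.edges ≠ []) :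
    vertexSetOf G W.edgeSet = {u | u ∈ W.vertices} :=
  Set.ext fun _ => W.mem_vertexSetOf_iff hW

theorem exists_append_of_mem {x y u : V} (W : Walk G x y) (hu : u ∈ W.vertices) :
    ∃ (W₁ : Walk G x u) (W₂ : Walk G u y), W = W₁.append W₂ := by
  induction W with
  | nil x hx =>
    simp only [vertices, List.mem_singleton] at hu
    subst hu
    exact ⟨nil u hx, nil u hx, rfl⟩
  | cons e h W ih =>
    simp only [vertices, List.mem_cons] at hu
    rcases hu with rfl | hu
    · exact ⟨nil _ h.left_mem, cons e h W, rfl⟩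
    · obtain ⟨W₁, W₂, rfl⟩ := ih hu
      exact ⟨cons e h W₁, W₂, rfl⟩

/-- Every walk meeting a set of vertices is split by its first vertex in the set. -/
theorem exists_append_first {x y : V} (W : Walk G x y) (S : Set V)
    (hS : ∃ u ∈ W.vertices, u ∈ S) :
    ∃ u ∈ S, ∃ (W₁ : Walk G x u) (W₂ : Walk G u y), W = W₁.append W₂ ∧
      ∀ v ∈ W₁.vertices, v ∈ S → v = u := by
  induction W with
  | nil x hx =>
    obtain ⟨u, hu, huS⟩ := hS
    simp only [vertices, List.mem_singleton] at hu
    subst hu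
    exact ⟨u, huS, nil u hx, nil u hx, rfl, by simp [vertices]⟩
  | @cons x z y e h W ih =>
    by_cases hx : x ∈ S
    · exact ⟨x, hx, nil _ h.left_mem, cons e h W, rfl, by simp [vertices]⟩
    · obtain ⟨u, hu, huS⟩ := hS
      simp only [vertices, List.mem_cons] at hu
      obtain ⟨u, huS, W₁, W₂, rfl, hW⟩ := ih ⟨u, by grind, huS⟩
      refine ⟨u, huS, cons e h W₁, W₂, rfl, ?_⟩
      simp only [vertices, List.mem_cons]
      rintro v (rfl | hv) hvS
      · exact absurd hvS hx
      · exact hW v hv hvS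

/-- Every walk meeting a set of vertices is split by its last vertex in the set. -/
theorem exists_append_last {x y : V} (W : Walk G x y) (S : Set V)
    (hS : ∃ u ∈ W.vertices, u ∈ S) :
    ∃ u ∈ S, ∃ (W₁ : Walk G x u) (W₂ : Walk G u y), W = W₁.append W₂ ∧
      ∀ v ∈ W₂.vertices, v ∈ S → v = u := by
  induction W with
  | nil x hx =>
    obtain ⟨u, hu, huS⟩ := hS
    simp only [vertices, List.mem_singleton] at hu
    subst hu
    exact ⟨u, huS, nil u hx, nil u hx, rfl, by simp [vertices]⟩
  | @cons x z y e h W ih =>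
    by_cases hx : ∃ u ∈ W.vertices, u ∈ S
    · obtain ⟨u, huS, W₁, W₂, rfl, hW⟩ := ih hx
      exact ⟨u, huS, cons e h W₁, W₂, rfl, hW⟩
    · obtain ⟨u, hu, huS⟩ := hS
      simp only [vertices, List.mem_cons] at hu
      obtain rfl : u = x := by grind
      refine ⟨u, huS, nil _ h.left_mem, cons e h W, rfl, ?_⟩
      simp only [vertices, List.mem_cons]
      grind

theorem IsPath.of_append_left {x y z : V} {U : Walk G x y} {W : Walk G y z}
    (h : (U.append W).IsPath) : U.IsPath := by
  rw [IsPath, vertices_append] at h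
  exact h.of_append_left

theorem IsPath.of_append_right {x y z : V} {U : Walk G x y} {W : Walk G y z}
    (h : (U.append W).IsPath) : W.IsPath := by
  rw [IsPath, vertices_append, List.nodup_append] at h
  rw [IsPath, W.vertices_eq_cons, List.nodup_cons]
  exact ⟨fun h' => h.2.2 _ U.end_mem_vertices _ h' rfl, h.2.1⟩

theorem IsPath.eq_of_mem_append {x y z u : V} {U : Walk G x y} {W : Walk G y z}
    (h : (U.append W).IsPath) (hU : u ∈ U.vertices) (hW : u ∈ W.vertices) : u = y := by
  rw [IsPath, vertices_append, List.nodup_append] at h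
  rcases W.mem_vertices_iff.1 hW with rfl | hW
  · rfl
  · exact absurd rfl (h.2.2 _ hU _ hW)

theorem IsPath.append {x y z : V} {U : Walk G x y} {W : Walk G y z} (hU : U.IsPath)
    (hW : W.IsPath) (h : ∀ u ∈ U.vertices, u ∈ W.vertices → u = y) : (U.append W).IsPath := by
  rw [IsPath, W.vertices_eq_cons, List.nodup_cons] at hW
  rw [IsPath, vertices_append, List.nodup_append]
  refine ⟨hU, hW.2, fun a ha b hb hab => ?_⟩
  subst hab
  have := h a ha (W.mem_vertices_iff.2 (Or.inr hb))
  subst this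
  exact hW.1 hb

theorem isPath_nil (x : V) (hx : x ∈ G.vertexSet) : (nil x hx).IsPath := by
  simp [IsPath, vertices]

theorem isPath_cons {x y z : V} {e : E} {h : G.IsLink e x y} {W : Walk G y z} :
    (cons e h W).IsPath ↔ x ∉ W.vertices ∧ W.IsPath := by
  simp [IsPath, vertices]

theorem IsPath.eq_nil {x : V} {W : Walk G x x} (h : W.IsPath) : W = nil x W.start_mem := by
  cases W with
  | nil => rfl
  | cons e h' W => exact absurd W.end_mem_vertices (isPath_cons.1 h).1

theorem IsPath.nodup_edges {x y : V} {W : Walk G x y} (h : W.IsPath) : W.edges.Nodup := by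
  induction W with
  | nil => simp [edges]
  | cons e h' W ih =>
    rw [isPath_cons] at h
    simp only [edges, List.nodup_cons]
    exact ⟨fun he => h.1 (mem_vertices_of_isLink he h'), ih h.2⟩

theorem IsPath.ne_of_isLink {x y u v : V} {W : Walk G x y} (h : W.IsPath) {e : E}
    (he : e ∈ W.edges) (hl : G.IsLink e u v) : u ≠ v := by
  induction W with
  | nil => simp [edges] at he
  | cons f h' W ih =>
    rw [isPath_cons] at h
    simp only [edges, List.mem_cons] at he
    rcases he with rfl | he
    · rintro rfl
      rcases hl.isLink_iff.1 h' with ⟨rfl, rfl⟩ | ⟨rfl, rfl⟩ <;> exact h.1 W.start_mem_vertices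
    · exact ih h.2 he

/-- A path shares no edge with a walk that it meets in at most one vertex. -/
theorem IsPath.disjoint_edgeSet {x y x' y' u : V} {P : Walk G x y} (hP : P.IsPath)
    {W : Walk G x' y'} (h : ∀ v ∈ P.vertices, v ∈ W.vertices → v = u) :
    Disjoint P.edgeSet W.edgeSet := by
  rw [Set.disjoint_left]
  intro e he he'
  obtain ⟨a, b, hl⟩ := Graph.exists_isLink_of_mem_edgeSet (mem_edgeSet_graph he)
  have ha := h a (mem_vertices_of_isLink he hl) (mem_vertices_of_isLink he' hl)
  have hb := h b (mem_vertices_of_isLink he hl.symm) (mem_vertices_of_isLink he' hl.symm)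
  exact hP.ne_of_isLink he hl (ha.trans hb.symm)

theorem disjoint_edgeSet_of_vertices {x y x' y' : V} {P : Walk G x y}
    {W : Walk G x' y'} (h : ∀ v ∈ P.vertices, v ∉ W.vertices) :
    Disjoint P.edgeSet W.edgeSet := by
  rw [Set.disjoint_left]
  intro e he he'
  obtain ⟨a, b, hl⟩ := Graph.exists_isLink_of_mem_edgeSet (mem_edgeSet_graph he)
  exact h a (mem_vertices_of_isLink he hl) (mem_vertices_of_isLink he' hl)

/-! ### Simple closed walks -/

theorem IsSimpleClosed.append_comm {x y : V} {U : Walk G x y} {W : Walk G y x}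
    (h : (U.append W).IsSimpleClosed) : (W.append U).IsSimpleClosed := by
  obtain ⟨h₁, h₂, h₃⟩ := h
  rw [edges_append] at h₁ h₂
  rw [vertices_append_tail] at h₃
  refine ⟨?_, ?_, ?_⟩
  · rw [edges_append]
    simp_all
    tauto
  · rw [edges_append]
    exact List.nodup_append_comm.1 h₂
  · rw [vertices_append_tail]
    exact List.nodup_append_comm.1 h₃

/-- A link `e` from `x` to `y` and a path from `y` to `x` that avoids `e` form a simple closed
walk. -/
theorem IsPath.isSimpleClosed_cons {x y : V} {P : Walk G y x} (hP : P.IsPath) {e : E}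
    (h : G.IsLink e x y) (he : e ∉ P.edges) : (cons e h P).IsSimpleClosed := by
  refine ⟨by simp [edges], ?_, hP⟩
  simp only [edges, List.nodup_cons]
  exact ⟨he, hP.nodup_edges⟩

theorem IsSimpleClosed.isPath_of_cons {x y : V} {P : Walk G y x} {e : E} {h : G.IsLink e x y}
    (hC : (cons e h P).IsSimpleClosed) : P.IsPath := hC.2.2

theorem IsSimpleClosed.notMem_of_cons {x y : V} {P : Walk G y x} {e : E} {h : G.IsLink e x y}
    (hC : (cons e h P).IsSimpleClosed) : e ∉ P.edges := (List.nodup_cons.1 hC.2.1).1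

theorem IsSimpleClosed.isPath_of_append {x y : V} {U : Walk G x y} {W : Walk G y x}
    (h : (U.append W).IsSimpleClosed) (hne : x ≠ y) : U.IsPath := by
  have h₃ := h.2.2
  rw [vertices_append_tail, List.nodup_append] at h₃
  rw [IsPath, U.vertices_eq_cons, List.nodup_cons]
  refine ⟨fun hx => ?_, h₃.1⟩
  have := (W.mem_vertices_iff.1 W.end_mem_vertices).resolve_left hne
  exact h₃.2.2 _ hx _ this rfl

theorem IsSimpleClosed.internallyDisjoint {x y : V} {U : Walk G x y} {W : Walk G y x}
    (h : (U.append W).IsSimpleClosed) : InternallyDisjoint U W.reverse := by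
  constructor
  · have h₂ := h.2.1
    rw [edges_append, List.nodup_append] at h₂
    rw [edgeSet_reverse, Set.disjoint_left]
    exact fun e he he' => h₂.2.2 _ he _ he' rfl
  · have h₃ := h.2.2
    rw [vertices_append_tail, List.nodup_append] at h₃
    intro z hz hz'
    rw [vertices_reverse, List.mem_reverse] at hz'
    rcases U.mem_vertices_iff.1 hz with rfl | hz
    · exact Or.inl rfl
    · rcases W.mem_vertices_iff.1 hz' with rfl | hz'
      · exact Or.inr rfl
      · exact absurd rfl (h₃.2.2 _ hz _ hz')

theorem _root_.GainGraph.InternallyDisjoint.isSimpleClosed {x y : V} {P Q : Walk G x y}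
    (h : InternallyDisjoint P Q) (hP : P.IsPath) (hQ : Q.IsPath) (hne : x ≠ y) :
    (P.append Q.reverse).IsSimpleClosed := by
  refine ⟨?_, ?_, ?_⟩
  · cases P with
    | nil => exact absurd rfl hne
    | cons => simp [append, edges]
  · rw [edges_append, List.nodup_append]
    refine ⟨hP.nodup_edges, hQ.reverse.nodup_edges, fun a ha b hb hab => ?_⟩
    subst hab
    rw [edges_reverse, List.mem_reverse] at hb
    exact Set.disjoint_left.1 h.1 ha hb
  · have hP' := hP
    have hQ' := hQ.reverse
    rw [IsPath, vertices_eq_cons, List.nodup_cons] at hP' hQ'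
    rw [vertices_append_tail, List.nodup_append]
    refine ⟨hP'.2, hQ'.2, fun a ha b hb hab => ?_⟩
    subst hab
    have ha' : a ∈ Q.vertices := by
      have := Q.reverse.mem_vertices_iff.2 (Or.inr hb)
      rwa [vertices_reverse, List.mem_reverse] at this
    rcases h.2 a (P.mem_vertices_iff.2 (Or.inr ha)) ha' with rfl | rfl
    · exact hP'.1 ha
    · exact hQ'.1 hb

/-- A cycle has a simple closed walk starting with any given edge. -/
theorem exists_append_cons {x y : V} {e : E} (W : Walk G x y) (he : e ∈ W.edges) :
    ∃ (a b : V) (h : G.IsLink e a b) (W₁ : Walk G x a) (W₂ : Walk G b y),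
      W = W₁.append (cons e h W₂) := by
  induction W with
  | nil => simp [edges] at he
  | cons f hf W ih =>
    simp only [edges, List.mem_cons] at he
    rcases he with rfl | he
    · exact ⟨_, _, hf, nil _ hf.left_mem, W, rfl⟩
    · obtain ⟨a, b, h, W₁, W₂, rfl⟩ := ih he
      exact ⟨a, b, h, cons f hf W₁, W₂, rfl⟩

/-- The explicit decomposition is kept so that the gain of the rotated walk can be compared with
that of `W`. -/
theorem IsSimpleClosed.exists_cons {x : V} {W : Walk G x x} (hW : W.IsSimpleClosed) {e : E}
    (he : e ∈ W.edges) : ∃ (a b : V) (h : G.IsLink e a b) (P : Walk G b a),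
      (cons e h P).IsSimpleClosed ∧ (cons e h P).edgeSet = W.edgeSet ∧
      ∃ (U₁ : Walk G x a) (U₂ : Walk G b x), W = U₁.append (cons e h U₂) ∧ P = U₂.append U₁ := by
  obtain ⟨a, b, h, W₁, W₂, rfl⟩ := W.exists_append_cons he
  refine ⟨a, b, h, W₂.append W₁, hW.append_comm, ?_, W₁, W₂, rfl, rfl⟩
  simp [Set.union_comm]

/-- The edges of a path contain no cycle. -/
theorem IsPath.not_edgeSet_subset {x y z : V} {P : Walk G x y} (hP : P.IsPath) {W : Walk G z z}
    (hW : W.IsSimpleClosed) : ¬ W.edgeSet ⊆ P.edgeSet := by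
  induction P with
  | nil x hx =>
    intro h
    obtain ⟨e, he⟩ := List.exists_mem_of_ne_nil _ hW.1
    simpa using h (show e ∈ W.edgeSet from he)
  | @cons x w y e h P ih =>
    intro hsub
    rw [isPath_cons] at hP
    -- The path never returns to `x`. If `e` were on the cycle, the rest `Q` of the cycle would join
    -- the two ends of `e`, which are distinct, and would thus have an edge at `x` lying in the tail
    -- `P`.
    have he : e ∉ W.edges := by
      intro he
      obtain ⟨a, b, hab, Q, hC, hQ, -⟩ := hW.exists_cons he
      have hQP : ∀ f ∈ Q.edges, f ∈ P.edges := by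
        intro f hf
        have hf' : f ∈ (cons e h P).edgeSet := hsub (hQ ▸ (by simp [hf]))
        simp only [edgeSet_cons, Set.mem_insert_iff, mem_edgeSet] at hf'
        rcases hf' with rfl | hf'
        · exact absurd hf hC.notMem_of_cons
        · exact hf'
      have hx : x ≠ w := fun hx => hP.1 (hx ▸ P.start_mem_vertices)
      have hne : Q.edges ≠ [] := by
        intro h0
        cases Q with
        | nil =>
          rcases h.isLink_iff.1 hab with ⟨h1, h2⟩ | ⟨h1, h2⟩
          · exact hx (h1.trans h2.symm)
          · exact hx (h1.trans h2.symm)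
        | cons => simp [edges] at h0
      have hxQ : x ∈ Q.vertices := by
        rcases h.left_eq_or_eq hab with rfl | rfl
        · exact Q.end_mem_vertices
        · exact Q.start_mem_vertices
      obtain ⟨f, hf, v, hv⟩ := (Q.mem_vertexSetOf_iff hne).2 hxQ
      exact hP.1 (mem_vertices_of_isLink (hQP f hf) hv)
    refine ih hP.2 fun f hf => ?_
    have := hsub hf
    simp only [edgeSet_cons, Set.mem_insert_iff] at this
    rcases this with rfl | this
    · exact absurd hf he
    · exact this

/-- No cycle is properly contained in a cycle. -/
theorem IsSimpleClosed.edgeSet_eq_of_subset {x z : V} {U : Walk G x x} (hU : U.IsSimpleClosed)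
    {W : Walk G z z} (hW : W.IsSimpleClosed) (h : W.edgeSet ⊆ U.edgeSet) :
    W.edgeSet = U.edgeSet := by
  refine h.antisymm fun e he => ?_
  by_contra heW
  -- Without the missing edge the larger cycle is a path, and a path contains no cycle.
  obtain ⟨a, b, hab, P, hC, hP, -⟩ := hU.exists_cons he
  refine hC.isPath_of_cons.not_edgeSet_subset hW fun f hf => ?_
  have hf' := h hf
  rw [← hP, edgeSet_cons] at hf'
  rcases hf' with rfl | hf'
  · exact absurd hf heW
  · exact hf'

end Walk

end GainGraph

namespace GainGraph

open Set

/-! ### The groupoid generated by labelled arrows -/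

/-- A labelled arrow for every edge in `E`: a choice of one orientation for the edges of a gain
graph. -/
structure ArrowData (V E Δ : Type*) where
  /-- the first vertex -/
  src : E → V
  /-- the last vertex -/
  tgt : E → V
  /-- the gain -/
  gn : E → Δ

/-- The groupoid generated by the arrows in `X`: `D.Conn X x g y` means that `g` is the value of a
walk from `x` to `y` that uses arrows in `X` and their inverses. -/
inductive ArrowData.Conn {V E Δ : Type*} [Group Δ] (D : ArrowData V E Δ) (X : Set E) :
    V → Δ → V → Prop
  | refl (x : V) : D.Conn X x 1 x
  | fwd {e : E} {g : Δ} {z : V} (he : e ∈ X) (h : D.Conn X (D.tgt e) g z) :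
      D.Conn X (D.src e) (D.gn e * g) z
  | bwd {e : E} {g : Δ} {z : V} (he : e ∈ X) (h : D.Conn X (D.src e) g z) :
      D.Conn X (D.tgt e) ((D.gn e)⁻¹ * g) z

namespace ArrowData

variable {V E Δ : Type*} [Group Δ] {D : ArrowData V E Δ} {X Y : Set E} {x y z : V} {g h : Δ}
  {e f : E}

namespace Conn

theorem trans (h₁ : D.Conn X x g y) (h₂ : D.Conn X y h z) : D.Conn X x (g * h) z := by
  induction h₁ with
  | refl => simpa using h₂
  | fwd he _ ih => rw [mul_assoc]; exact .fwd he (ih h₂)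
  | bwd he _ ih => rw [mul_assoc]; exact .bwd he (ih h₂)

theorem arrow (he : e ∈ X) : D.Conn X (D.src e) (D.gn e) (D.tgt e) := by
  simpa using Conn.fwd he (Conn.refl (D := D) (X := X) _)

theorem arrow_inv (he : e ∈ X) : D.Conn X (D.tgt e) (D.gn e)⁻¹ (D.src e) := by
  simpa using Conn.bwd he (Conn.refl (D := D) (X := X) _)

theorem symm (h₁ : D.Conn X x g y) : D.Conn X y g⁻¹ x := by
  induction h₁ with
  | refl => simpa using Conn.refl (D := D) (X := X) _
  | fwd he _ ih => rw [mul_inv_rev]; exact ih.trans (arrow_inv he)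
  | bwd he _ ih => rw [mul_inv_rev, inv_inv]; exact ih.trans (arrow he)

/-- Functoriality of the generated groupoid, with switching. -/
theorem map {V' E' Δ' : Type*} [Group Δ'] {D' : ArrowData V' E' Δ'} {X' : Set E'}
    (h₁ : D.Conn X x g y) (p : V → V') (τ : V → Δ') (φ : Δ →* Δ')
    (H : ∀ e ∈ X, D'.Conn X' (p (D.src e)) ((τ (D.src e))⁻¹ * φ (D.gn e) * τ (D.tgt e))
      (p (D.tgt e))) : D'.Conn X' (p x) ((τ x)⁻¹ * φ g * τ y) (p y) := by
  induction h₁ with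
  | refl => simpa using Conn.refl (D := D') (X := X') _
  | fwd he _ ih =>
    convert (H _ he).trans ih using 1
    rw [map_mul]
    group
  | bwd he _ ih =>
    convert (H _ he).symm.trans ih using 1
    rw [map_mul, map_inv]
    group

theorem mono (h₁ : D.Conn X x g y) (hXY : X ⊆ Y) : D.Conn Y x g y := by
  simpa using h₁.map id 1 (MonoidHom.id Δ) (D' := D) (X' := Y) fun e he => by
    simpa using arrow (hXY he)

/-- If switching by `τ` moves all gains into a subgroup, then it moves the values of all walks into
this subgroup. -/
theorem switch_mem (h₁ : D.Conn X x g y) (A : Subgroup Δ) (τ : V → Δ)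
    (H : ∀ e ∈ X, (τ (D.src e))⁻¹ * D.gn e * τ (D.tgt e) ∈ A) : (τ x)⁻¹ * g * τ y ∈ A := by
  induction h₁ with
  | refl => simp [A.one_mem]
  | fwd he _ ih =>
    convert A.mul_mem (H _ he) ih using 1
    group
  | bwd he _ ih =>
    convert A.mul_mem (A.inv_mem (H _ he)) ih using 1
    group

/-- A vertex without incident arrows is isolated. -/
theorem eq_of_isolated (h₁ : D.Conn X x g y) (H : ∀ e ∈ X, D.src e ≠ x ∧ D.tgt e ≠ x) :
    x = y ∧ g = 1 := by
  cases h₁ with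
  | refl => exact ⟨rfl, rfl⟩
  | fwd he _ => exact absurd rfl (H _ he).1
  | bwd he _ => exact absurd rfl (H _ he).2

end Conn

/-- The image of a labelling under a group homomorphism. -/
def mapHom {Δ' : Type*} [Group Δ'] (D : ArrowData V E Δ) (φ : Δ →* Δ') : ArrowData V E Δ' where
  src := D.src
  tgt := D.tgt
  gn e := φ (D.gn e)

/-- A walk does not depend on the labels, so it can be evaluated in `Δ` before applying `φ`. -/
theorem conn_mapHom {Δ' : Type*} [Group Δ'] {φ : Δ →* Δ'} {k : Δ'} :
    (D.mapHom φ).Conn X x k y ↔ ∃ g, φ g = k ∧ D.Conn X x g y := by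
  constructor
  · intro h
    induction h with
    | refl x => exact ⟨1, map_one φ, .refl x⟩
    | fwd he _ ih =>
      obtain ⟨g, rfl, hg⟩ := ih
      exact ⟨_, map_mul .., .fwd he hg⟩
    | bwd he _ ih =>
      obtain ⟨g, rfl, hg⟩ := ih
      exact ⟨(D.gn _)⁻¹ * g, by rw [map_mul, map_inv]; rfl, .bwd he hg⟩
  · rintro ⟨g, rfl, hg⟩
    simpa using hg.map id 1 φ (D' := D.mapHom φ) (X' := X) fun e he => by
      simpa using show (D.mapHom φ).Conn X (D.src e) (φ (D.gn e)) (D.tgt e) from .arrow he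

/-- The component of `x` in `X` is unbalanced. -/
def Unbalanced (D : ArrowData V E Δ) (X : Set E) (x : V) : Prop := ∃ g, g ≠ 1 ∧ D.Conn X x g x

/-- The closure of `X` in the frame matroid. -/
def InClosure (D : ArrowData V E Δ) (X : Set E) (e : E) : Prop :=
  D.Conn X (D.src e) (D.gn e) (D.tgt e) ∨
    (D.Unbalanced X (D.src e) ∧ D.Unbalanced X (D.tgt e))

theorem Unbalanced.mono (h : D.Unbalanced X x) (hXY : X ⊆ Y) : D.Unbalanced Y x :=
  let ⟨g, hg, hc⟩ := h
  ⟨g, hg, hc.mono hXY⟩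

theorem InClosure.mono (h : D.InClosure X e) (hXY : X ⊆ Y) : D.InClosure Y e :=
  h.imp (fun h => h.mono hXY) (fun h => ⟨h.1.mono hXY, h.2.mono hXY⟩)

theorem Unbalanced.of_conn (h : D.Unbalanced X x) (hc : D.Conn X y g x) : D.Unbalanced X y := by
  obtain ⟨k, hk, hkc⟩ := h
  refine ⟨g * k * g⁻¹, fun h => hk ?_, (hc.trans hkc).trans hc.symm⟩
  simpa using h

/-- Each use of `f` can be replaced by a walk in `X` of the same value, unless `f` joins unbalanced
components; in that case the value is lost but both ends of the walk are unbalanced. This gives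
idempotence of the closure. -/
theorem conn_insert_of_inClosure (hf : D.InClosure X f) (h : D.Conn (insert f X) x g y) :
    D.Conn X x g y ∨ (D.Unbalanced X x ∧ D.Unbalanced X y) := by
  induction h with
  | refl x => exact .inl (.refl x)
  | fwd he _ ih =>
    rcases Set.mem_insert_iff.1 he with rfl | he
    · rcases hf with hf | hf
      · exact ih.imp (fun h => hf.trans h) (fun h => ⟨h.1.of_conn hf, h.2⟩)
      · exact .inr ⟨hf.1, ih.elim (fun h => hf.2.of_conn h.symm) (fun h => h.2)⟩
    · exact ih.imp (fun h => .fwd he h) (fun h => ⟨h.1.of_conn (.arrow he), h.2⟩)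
  | bwd he _ ih =>
    rcases Set.mem_insert_iff.1 he with rfl | he
    · rcases hf with hf | hf
      · exact ih.imp (fun h => hf.symm.trans h) (fun h => ⟨h.1.of_conn hf.symm, h.2⟩)
      · exact .inr ⟨hf.2, ih.elim (fun h => hf.1.of_conn h.symm) (fun h => h.2)⟩
    · exact ih.imp (fun h => .bwd he h) (fun h => ⟨h.1.of_conn (.arrow_inv he), h.2⟩)

theorem Unbalanced.of_insert (hf : D.InClosure X f) (h : D.Unbalanced (insert f X) x) :
    D.Unbalanced X x := by
  obtain ⟨g, hg, hc⟩ := h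
  rcases conn_insert_of_inClosure hf hc with h | h
  exacts [⟨g, hg, h⟩, h.1]

theorem InClosure.of_insert (hf : D.InClosure X f) (h : D.InClosure (insert f X) e) :
    D.InClosure X e := by
  rcases h with h | h
  · exact conn_insert_of_inClosure hf h
  · exact .inr ⟨h.1.of_insert hf, h.2.of_insert hf⟩

theorem inClosure_of_mem (he : e ∈ X) : D.InClosure X e := .inl (.arrow he)

end ArrowData

/-! ### Oriented gain graphs -/

section Oriented

variable {V E Δ : Type*} [Group Δ] {G : Graph V E} {ψ : GainFunction G Δ}
  {D : ArrowData V E Δ} {X : Set E}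

theorem GainFunction.walkGain_append (ψ : GainFunction G Δ) {x y z : V} (U : Walk G x y)
    (W : Walk G y z) : ψ.walkGain (U.append W) = ψ.walkGain U * ψ.walkGain W := by
  induction U with
  | nil => simp [Walk.append, walkGain]
  | cons e h U ih => simp [Walk.append, walkGain, ih, mul_assoc]

/-- `D` consists of one orientation of each edge of the gain graph `(G, ψ)`. -/
def ArrowData.Orients (D : ArrowData V E Δ) (ψ : GainFunction G Δ) : Prop :=
  ∀ e ∈ G.edgeSet, G.IsLink e (D.src e) (D.tgt e) ∧ ψ.gain e (D.src e) (D.tgt e) = D.gn e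

/-- For a loop the first alternative holds, so `gain_symm` is only needed for distinct ends. -/
theorem ArrowData.Orients.eq_or (hD : D.Orients ψ) {e : E} {x y : V} (h : G.IsLink e x y) :
    (x = D.src e ∧ y = D.tgt e ∧ ψ.gain e x y = D.gn e) ∨
      (x = D.tgt e ∧ y = D.src e ∧ ψ.gain e x y = (D.gn e)⁻¹) := by
  obtain ⟨h₁, h₂⟩ := hD e h.edge_mem
  by_cases hxy : x = D.src e ∧ y = D.tgt e
  · obtain ⟨rfl, rfl⟩ := hxy
    exact .inl ⟨rfl, rfl, h₂⟩
  · obtain ⟨h3, h4⟩ := (h₁.isLink_iff.1 h).resolve_left (fun h => hxy ⟨h.1.symm, h.2.symm⟩)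
    subst h3 h4
    refine .inr ⟨rfl, rfl, ?_⟩
    rw [ψ.gain_symm h, h₂]
    exact fun h => hxy ⟨h, h.symm⟩

theorem exists_orients [Nonempty V] (ψ : GainFunction G Δ) :
    ∃ D : ArrowData V E Δ, D.Orients ψ := by
  classical
  have : ∀ e, ∃ p : V × V, e ∈ G.edgeSet → G.IsLink e p.1 p.2 := by
    intro e
    by_cases he : e ∈ G.edgeSet
    · obtain ⟨x, y, h⟩ := Graph.exists_isLink_of_mem_edgeSet he
      exact ⟨(x, y), fun _ => h⟩
    · exact ⟨Classical.arbitrary _, fun h => absurd h he⟩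
  choose p hp using this
  exact ⟨⟨fun e => (p e).1, fun e => (p e).2, fun e => ψ.gain e (p e).1 (p e).2⟩,
    fun e he => ⟨hp e he, rfl⟩⟩

theorem ArrowData.Orients.quotient (hD : D.Orients ψ) (N : Subgroup Δ) [N.Normal] :
    (D.mapHom (QuotientGroup.mk' N)).Orients (ψ.quotient N) := by
  intro e he
  obtain ⟨h₁, h₂⟩ := hD e he
  exact ⟨h₁, congrArg (QuotientGroup.mk' N) h₂⟩

theorem ArrowData.Orients.conn_link (hD : D.Orients ψ) {e : E} {x y : V} (h : G.IsLink e x y)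
    (he : e ∈ X) : D.Conn X x (ψ.gain e x y) y := by
  rcases hD.eq_or h with ⟨rfl, rfl, hg⟩ | ⟨rfl, rfl, hg⟩ <;> rw [hg]
  exacts [.arrow he, .arrow_inv he]

theorem ArrowData.Orients.conn_walk (hD : D.Orients ψ) {x y : V} (W : Walk G x y)
    (hW : W.edgeSet ⊆ X) : D.Conn X x (ψ.walkGain W) y := by
  induction W with
  | nil x hx => exact .refl x
  | cons e h W ih =>
    rw [Walk.edgeSet_cons, insert_subset_iff] at hW
    exact (hD.conn_link h hW.1).trans (ih hW.2)

theorem ArrowData.Orients.inClosure_link (hD : D.Orients ψ) {e : E} {x y : V}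
    (h : G.IsLink e x y) :
    D.InClosure X e ↔ D.Conn X x (ψ.gain e x y) y ∨ (D.Unbalanced X x ∧ D.Unbalanced X y) := by
  rcases hD.eq_or h with ⟨rfl, rfl, hg⟩ | ⟨rfl, rfl, hg⟩ <;> rw [hg]
  · rfl
  · rw [InClosure, and_comm (a := D.Unbalanced X (D.src e))]
    exact or_congr_left ⟨fun h => h.symm, fun h => by simpa using h.symm⟩

/-- Connected vertices are joined by a path. -/
theorem ArrowData.Orients.exists_isPath (hD : D.Orients ψ) (hX : X ⊆ G.edgeSet) {x y : V} {g : Δ}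
    (h : D.Conn X x g y) (hx : x ∈ G.vertexSet) :
    ∃ P : Walk G x y, P.IsPath ∧ P.edgeSet ⊆ X := by
  have step : ∀ {e x z y}, e ∈ X → G.IsLink e x z →
      (∃ P : Walk G z y, P.IsPath ∧ P.edgeSet ⊆ X) →
      ∃ P : Walk G x y, P.IsPath ∧ P.edgeSet ⊆ X := by
    rintro e x z y he hl ⟨P, hP, hPX⟩
    by_cases hxP : x ∈ P.vertices
    · obtain ⟨P₁, P₂, rfl⟩ := P.exists_append_of_mem hxP
      rw [Walk.edgeSet_append, union_subset_iff] at hPX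
      exact ⟨P₂, hP.of_append_right, hPX.2⟩
    · refine ⟨.cons e hl P, Walk.isPath_cons.2 ⟨hxP, hP⟩, ?_⟩
      rw [Walk.edgeSet_cons, insert_subset_iff]
      exact ⟨he, hPX⟩
  induction h with
  | refl x => exact ⟨.nil x hx, Walk.isPath_nil x hx, by simp⟩
  | fwd he _ ih =>
    have hl := (hD _ (hX he)).1
    exact step he hl (ih hl.right_mem)
  | bwd he _ ih =>
    have hl := (hD _ (hX he)).1
    exact step he hl.symm (ih hl.left_mem)

/-- In `X` there is a path from `x` to an unbalanced cycle. -/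
def HasLollipop (ψ : GainFunction G Δ) (X : Set E) (x : V) : Prop :=
  ∃ (z : V) (P : Walk G x z) (W : Walk G z z), P.IsPath ∧ P.edgeSet ⊆ X ∧ W.IsSimpleClosed ∧
    W.edgeSet ⊆ X ∧ ψ.walkGain W ≠ 1 ∧ ∀ u ∈ P.vertices, u ∈ W.vertices → u = z

/-- Such a path consists of the single edge `e`. -/
theorem Walk.IsPath.eq_of_mem_edges {x y : V} {P : Walk G x y} (hP : P.IsPath) {e : E}
    (he : e ∈ P.edges) (h : G.IsLink e x y) : ψ.walkGain P = ψ.gain e x y := by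
  have hxy := hP.ne_of_isLink he h
  cases P with
  | nil => exact absurd rfl hxy
  | cons f hf P =>
    rw [isPath_cons] at hP
    simp only [edges, List.mem_cons] at he
    rcases he with rfl | he
    · obtain rfl := hf.right_unique h
      rw [hP.2.eq_nil]
      simp [GainFunction.walkGain]
    · exact absurd (mem_vertices_of_isLink he h) hP.1

/-- Rotation conjugates the value of a closed walk, so only its triviality is invariant. -/
theorem Walk.IsSimpleClosed.exists_rotate {x u : V} {W : Walk G x x} (hW : W.IsSimpleClosed)
    (hu : u ∈ W.vertices) : ∃ W' : Walk G u u, W'.IsSimpleClosed ∧ W'.edgeSet = W.edgeSet ∧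
      (ψ.walkGain W' = 1 ↔ ψ.walkGain W = 1) ∧ ∀ v, v ∈ W'.vertices ↔ v ∈ W.vertices := by
  obtain ⟨W₁, W₂, rfl⟩ := W.exists_append_of_mem hu
  refine ⟨W₂.append W₁, hW.append_comm, by simp [Set.union_comm], ?_, fun v => ?_⟩
  · rw [ψ.walkGain_append, ψ.walkGain_append, mul_eq_one_iff_eq_inv', mul_eq_one_iff_eq_inv]
  · rw [Walk.mem_vertices_append, Walk.mem_vertices_append, or_comm]

/-- The value of a walk in `X` is the value of a path in `X`, unless there is an unbalanced cycle in
the component. -/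
theorem ArrowData.Orients.exists_isPath_or_hasLollipop (hD : D.Orients ψ) (hX : X ⊆ G.edgeSet)
    {x y : V} {g : Δ} (h : D.Conn X x g y) (hx : x ∈ G.vertexSet) :
    (∃ P : Walk G x y, P.IsPath ∧ P.edgeSet ⊆ X ∧ ψ.walkGain P = g) ∨ HasLollipop ψ X x := by
  have step : ∀ {e x z y g}, e ∈ X → G.IsLink e x z →
      ((∃ P : Walk G z y, P.IsPath ∧ P.edgeSet ⊆ X ∧ ψ.walkGain P = g) ∨ HasLollipop ψ X z) →
      (∃ P : Walk G x y, P.IsPath ∧ P.edgeSet ⊆ X ∧ ψ.walkGain P = ψ.gain e x z * g) ∨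
        HasLollipop ψ X x := by
    rintro e x z y g he hl (⟨P, hP, hPX, rfl⟩ | ⟨t, P, W, hP, hPX, hW, hWX, hW1, hPW⟩)
    · by_cases hxP : x ∈ P.vertices
      · obtain ⟨P₁, P₂, rfl⟩ := P.exists_append_of_mem hxP
        rw [Walk.edgeSet_append, union_subset_iff] at hPX
        rw [ψ.walkGain_append]
        -- Here `e` followed by `P₁` returns to `x`. If `e` is on `P₁`, then `P₁` is `e` traversed
        -- backwards and the two cancel. Otherwise they form a cycle, which can be dropped if its
        -- value is 1 and is the required unbalanced cycle if not.
        by_cases heP : e ∈ P₁.edges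
        · refine .inl ⟨P₂, hP.of_append_right, hPX.2, ?_⟩
          rw [hP.of_append_left.eq_of_mem_edges (ψ := ψ) heP hl.symm,
            ψ.gain_symm hl (hP.of_append_left.ne_of_isLink heP hl), inv_mul_cancel_left]
        · by_cases h1 : ψ.walkGain (Walk.cons e hl P₁) = 1
          · refine .inl ⟨P₂, hP.of_append_right, hPX.2, ?_⟩
            rw [GainFunction.walkGain] at h1
            rw [← mul_assoc, h1, one_mul]
          · refine .inr ⟨x, .nil x hl.left_mem, .cons e hl P₁, Walk.isPath_nil _ _, by simp,
              hP.of_append_left.isSimpleClosed_cons hl heP, ?_, h1, ?_⟩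
            · rw [Walk.edgeSet_cons, insert_subset_iff]
              exact ⟨he, hPX.1⟩
            · simp [Walk.vertices]
      · refine .inl ⟨.cons e hl P, Walk.isPath_cons.2 ⟨hxP, hP⟩, ?_, rfl⟩
        rw [Walk.edgeSet_cons, insert_subset_iff]
        exact ⟨he, hPX⟩
    · right
      by_cases hxP : x ∈ P.vertices
      · obtain ⟨P₁, P₂, rfl⟩ := P.exists_append_of_mem hxP
        rw [Walk.edgeSet_append, union_subset_iff] at hPX
        exact ⟨t, P₂, W, hP.of_append_right, hPX.2, hW, hWX, hW1,
          fun u hu => hPW u ((Walk.mem_vertices_append _ _).2 (.inr hu))⟩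
      by_cases hxW : x ∈ W.vertices
      · obtain ⟨W', h1, h2, h3, h4⟩ := hW.exists_rotate (ψ := ψ) hxW
        exact ⟨x, .nil x hl.left_mem, W', Walk.isPath_nil _ _, by simp, h1, h2 ▸ hWX,
          fun h => hW1 (h3.1 h), by simp [Walk.vertices]⟩
      · refine ⟨t, .cons e hl P, W, Walk.isPath_cons.2 ⟨hxP, hP⟩, ?_, hW, hWX, hW1, ?_⟩
        · rw [Walk.edgeSet_cons, insert_subset_iff]
          exact ⟨he, hPX⟩
        · simp only [Walk.vertices, List.mem_cons]
          rintro u (rfl | hu) huW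
          exacts [absurd huW hxW, hPW u hu huW]
  induction h with
  | refl x => exact .inl ⟨.nil x hx, Walk.isPath_nil x hx, by simp, rfl⟩
  | @fwd e g z he _ ih =>
    obtain ⟨hl, hg⟩ := hD _ (hX he)
    rw [← hg]
    exact step he hl (ih hl.right_mem)
  | @bwd e g z he _ ih =>
    obtain ⟨hl, hg⟩ := hD _ (hX he)
    -- A loop has only one orientation in the gain graph, so traversing its arrow backwards is not a
    -- step of a `Walk`. If its gain is 1 it can be skipped; otherwise the loop itself is an
    -- unbalanced cycle.
    rcases eq_or_ne (D.src e) (D.tgt e) with heq | hne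
    · by_cases h1 : D.gn e = 1
      · rw [h1, inv_one, one_mul, ← heq]
        exact ih hl.left_mem
      · have hl' : G.IsLink e (D.tgt e) (D.tgt e) := by rwa [heq] at hl
        refine .inr ⟨D.tgt e, .nil _ hx, .cons e hl' (.nil _ hx), Walk.isPath_nil _ _, by simp,
          (Walk.isPath_nil _ hx).isSimpleClosed_cons hl' (by simp [Walk.edges]), by simpa using he,
          ?_, by simp [Walk.vertices]⟩
        rw [heq] at hg
        simpa [GainFunction.walkGain, hg] using h1
    · rw [← hg, ← ψ.gain_symm hl.symm hne.symm]
      exact step he hl.symm (ih hl.left_mem)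

theorem ArrowData.Orients.hasLollipop_of_unbalanced (hD : D.Orients ψ) (hX : X ⊆ G.edgeSet)
    {x : V} (h : D.Unbalanced X x) (hx : x ∈ G.vertexSet) : HasLollipop ψ X x := by
  obtain ⟨g, hg, hc⟩ := h
  refine (hD.exists_isPath_or_hasLollipop hX hc hx).resolve_left ?_
  rintro ⟨P, hP, -, rfl⟩
  rw [hP.eq_nil] at hg
  exact hg rfl

end Oriented

end GainGraph

namespace GainGraph

open Set

/-! ### Frame circuits and the closure given by walks -/

section FrameCircuits

variable {V E Δ : Type*} [Group Δ] {G : Graph V E} {ψ : GainFunction G Δ}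
  {D : ArrowData V E Δ} {X C : Set E}

theorem vertexSetOf_union (G : Graph V E) (X Y : Set E) :
    vertexSetOf G (X ∪ Y) = vertexSetOf G X ∪ vertexSetOf G Y := by
  ext u
  simp only [vertexSetOf, mem_ofPred_eq, Set.mem_union]
  grind

theorem Walk.mem_vertices_of_mem_vertexSetOf {x y u : V} {W : Walk G x y}
    (hu : u ∈ vertexSetOf G W.edgeSet) : u ∈ W.vertices := by
  obtain ⟨e, he, v, hv⟩ := hu
  exact mem_vertices_of_isLink he hv

theorem Walk.IsPath.ne_of_mem_tail {x y u : V} {W : Walk G x y} (hW : W.IsPath)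
    (hu : u ∈ W.vertices.tail) : u ≠ x := by
  rw [IsPath, W.vertices_eq_cons, List.nodup_cons] at hW
  rintro rfl
  exact hW.1 hu

/-- The two cycles and the path of a handcuff; the path is trivial for a tight handcuff. -/
theorem IsHandcuff.exists_walks (hC : IsHandcuff G C) :
    ∃ (x y : V) (U : Walk G x x) (W : Walk G y y) (P : Walk G x y), U.IsSimpleClosed ∧
      W.IsSimpleClosed ∧ P.IsPath ∧ C = U.edgeSet ∪ W.edgeSet ∪ P.edgeSet ∧
      Disjoint U.edgeSet W.edgeSet ∧ (∀ u ∈ P.vertices, u ∈ U.vertices → u = x) ∧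
      (∀ u ∈ P.vertices, u ∈ W.vertices → u = y) ∧
      (∀ u ∈ U.vertices, u ∈ W.vertices → u = x ∧ u = y) := by
  -- The trivial gains serve only to apply `exists_rotate`, whose statement mentions a gain
  -- function.
  let ψ₀ : GainFunction G Unit := ⟨fun _ _ _ => 1, fun _ _ _ _ _ => rfl⟩
  rcases hC with ⟨D₁, D₂, ⟨a, U, hU, rfl⟩, ⟨b, W, hW, rfl⟩, hd, ⟨x, hx⟩, rfl⟩ |
    ⟨D₁, D₂, ⟨a, U, hU, rfl⟩, ⟨b, W, hW, rfl⟩, hd, x, y, P, hP, hx, hy, rfl⟩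
  · rw [U.vertexSetOf_edgeSet hU.1, W.vertexSetOf_edgeSet hW.1] at hx
    have hx' : x ∈ ({u | u ∈ U.vertices} ∩ {u | u ∈ W.vertices} : Set V) := hx ▸ rfl
    obtain ⟨U', hU', hUe, -, hUv⟩ := hU.exists_rotate (ψ := ψ₀) hx'.1
    obtain ⟨W', hW', hWe, -, hWv⟩ := hW.exists_rotate (ψ := ψ₀) hx'.2
    refine ⟨x, x, U', W', .nil x U'.start_mem, hU', hW', Walk.isPath_nil _ _, ?_, ?_, ?_, ?_, ?_⟩
    · simp [hUe, hWe]
    · rwa [hUe, hWe]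
    · simp [Walk.vertices]
    · simp [Walk.vertices]
    · intro u hu hu'
      have : u ∈ ({x} : Set V) := hx ▸ ⟨(hUv u).1 hu, (hWv u).1 hu'⟩
      exact ⟨this, this⟩
  · rw [U.vertexSetOf_edgeSet hU.1] at hx hd
    rw [W.vertexSetOf_edgeSet hW.1] at hy hd
    have hx' : x ∈ ({u | u ∈ P.vertices} ∩ {u | u ∈ U.vertices} : Set V) := hx ▸ rfl
    have hy' : y ∈ ({u | u ∈ P.vertices} ∩ {u | u ∈ W.vertices} : Set V) := hy ▸ rfl
    obtain ⟨U', hU', hUe, -, hUv⟩ := hU.exists_rotate (ψ := ψ₀) hx'.2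
    obtain ⟨W', hW', hWe, -, hWv⟩ := hW.exists_rotate (ψ := ψ₀) hy'.2
    refine ⟨x, y, U', W', P, hU', hW', hP, by rw [hUe, hWe], ?_, ?_, ?_, ?_⟩
    · rw [hUe, hWe]
      exact Walk.disjoint_edgeSet_of_vertices fun v hv hv' => Set.disjoint_left.1 hd hv hv'
    · intro u hu hu'
      exact (Set.ext_iff.1 hx u).1 ⟨hu, (hUv u).1 hu'⟩
    · intro u hu hu'
      exact (Set.ext_iff.1 hy u).1 ⟨hu, (hWv u).1 hu'⟩
    · intro u hu hu'
      exact absurd ((hWv u).1 hu') (Set.disjoint_left.1 hd ((hUv u).1 hu))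

namespace ArrowData.Orients

/-! ### Elements of frame circuits are spanned by the remaining elements -/

theorem conn_of_mem_vertices (hD : D.Orients ψ) {x y u : V} {W : Walk G x y}
    (hW : W.edgeSet ⊆ X) (hu : u ∈ W.vertices) :
    (∃ g, D.Conn X u g x) ∧ ∃ g, D.Conn X u g y := by
  obtain ⟨W₁, W₂, rfl⟩ := W.exists_append_of_mem hu
  rw [Walk.edgeSet_append, union_subset_iff] at hW
  exact ⟨⟨_, (hD.conn_walk W₁ hW.1).symm⟩, ⟨_, hD.conn_walk W₂ hW.2⟩⟩

theorem unbalanced_of_walk (hD : D.Orients ψ) {x u : V} {W : Walk G x x}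
    (hW : W.edgeSet ⊆ X) (h1 : ψ.walkGain W ≠ 1) (hu : u ∈ W.vertices) : D.Unbalanced X u := by
  obtain ⟨g, hg⟩ := (hD.conn_of_mem_vertices hW hu).1
  exact ArrowData.Unbalanced.of_conn ⟨_, h1, hD.conn_walk W hW⟩ hg

/-- Removing `e` cuts the path into two pieces, each joining an end of `e` to an end of the path. -/
theorem unbalanced_of_mem_path (hD : D.Orients ψ) {x y v : V} {P : Walk G x y} (hP : P.IsPath)
    (hPC : P.edgeSet ⊆ C) {e : E} (he : e ∈ P.edges) (hx : D.Unbalanced (C \ {e}) x)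
    (hy : D.Unbalanced (C \ {e}) y) (hv : G.Inc e v) : D.Unbalanced (C \ {e}) v := by
  obtain ⟨a, b, h, P₁, P₂, rfl⟩ := P.exists_append_cons he
  have hnd := hP.nodup_edges
  rw [Walk.edges_append, List.nodup_append, Walk.edges, List.nodup_cons] at hnd
  rw [Walk.edgeSet_append, Walk.edgeSet_cons, union_subset_iff, insert_subset_iff] at hPC
  have h₁ : P₁.edgeSet ⊆ C \ {e} :=
    subset_sdiff_singleton hPC.1 fun he => hnd.2.2 _ he _ List.mem_cons_self rfl
  have h₂ : P₂.edgeSet ⊆ C \ {e} := subset_sdiff_singleton hPC.2.2 fun he => hnd.2.1.1 he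
  rcases hv.eq_or_eq_of_isLink h with rfl | rfl
  · exact hx.of_conn (hD.conn_walk P₁ h₁).symm
  · exact hy.of_conn (hD.conn_walk P₂ h₂)

/-- Removing `e` from the cycle leaves a path, so `x` stays connected to both ends of `e`. -/
theorem unbalanced_of_mem_cycle (hD : D.Orients ψ) {x v : V} {W : Walk G x x}
    (hW : W.IsSimpleClosed) (hWC : W.edgeSet ⊆ C) {e : E} (he : e ∈ W.edges)
    (hx : D.Unbalanced (C \ {e}) x) (hv : G.Inc e v) : D.Unbalanced (C \ {e}) v := by
  obtain ⟨a, b, h, P, hC, hPW, U₁, U₂, rfl, rfl⟩ := hW.exists_cons he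
  have heP := hC.notMem_of_cons
  rw [Walk.edges_append, List.mem_append, not_or] at heP
  rw [Walk.edgeSet_append, Walk.edgeSet_cons, union_subset_iff, insert_subset_iff] at hWC
  rcases hv.eq_or_eq_of_isLink h with rfl | rfl
  · exact hx.of_conn (hD.conn_walk U₁ (subset_sdiff_singleton hWC.1 heP.2)).symm
  · exact hx.of_conn (hD.conn_walk U₂ (subset_sdiff_singleton hWC.2.2 heP.1))

/-- The rest of the cycle, read in the right direction, has the same value as `e`. -/
theorem conn_of_isBalancedCycle (hD : D.Orients ψ) (hC : ψ.IsBalancedCycle C) {e : E}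
    (he : e ∈ C) : D.Conn (C \ {e}) (D.src e) (D.gn e) (D.tgt e) := by
  obtain ⟨x, W, hW, rfl, h1⟩ := hC
  obtain ⟨a, b, h, P, hP, hPW, U₁, U₂, rfl, rfl⟩ := hW.exists_cons he
  have hg : ψ.gain e a b * ψ.walkGain (U₂.append U₁) = 1 := by
    rw [ψ.walkGain_append, GainFunction.walkGain] at h1
    rw [ψ.walkGain_append, ← mul_assoc]
    exact mul_eq_one_comm.1 h1
  have hc : D.Conn ((U₁.append (Walk.cons e h U₂)).edgeSet \ {e}) b
      (ψ.walkGain (U₂.append U₁)) a := by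
    refine hD.conn_walk _ (subset_sdiff_singleton ?_ hP.notMem_of_cons)
    rw [← hPW, Walk.edgeSet_cons]
    exact subset_insert _ _
  rw [mul_eq_one_iff_eq_inv'] at hg
  rw [hg] at hc
  rcases hD.eq_or h with ⟨rfl, rfl, hg⟩ | ⟨rfl, rfl, hg⟩
  · simpa [hg] using hc.symm
  · simpa [hg] using hc

/-- An unbalanced cycle survives the removal of `e`: in a theta graph the one formed by the two
paths avoiding `e`, in a handcuff one that does not contain `e`. Each end of `e` remains connected
to such a cycle. -/
theorem unbalanced_of_mem_circuit (hD : D.Orients ψ) (hC : IsTheta G C ∨ IsHandcuff G C)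
    (hb : ∀ D ⊆ C, IsCycle G D → ¬ ψ.IsBalancedCycle D) {e : E} (he : e ∈ C) {v : V}
    (hv : G.Inc e v) : D.Unbalanced (C \ {e}) v := by
  have hb' : ∀ {x : V} {W : Walk G x x}, W.IsSimpleClosed → W.edgeSet ⊆ C → ψ.walkGain W ≠ 1 :=
    fun hW hWC h1 => hb _ hWC ⟨_, _, hW, rfl⟩ ⟨_, _, hW, rfl, h1⟩
  rcases hC with ⟨x, y, P, Q, R, hne, hP, hQ, hR, hPQ, hPR, hQR, rfl⟩ | hC
  -- The three paths play symmetric roles, so the case where `e` is on the first one is proved for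
  -- arbitrary names.
  · have key : ∀ {C : Set E} {P Q R : Walk G x y}, P.IsPath → Q.IsPath → R.IsPath →
        InternallyDisjoint Q R → P.edgeSet ⊆ C → Q.edgeSet ⊆ C → R.edgeSet ⊆ C →
        (∀ {x : V} {W : Walk G x x}, W.IsSimpleClosed → W.edgeSet ⊆ C → ψ.walkGain W ≠ 1) →
        e ∈ P.edges → e ∉ Q.edges → e ∉ R.edges → D.Unbalanced (C \ {e}) v := by
      intro C P Q R hP hQ hR hQR hPC hQC hRC hb heP heQ heR
      have hW := hQR.isSimpleClosed hQ hR hne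
      have hWC : (Q.append R.reverse).edgeSet ⊆ C := by simp [hQC, hRC]
      have hWC' : (Q.append R.reverse).edgeSet ⊆ C \ {e} :=
        subset_sdiff_singleton hWC (by simp [heQ, heR])
      refine hD.unbalanced_of_mem_path hP hPC heP ?_ ?_ hv
      · exact hD.unbalanced_of_walk hWC' (hb hW hWC) (Walk.start_mem_vertices _)
      · exact hD.unbalanced_of_walk hWC' (hb hW hWC)
          ((Walk.mem_vertices_append _ _).2 (.inl Q.end_mem_vertices))
    have h1 := Set.disjoint_left.1 hPQ.1
    have h2 := Set.disjoint_left.1 hPR.1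
    have h3 := Set.disjoint_left.1 hQR.1
    simp only [Walk.mem_edgeSet] at h1 h2 h3
    have hPs : P.edgeSet ⊆ P.edgeSet ∪ Q.edgeSet ∪ R.edgeSet := by grind
    have hQs : Q.edgeSet ⊆ P.edgeSet ∪ Q.edgeSet ∪ R.edgeSet := by grind
    have hRs : R.edgeSet ⊆ P.edgeSet ∪ Q.edgeSet ∪ R.edgeSet := by grind
    rcases he with (he | he) | he
    · exact key hP hQ hR hQR hPs hQs hRs hb' he (h1 he) (h2 he)
    · exact key hQ hP hR hPR hQs hPs hRs hb' he (fun h => h1 h he) (h3 he)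
    · exact key hR hP hQ hPQ hRs hPs hQs hb' he (fun h => h2 h he) (fun h => h3 h he)
  · obtain ⟨x, y, U, W, P, hU, hW, hP, rfl, hUW, hPU, hPW, -⟩ := hC.exists_walks
    have hUP := (hP.disjoint_edgeSet hPU).symm
    have hWP := (hP.disjoint_edgeSet hPW).symm
    have hUs : U.edgeSet ⊆ U.edgeSet ∪ W.edgeSet ∪ P.edgeSet := by grind
    have hWs : W.edgeSet ⊆ U.edgeSet ∪ W.edgeSet ∪ P.edgeSet := by grind
    have hPs : P.edgeSet ⊆ U.edgeSet ∪ W.edgeSet ∪ P.edgeSet := subset_union_right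
    have hUu : e ∉ U.edgeSet → D.Unbalanced ((U.edgeSet ∪ W.edgeSet ∪ P.edgeSet) \ {e}) x :=
      fun h => hD.unbalanced_of_walk (subset_sdiff_singleton hUs h) (hb' hU hUs)
        U.start_mem_vertices
    have hWu : e ∉ W.edgeSet → D.Unbalanced ((U.edgeSet ∪ W.edgeSet ∪ P.edgeSet) \ {e}) y :=
      fun h => hD.unbalanced_of_walk (subset_sdiff_singleton hWs h) (hb' hW hWs)
        W.start_mem_vertices
    have hPc : e ∉ P.edgeSet → D.Conn ((U.edgeSet ∪ W.edgeSet ∪ P.edgeSet) \ {e}) x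
        (ψ.walkGain P) y := fun h => hD.conn_walk P (subset_sdiff_singleton hPs h)
    rcases he with (he | he) | he
    · exact hD.unbalanced_of_mem_cycle hU hUs he ((hWu (Set.disjoint_left.1 hUW he)).of_conn
        (hPc (Set.disjoint_left.1 hUP he))) hv
    · exact hD.unbalanced_of_mem_cycle hW hWs he ((hUu (Set.disjoint_right.1 hUW he)).of_conn
        (hPc (Set.disjoint_left.1 hWP he)).symm) hv
    · exact hD.unbalanced_of_mem_path hP hPs he (hUu (Set.disjoint_right.1 hUP he))
        (hWu (Set.disjoint_right.1 hWP he)) hv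

theorem _root_.GainGraph.GainFunction.IsFrameCircuit.subset (hC : ψ.IsFrameCircuit C) :
    C ⊆ G.edgeSet := by
  rcases hC with ⟨x, W, -, rfl, -⟩ | ⟨⟨x, y, P, Q, R, -, -, -, -, -, -, -, rfl⟩ | hC, -⟩
  · exact W.edgeSet_subset
  · exact union_subset (union_subset P.edgeSet_subset Q.edgeSet_subset) R.edgeSet_subset
  · obtain ⟨x, y, U, W, P, -, -, -, rfl, -⟩ := hC.exists_walks
    exact union_subset (union_subset U.edgeSet_subset W.edgeSet_subset) P.edgeSet_subset

theorem inClosure_of_isFrameCircuit (hD : D.Orients ψ) (hC : ψ.IsFrameCircuit C) {e : E}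
    (he : e ∈ C) : D.InClosure (C \ {e}) e := by
  have hl := (hD e (hC.subset he)).1
  rcases hC with hC | ⟨hC, hb⟩
  · exact .inl (hD.conn_of_isBalancedCycle hC he)
  · exact .inr ⟨hD.unbalanced_of_mem_circuit hC hb he hl.inc_left,
      hD.unbalanced_of_mem_circuit hC hb he hl.inc_right⟩

/-! ### Spanned elements are in frame circuits -/

/-- The edge `e` closes the path `R` to a cycle. If `R` meets the lollipop's cycle `W` in one
vertex, there is a tight handcuff; if in more, the part of the new cycle through `e` between the
first and last common vertices on `R` is an ear of `W` and gives a theta graph. If they are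
disjoint, the stick of the lollipop from its last vertex on `R` completes a loose handcuff. Nothing
is claimed about balance. -/
theorem exists_circuit_of_hasLollipop {e : E} (he : e ∉ X) {x y : V} (h : G.IsLink e x y)
    {R : Walk G x y} (hR : R.IsPath) (hRX : R.edgeSet ⊆ X) (hL : HasLollipop ψ X x) :
    ∃ C ⊆ insert e X, IsTheta G C ∨ IsHandcuff G C := by
  obtain ⟨z, P, W, hP, hPX, hW, hWX, -, hPW⟩ := hL
  have heR : e ∉ R.edges := fun h => he (hRX h)
  have hRX' : R.edgeSet ⊆ insert e X := hRX.trans (subset_insert _ _)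
  have hWX' : W.edgeSet ⊆ insert e X := hWX.trans (subset_insert _ _)
  have hPX' : P.edgeSet ⊆ insert e X := hPX.trans (subset_insert _ _)
  have hO := hR.isSimpleClosed_cons h.symm heR
  have hOv : ∀ u, u ∈ (Walk.cons e h.symm R).vertices ↔ u ∈ R.vertices := by
    intro u
    simp only [Walk.vertices, List.mem_cons]
    exact ⟨fun h => h.elim (fun h => h ▸ R.end_mem_vertices) id, .inr⟩
  have hOX : (Walk.cons e h.symm R).edgeSet ⊆ insert e X := by
    rw [Walk.edgeSet_cons]
    exact insert_subset_insert hRX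
  by_cases hRW : ∃ u ∈ R.vertices, u ∈ {u | u ∈ W.vertices}
  · obtain ⟨u, huW, R₁, R', rfl, hR₁⟩ := R.exists_append_first _ hRW
    obtain ⟨w, hwW, R₃, R₄, rfl, hR₄⟩ :=
      R'.exists_append_last _ ⟨u, R'.start_mem_vertices, huW⟩
    rcases eq_or_ne u w with rfl | hne
    · have hR₃ := hR.of_append_right.of_append_left.eq_nil
      have hOW : ∀ v, v ∈ (R₁.append (R₃.append R₄)).vertices → v ∈ W.vertices → v = u := by
        intro v hv hvW
        rw [Walk.mem_vertices_append, Walk.mem_vertices_append] at hv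
        rcases hv with hv | hv | hv
        · exact hR₁ v hv hvW
        · rw [hR₃] at hv
          simpa [Walk.vertices] using hv
        · exact hR₄ v hv hvW
      refine ⟨_ ∪ _, union_subset hOX hWX', .inr (.inl ⟨_, _, ⟨_, _, hO, rfl⟩, ⟨_, W, hW, rfl⟩,
        ?_, ⟨u, ?_⟩, rfl⟩)⟩
      · rw [Walk.edgeSet_cons, disjoint_insert_left]
        exact ⟨fun h => he (hWX h), hR.disjoint_edgeSet hOW⟩
      · rw [Walk.vertexSetOf_edgeSet _ hO.1, Walk.vertexSetOf_edgeSet _ hW.1]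
        ext v
        simp only [mem_inter_iff, mem_ofPred_eq, hOv, mem_singleton_iff]
        refine ⟨fun h => hOW v h.1 h.2, ?_⟩
        rintro rfl
        exact ⟨(Walk.mem_vertices_append _ _).2 (.inl R₁.end_mem_vertices), huW⟩
    · let ψ₀ : GainFunction G Unit := ⟨fun _ _ _ => 1, fun _ _ _ _ _ => rfl⟩
      obtain ⟨W', hW', hWe, -, hWv⟩ := hW.exists_rotate (ψ := ψ₀) huW
      obtain ⟨W₁, W₂, rfl⟩ := W'.exists_append_of_mem ((hWv w).2 hwW)
      have hR₁₄ : ∀ v ∈ R₁.vertices, v ∉ R₄.vertices := by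
        intro v h1 h4
        have h5 := hR.eq_of_mem_append h1 ((Walk.mem_vertices_append _ _).2 (.inr h4))
        subst h5
        exact hne (hR.of_append_right.eq_of_mem_append R₃.start_mem_vertices h4)
      -- The ear: back along `R` from `u` to `x`, across `e` to `y`, and back along `R` from `y` to
      -- `w`.
      let Q : Walk G u w := R₁.reverse.append (.cons e h R₄.reverse)
      have hQv : ∀ v, v ∈ Q.vertices ↔ v ∈ R₁.vertices ∨ v ∈ R₄.vertices := by
        intro v
        simp only [Q, Walk.mem_vertices_append, Walk.vertices_reverse, List.mem_reverse,
          Walk.vertices, List.mem_cons]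
        have := R₁.start_mem_vertices
        grind
      have hQe : ∀ f, f ∈ Q.edgeSet ↔ f ∈ R₁.edgeSet ∨ f = e ∨ f ∈ R₄.edgeSet := by
        intro f
        simp only [Q, Walk.edgeSet_append, Walk.edgeSet_cons, Walk.edgeSet_reverse,
          Set.mem_union, Set.mem_insert_iff]
      have hQ : Q.IsPath := by
        refine hR.of_append_left.reverse.append (Walk.isPath_cons.2 ⟨?_, ?_⟩) ?_
        · rw [Walk.vertices_reverse, List.mem_reverse]
          exact hR₁₄ _ R₁.start_mem_vertices
        · exact hR.of_append_right.of_append_right.reverse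
        · intro v hv hv'
          rw [Walk.vertices_reverse, List.mem_reverse] at hv
          simp only [Walk.vertices, List.mem_cons, Walk.vertices_reverse, List.mem_reverse] at hv'
          exact hv'.resolve_right (hR₁₄ v hv)
      have hQW : ∀ v, v ∈ Q.vertices → v ∈ W.vertices → v = u ∨ v = w := fun v hv hvW =>
        ((hQv v).1 hv).imp (fun h => hR₁ v h hvW) (fun h => hR₄ v h hvW)
      have hQWe : Disjoint Q.edgeSet W.edgeSet := by
        rw [Set.disjoint_left]
        intro f hf
        rcases (hQe f).1 hf with hf | rfl | hf
        · exact Set.disjoint_left.1 (hR.of_append_left.disjoint_edgeSet hR₁) hf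
        · exact fun h => he (hWX h)
        · exact Set.disjoint_left.1
            (hR.of_append_right.of_append_right.disjoint_edgeSet hR₄) hf
      rw [← hWe, Walk.edgeSet_append W₁, disjoint_union_right] at hQWe
      refine ⟨Q.edgeSet ∪ W₁.edgeSet ∪ W₂.reverse.edgeSet, ?_, .inl ⟨u, w, Q, W₁, W₂.reverse, hne,
        hQ, hW'.isPath_of_append hne,
        (hW'.append_comm.isPath_of_append hne.symm).reverse, ⟨hQWe.1, fun v hv hv' => ?_⟩,
        ⟨by simpa using hQWe.2, fun v hv hv' => ?_⟩, hW'.internallyDisjoint, rfl⟩⟩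
      · rw [union_assoc, Walk.edgeSet_reverse, ← Walk.edgeSet_append, hWe]
        refine union_subset (fun f hf => ?_) hWX'
        simp only [Walk.edgeSet_append, union_subset_iff] at hRX'
        rcases (hQe f).1 hf with hf | rfl | hf
        exacts [hRX'.1 hf, mem_insert _ _, hRX'.2.2 hf]
      · exact hQW v hv ((hWv v).1 ((Walk.mem_vertices_append _ _).2 (.inl hv')))
      · rw [Walk.vertices_reverse, List.mem_reverse] at hv'
        exact hQW v hv ((hWv v).1 ((Walk.mem_vertices_append _ _).2 (.inr hv')))
  · push Not at hRW
    obtain ⟨u, huR, P₁, P₂, rfl, hP₂⟩ := P.exists_append_last {u | u ∈ R.vertices}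
      ⟨x, P.start_mem_vertices, R.start_mem_vertices⟩
    rw [Walk.edgeSet_append, union_subset_iff] at hPX'
    refine ⟨_ ∪ _ ∪ P₂.edgeSet, union_subset (union_subset hOX hWX') hPX'.2,
      .inr (.inr ⟨_, _, ⟨_, _, hO, rfl⟩, ⟨_, W, hW, rfl⟩, ?_, u, z, P₂, hP.of_append_right,
        ?_, ?_, rfl⟩)⟩
    · rw [Walk.vertexSetOf_edgeSet _ hO.1, Walk.vertexSetOf_edgeSet _ hW.1, Set.disjoint_left]
      exact fun v hv => hRW v ((hOv v).1 hv)
    · rw [Walk.vertexSetOf_edgeSet _ hO.1]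
      ext v
      simp only [mem_inter_iff, mem_ofPred_eq, hOv, mem_singleton_iff]
      refine ⟨fun h => hP₂ v h.1 h.2, ?_⟩
      rintro rfl
      exact ⟨P₂.start_mem_vertices, huR⟩
    · rw [Walk.vertexSetOf_edgeSet _ hW.1]
      ext v
      simp only [mem_inter_iff, mem_ofPred_eq, mem_singleton_iff]
      refine ⟨fun h => hPW v ((Walk.mem_vertices_append _ _).2 (.inr h.1)) h.2, ?_⟩
      rintro rfl
      exact ⟨P₂.end_mem_vertices, W.start_mem_vertices⟩

/-- If `X` connects the ends of `e`, either a path of the right value closes up with `e` to a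
balanced cycle, or there is a lollipop at an end of `e`. If not, `e` joins two lollipops in
different components to a loose handcuff. -/
theorem exists_circuit_of_inClosure (hD : D.Orients ψ) (hX : X ⊆ G.edgeSet) {e : E}
    (heG : e ∈ G.edgeSet) (he : e ∉ X) (h : D.InClosure X e) :
    ∃ C ⊆ insert e X, ψ.IsBalancedCycle C ∨ IsTheta G C ∨ IsHandcuff G C := by
  obtain ⟨hl, hg⟩ := hD e heG
  by_cases hc : ∃ g, D.Conn X (D.src e) g (D.tgt e)
  · have main : HasLollipop ψ X (D.src e) →
        ∃ C ⊆ insert e X, ψ.IsBalancedCycle C ∨ IsTheta G C ∨ IsHandcuff G C := by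
      intro hL
      obtain ⟨g, hc⟩ := hc
      obtain ⟨R, hR, hRX⟩ := hD.exists_isPath hX hc hl.left_mem
      obtain ⟨C, hCX, hC⟩ := exists_circuit_of_hasLollipop he hl hR hRX hL
      exact ⟨C, hCX, .inr hC⟩
    rcases h with h | h
    · rcases hD.exists_isPath_or_hasLollipop hX h hl.left_mem with ⟨P, hP, hPX, hPg⟩ | hL
      · refine ⟨(Walk.cons e hl.symm P).edgeSet, ?_, .inl ⟨_, _,
          hP.isSimpleClosed_cons hl.symm fun h => he (hPX h), rfl, ?_⟩⟩
        · rw [Walk.edgeSet_cons]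
          exact insert_subset_insert hPX
        · rw [GainFunction.walkGain, hPg]
          rcases hD.eq_or hl.symm with ⟨h1, h2, h3⟩ | ⟨-, -, h3⟩
          -- Here `e` is a loop, so the path `P` is closed and hence trivial.
          · have hPg' : ψ.walkGain P = 1 := by
              clear hPX
              revert P
              rw [h1]
              intro P hP _
              rw [hP.eq_nil]
              rfl
            rw [h3, ← hPg, hPg', mul_one]
          · rw [h3, inv_mul_cancel]
      · exact main hL
    · exact main (hD.hasLollipop_of_unbalanced hX h.1 hl.left_mem)
  · have h := h.resolve_left fun h => hc ⟨_, h⟩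
    obtain ⟨z, P, W, hP, hPX, hW, hWX, -, hPW⟩ := hD.hasLollipop_of_unbalanced hX h.1 hl.left_mem
    obtain ⟨z', P', W', hP', hPX', hW', hWX', -, hPW'⟩ :=
      hD.hasLollipop_of_unbalanced hX h.2 hl.right_mem
    have hsep : ∀ v g g', D.Conn X (D.src e) g v → ¬ D.Conn X (D.tgt e) g' v :=
      fun v g g' h1 h2 => hc ⟨_, h1.trans h2.symm⟩
    have hconn : ∀ {x z : V} {P : Walk G x z} {W : Walk G z z}, P.edgeSet ⊆ X → W.edgeSet ⊆ X →
        ∀ v, v ∈ P.vertices ∨ v ∈ W.vertices → ∃ g, D.Conn X x g v := by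
      rintro x z P W hPX hWX v (hv | hv)
      · obtain ⟨g, hg⟩ := (hD.conn_of_mem_vertices hPX hv).1
        exact ⟨_, hg.symm⟩
      · obtain ⟨g, hg⟩ := (hD.conn_of_mem_vertices hWX hv).1
        exact ⟨_, (hD.conn_walk P hPX).trans hg.symm⟩
    have hdis : ∀ v, v ∈ P.vertices ∨ v ∈ W.vertices → v ∈ P'.vertices ∨ v ∈ W'.vertices →
        False := by
      intro v hv hv'
      obtain ⟨g, hg⟩ := hconn hPX hWX v hv
      obtain ⟨g', hg'⟩ := hconn hPX' hWX' v hv'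
      exact hsep v g g' hg hg'
    let Q : Walk G z z' := P.reverse.append (.cons e hl P')
    have hQv : ∀ v, v ∈ Q.vertices ↔ v ∈ P.vertices ∨ v ∈ P'.vertices := by
      intro v
      simp only [Q, Walk.mem_vertices_append, Walk.vertices_reverse, List.mem_reverse,
        Walk.vertices, List.mem_cons]
      have := P.start_mem_vertices
      grind
    have hXe : X ⊆ insert e X := subset_insert _ _
    refine ⟨W.edgeSet ∪ W'.edgeSet ∪ Q.edgeSet, ?_, .inr (.inr (.inr ⟨_, _, ⟨_, W, hW, rfl⟩,
      ⟨_, W', hW', rfl⟩, ?_, z, z', Q, ?_, ?_, ?_, rfl⟩))⟩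
    · simp only [Q, Walk.edgeSet_append, Walk.edgeSet_cons, Walk.edgeSet_reverse,
        union_subset_iff, insert_subset_iff]
      exact ⟨⟨hWX.trans hXe, hWX'.trans hXe⟩, hPX.trans hXe, mem_insert _ _, hPX'.trans hXe⟩
    · rw [Walk.vertexSetOf_edgeSet _ hW.1, Walk.vertexSetOf_edgeSet _ hW'.1, Set.disjoint_left]
      exact fun v hv hv' => hdis v (.inr hv) (.inr hv')
    · refine hP.reverse.append (Walk.isPath_cons.2 ⟨fun h => ?_, hP'⟩) fun v hv hv' => ?_
      · exact hdis _ (.inl P.start_mem_vertices) (.inl h)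
      · rw [Walk.vertices_reverse, List.mem_reverse] at hv
        simp only [Walk.vertices, List.mem_cons] at hv'
        exact hv'.resolve_right fun h => hdis v (.inl hv) (.inl h)
    · rw [Walk.vertexSetOf_edgeSet _ hW.1]
      ext v
      simp only [mem_inter_iff, mem_ofPred_eq, hQv, mem_singleton_iff]
      constructor
      · rintro ⟨h | h, h'⟩
        exacts [hPW v h h', (hdis v (.inr h') (.inl h)).elim]
      · rintro rfl
        exact ⟨.inl P.end_mem_vertices, W.start_mem_vertices⟩
    · rw [Walk.vertexSetOf_edgeSet _ hW'.1]
      ext v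
      simp only [mem_inter_iff, mem_ofPred_eq, hQv, mem_singleton_iff]
      constructor
      · rintro ⟨h | h, h'⟩
        exacts [(hdis v (.inl h) (.inr h')).elim, hPW' v h h']
      · rintro rfl
        exact ⟨.inr P'.end_mem_vertices, W'.start_mem_vertices⟩

/-- While `X` contains a frame circuit, one of its elements can be removed from `X` without changing
the closure. Once there is none, every frame circuit in `insert e X` passes through `e`. The theta
graph or handcuff found may have a balanced cycle, which is then itself the circuit. -/
theorem exists_isFrameCircuit (hD : D.Orients ψ) (hfin : X.Finite) (hX : X ⊆ G.edgeSet) {e : E}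
    (heG : e ∈ G.edgeSet) (he : e ∉ X) (h : D.InClosure X e) :
    ∃ C ⊆ insert e X, e ∈ C ∧ ψ.IsFrameCircuit C := by
  induction hn : X.ncard using Nat.strong_induction_on generalizing X with
  | _ n ih =>
    subst hn
    by_cases hC : ∃ C ⊆ X, ψ.IsFrameCircuit C
    · obtain ⟨C, hCX, hC⟩ := hC
      have hne : C.Nonempty := by
        rcases hC with ⟨x, W, hW, rfl, -⟩ | ⟨⟨x, y, P, Q, R, hne, -, -, -, -, -, -, rfl⟩ | hC, -⟩
        · exact List.exists_mem_of_ne_nil _ hW.1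
        · cases P with
          | nil => exact absurd rfl hne
          | cons f => exact ⟨f, by simp⟩
        · obtain ⟨x, y, U, W, P, hU, -, -, rfl, -⟩ := hC.exists_walks
          obtain ⟨f, hf⟩ := List.exists_mem_of_ne_nil _ hU.1
          exact ⟨f, .inl (.inl hf)⟩
      obtain ⟨f, hf⟩ := hne
      have hcl := (hD.inClosure_of_isFrameCircuit hC hf).mono (sdiff_subset_sdiff_left hCX)
      have h' : D.InClosure (X \ {f}) e :=
        ArrowData.InClosure.of_insert hcl (by rwa [insert_sdiff_singleton,
          insert_eq_of_mem (hCX hf)])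
      obtain ⟨C', hC', h1, h2⟩ := ih _
        (ncard_lt_ncard (sdiff_singleton_ssubset.2 (hCX hf)) hfin) (hfin.subset sdiff_subset)
        (sdiff_subset.trans hX) (fun h => he h.1) h' rfl
      exact ⟨C', hC'.trans (insert_subset_insert sdiff_subset), h1, h2⟩
    · push Not at hC
      have key : ∀ C ⊆ insert e X, ψ.IsFrameCircuit C → e ∈ C := by
        intro C hCX hCc
        by_contra heC
        exact hC C ((subset_insert_iff_of_notMem heC).1 hCX) hCc
      obtain ⟨C, hCX, hC⟩ := hD.exists_circuit_of_inClosure hX heG he h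
      rcases hC with hC | hC
      · exact ⟨C, hCX, key C hCX (.inl hC), .inl hC⟩
      · by_cases hb : ∀ D ⊆ C, IsCycle G D → ¬ ψ.IsBalancedCycle D
        · exact ⟨C, hCX, key C hCX (.inr ⟨hC, hb⟩), .inr ⟨hC, hb⟩⟩
        · push Not at hb
          obtain ⟨B, hBC, -, hB⟩ := hb
          exact ⟨B, hBC.trans hCX, key B (hBC.trans hCX) (.inl hB), .inl hB⟩

end ArrowData.Orients

end FrameCircuits

end GainGraph

namespace GainGraph

open Set

/-! ### The frame matroid determined by its closure operator -/

section FrameMatroid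

variable {V E Δ : Type*} [Group Δ] {G : Graph V E} {ψ : GainFunction G Δ}
  {D : ArrowData V E Δ} {X C F : Set E} {N : Matroid E}

/-- `N` is the frame matroid of the labelled arrows in `F`, described by its closure. -/
def ArrowData.IsFrameOf (D : ArrowData V E Δ) (F : Set E) (N : Matroid E) : Prop :=
  N.E = F ∧ ∀ X ⊆ F, ∀ e ∈ F, e ∈ N.closure X ↔ D.InClosure X e

namespace ArrowData.Orients

/-- `X` is independent and all of its gains are made trivial by some switching. -/
def IsBalancedIndep (N : Matroid E) (D : ArrowData V E Δ) (X : Set E) : Prop :=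
  N.Indep X ∧ ∃ φ : V → Δ, ∀ e ∈ X, (φ (D.src e))⁻¹ * D.gn e * φ (D.tgt e) = 1

/-- The vertex `w` is isolated in `X`, so `X` does not span `e`, and the switching value at `w` is
free to trivialise the gain of `e`. -/
theorem isBalancedIndep_insert (hD : D.Orients ψ) (hN : D.IsFrameOf G.edgeSet N)
    (hX : IsBalancedIndep N D X) {e : E} {x w : V} (h : G.IsLink e x w) (hxw : x ≠ w)
    (hw : w ∉ vertexSetOf G X) : IsBalancedIndep N D (insert e X) := by
  classical
  obtain ⟨hXi, φ, hφ⟩ := hX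
  have hXG : X ⊆ G.edgeSet := hN.1 ▸ hXi.subset_ground
  have hiso : ∀ f ∈ X, D.src f ≠ w ∧ D.tgt f ≠ w := by
    intro f hf
    have hl := (hD f (hXG hf)).1
    exact ⟨fun h => hw ⟨f, hf, h ▸ hl.inc_left⟩, fun h => hw ⟨f, hf, h ▸ hl.inc_right⟩⟩
  constructor
  · refine (hXi.notMem_closure_iff (hN.1.symm ▸ h.edge_mem)).1 ?_ |>.1
    rw [hN.2 X hXG e h.edge_mem, hD.inClosure_link h, not_or]
    constructor
    · exact fun hc => hxw (hc.symm.eq_of_isolated hiso).1.symm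
    · rintro ⟨-, g, hg, hc⟩
      exact hg (hc.eq_of_isolated hiso).2
  · refine ⟨Function.update φ w ((ψ.gain e x w)⁻¹ * φ x), fun f hf => ?_⟩
    rcases mem_insert_iff.1 hf with rfl | hf
    · rcases hD.eq_or h with ⟨h1, h2, h3⟩ | ⟨h1, h2, h3⟩
      · rw [← h1, ← h2, Function.update_of_ne hxw, Function.update_self, h3]
        group
      · rw [← h1, ← h2, Function.update_of_ne hxw, Function.update_self, h3]
        group
    · rw [Function.update_of_ne (hiso f hf).1, Function.update_of_ne (hiso f hf).2]
      exact hφ f hf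

theorem isBalancedIndep_union (hD : D.Orients ψ) (hN : D.IsFrameOf G.edgeSet N)
    (hX : IsBalancedIndep N D X) {x y : V} {P : Walk G x y} (hP : P.IsPath)
    (h : ∀ u ∈ P.vertices.tail, u ∉ vertexSetOf G X) :
    IsBalancedIndep N D (X ∪ P.edgeSet) := by
  induction P generalizing X with
  | nil => simpa using hX
  | @cons x z y e hl P ih =>
    rw [Walk.isPath_cons] at hP
    simp only [Walk.vertices, List.tail_cons] at h
    rw [Walk.edgeSet_cons, union_insert, ← insert_union]
    refine ih (hD.isBalancedIndep_insert hN hX hl ?_ (h z P.start_mem_vertices)) hP.2 ?_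
    · rintro rfl
      exact hP.1 P.start_mem_vertices
    · rintro u hu ⟨f, hf, hfu⟩
      have huP := P.mem_vertices_iff.2 (.inr hu)
      rcases mem_insert_iff.1 hf with rfl | hf
      · rcases hfu.eq_or_eq_of_isLink hl with rfl | rfl
        · exact hP.1 huP
        · exact hP.2.ne_of_mem_tail hu rfl
      · exact h u huP ⟨f, hf, hfu⟩

/-- With trivialised gains no vertex is unbalanced and the value of a walk depends only on its ends.
The walk `U` then shows that the gain of `e` is not such a value. -/
theorem indep_insert_of_walkGain_ne_one (hD : D.Orients ψ) (hN : D.IsFrameOf G.edgeSet N)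
    (hX : IsBalancedIndep N D X) {e : E} {x y : V} (h : G.IsLink e x y) {U : Walk G y x}
    (hU : U.edgeSet ⊆ X) (h1 : ψ.walkGain (Walk.cons e h U) ≠ 1) : N.Indep (insert e X) := by
  obtain ⟨hXi, φ, hφ⟩ := hX
  have hXG : X ⊆ G.edgeSet := hN.1 ▸ hXi.subset_ground
  have hpot : ∀ {x g y}, D.Conn X x g y → (φ x)⁻¹ * g * φ y = 1 := fun hc =>
    Subgroup.mem_bot.1 (hc.switch_mem ⊥ φ fun e he => Subgroup.mem_bot.2 (hφ e he))
  refine (hXi.notMem_closure_iff (hN.1.symm ▸ h.edge_mem)).1 ?_ |>.1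
  rw [hN.2 X hXG e h.edge_mem, hD.inClosure_link h, not_or]
  constructor
  · intro hc
    have h2 := hpot (hc.trans (hD.conn_walk U hU))
    rw [GainFunction.walkGain] at h1
    rw [mul_eq_one_iff_eq_inv] at h2
    exact h1 (mul_eq_left.1 h2 |> fun h => by simpa using h)
  · rintro ⟨⟨g, hg, hc⟩, -⟩
    have h2 := hpot hc
    rw [mul_eq_one_iff_eq_inv] at h2
    exact hg (by simpa using h2)

/-- A balanced cycle minus an edge is a path. Removing the first edge of `P` from a theta graph, or
an edge of the cycle `U` from a handcuff, leaves a tree and one edge `q` that closes an unbalanced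
cycle. The tree is grown path by path, each meeting the earlier ones only in its first vertex. -/
theorem exists_indep_sdiff_singleton (hD : D.Orients ψ) (hN : D.IsFrameOf G.edgeSet N)
    (hC : ψ.IsFrameCircuit C) : ∃ e ∈ C, N.Indep (C \ {e}) := by
  have h0 : IsBalancedIndep N D ∅ := ⟨N.empty_indep, 1, by simp⟩
  have hpath : ∀ {x y : V} {P : Walk G x y}, P.IsPath → IsBalancedIndep N D P.edgeSet := by
    intro x y P hP
    simpa using hD.isBalancedIndep_union hN h0 hP (by simp [vertexSetOf])
  rcases hC with ⟨x, W, hW, rfl, -⟩ | ⟨hC, hb⟩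
  · cases W with
    | nil => exact absurd rfl hW.1
    | cons e h P =>
      refine ⟨e, by simp, ?_⟩
      rw [Walk.edgeSet_cons, insert_sdiff_self_of_notMem (s := P.edgeSet) hW.notMem_of_cons]
      exact (hpath hW.isPath_of_cons).1
  have hb' : ∀ {x : V} {W : Walk G x x}, W.IsSimpleClosed → W.edgeSet ⊆ C → ψ.walkGain W ≠ 1 :=
    fun hW hWC h1 => hb _ hWC ⟨_, _, hW, rfl⟩ ⟨_, _, hW, rfl, h1⟩
  rcases hC with ⟨x, y, P, Q, R, hne, hP, hQ, hR, hPQ, hPR, hQR, rfl⟩ | hC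
  · cases P with
    | nil => exact absurd rfl hne
    | @cons _ a _ p hp P =>
    cases Q with
    | nil => exact absurd rfl hne
    | @cons _ b _ q hq Q =>
    have hcyc := hQR.isSimpleClosed hQ hR hne
    have h1 := hb' hcyc (by
      rw [Walk.edgeSet_append, Walk.edgeSet_reverse]
      grind)
    have hpP : p ∉ P.edgeSet := fun h => (List.nodup_cons.1 hP.nodup_edges).1 h
    rw [Walk.isPath_cons] at hP hQ
    have hPQe := hPQ.1
    have hPRe := hPR.1
    rw [Walk.edgeSet_cons] at hPQe hPRe
    rw [Walk.edgeSet_cons, disjoint_insert_left, disjoint_insert_right] at hPQe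
    rw [disjoint_insert_left] at hPRe
    have hT := hD.isBalancedIndep_union hN (hpath hR.reverse) hQ.2.reverse (by
      intro u hu hu'
      have h2 := hQ.2.reverse.ne_of_mem_tail hu
      have h3 := Q.reverse.mem_vertices_iff.2 (.inr hu)
      have h4 := Walk.mem_vertices_of_mem_vertexSetOf hu'
      rw [Walk.vertices_reverse, List.mem_reverse] at h3 h4
      rcases hQR.2 u (by simp [Walk.vertices, h3]) h4 with rfl | rfl
      exacts [hQ.1 h3, h2 rfl])
    have hT' := hD.isBalancedIndep_union hN hT hP.2.reverse (by
      intro u hu hu'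
      have h2 := hP.2.reverse.ne_of_mem_tail hu
      have h3 := P.reverse.mem_vertices_iff.2 (.inr hu)
      rw [vertexSetOf_union] at hu'
      rw [Walk.vertices_reverse, List.mem_reverse] at h3
      have h5 : u = x ∨ u = y := by
        rcases hu' with h4 | h4
        · have h4 := Walk.mem_vertices_of_mem_vertexSetOf h4
          rw [Walk.vertices_reverse, List.mem_reverse] at h4
          exact hPR.2 u (by simp [Walk.vertices, h3]) h4
        · have h4 := Walk.mem_vertices_of_mem_vertexSetOf h4
          rw [Walk.vertices_reverse, List.mem_reverse] at h4
          exact hPQ.2 u (by simp [Walk.vertices, h3]) (by simp [Walk.vertices, h4])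
      rcases h5 with rfl | rfl
      exacts [hP.1 h3, h2 rfl])
    have hfin := hD.indep_insert_of_walkGain_ne_one hN hT' hq (U := Q.append R.reverse) (by
      simp only [Walk.edgeSet_append, Walk.edgeSet_reverse]
      grind) h1
    refine ⟨p, by simp, ?_⟩
    convert hfin using 1
    simp only [Walk.edgeSet_cons, Walk.edgeSet_reverse]
    grind
  · obtain ⟨x, y, U, W, P, hU, hW, hP, rfl, hUW, hPU, hPW, hUWv⟩ := hC.exists_walks
    have h1 := hb' hW (by grind)
    have hUP := (hP.disjoint_edgeSet hPU).symm
    cases U with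
    | nil => exact absurd rfl hU.1
    | @cons _ a _ p hp U =>
    cases W with
    | nil => exact absurd rfl hW.1
    | @cons _ b _ q hq W =>
    have hpU := hU.notMem_of_cons
    rw [Walk.edgeSet_cons] at hUW hUP
    rw [Walk.edgeSet_cons, disjoint_insert_left, disjoint_insert_right] at hUW
    rw [disjoint_insert_left] at hUP
    have hT := hD.isBalancedIndep_union hN (hpath hW.isPath_of_cons) hP.reverse (by
      intro u hu hu'
      have h2 := hP.reverse.ne_of_mem_tail hu
      have h3 := P.reverse.mem_vertices_iff.2 (.inr hu)
      have h4 := Walk.mem_vertices_of_mem_vertexSetOf hu'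
      rw [Walk.vertices_reverse, List.mem_reverse] at h3
      exact h2 (hPW u h3 (by simp [Walk.vertices, h4])))
    have hT' := hD.isBalancedIndep_union hN hT hU.isPath_of_cons.reverse (by
      intro u hu hu'
      have h2 := hU.isPath_of_cons.reverse.ne_of_mem_tail hu
      have h3 := U.reverse.mem_vertices_iff.2 (.inr hu)
      rw [vertexSetOf_union] at hu'
      rw [Walk.vertices_reverse, List.mem_reverse] at h3
      have h3' : u ∈ (Walk.cons p hp U).vertices := by simp [Walk.vertices, h3]
      rcases hu' with h4 | h4
      · have h4 := Walk.mem_vertices_of_mem_vertexSetOf h4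
        exact h2 (hUWv u h3' (by simp [Walk.vertices, h4])).1
      · have h4 := Walk.mem_vertices_of_mem_vertexSetOf h4
        rw [Walk.vertices_reverse, List.mem_reverse] at h4
        exact h2 (hPU u h4 h3'))
    have hfin := hD.indep_insert_of_walkGain_ne_one hN hT' hq (U := W) (by grind) h1
    refine ⟨p, by simp, ?_⟩
    convert hfin using 1
    simp only [Walk.edgeSet_cons, Walk.edgeSet_reverse]
    rw [Walk.mem_edgeSet] at hUW
    have : p ∉ U.edgeSet := hpU
    grind

/-- The circuits of the frame matroid are the frame circuits if and only if its closure is the one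
given by the groupoid of walks. -/
theorem isFrameMatroid_iff (hD : D.Orients ψ) (hfin : G.edgeSet.Finite) :
    ψ.IsFrameMatroid N ↔ D.IsFrameOf G.edgeSet N := by
  refine ⟨fun ⟨hE, hN⟩ => ⟨hE, fun X hX e he => ?_⟩, fun h => ⟨h.1, fun C => ?_⟩⟩
  · by_cases heX : e ∈ X
    · exact iff_of_true (N.mem_closure_of_mem heX (hE ▸ hX)) (inClosure_of_mem heX)
    rw [N.mem_closure_iff_exists_isCircuit heX]
    constructor
    · rintro ⟨C, hCX, hC, heC⟩
      rw [hN] at hC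
      exact (hD.inClosure_of_isFrameCircuit hC heC).mono (sdiff_singleton_subset_iff.2 hCX)
    · intro h
      obtain ⟨C, hCX, heC, hC⟩ := hD.exists_isFrameCircuit (hfin.subset hX) hX he heX h
      exact ⟨C, hCX, (hN C).2 hC, heC⟩
  -- Each circuit of `N` contains a frame circuit and frame circuits are dependent, so only the
  -- minimality of frame circuits needs further argument.
  · have hcirc : ∀ C, N.IsCircuit C → ∀ e ∈ C, ∃ C' ⊆ C, e ∈ C' ∧ ψ.IsFrameCircuit C' := by
      intro C hC e he
      have hCG : C ⊆ G.edgeSet := h.1 ▸ hC.subset_ground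
      have h1 := hC.mem_closure_sdiff_singleton_of_mem he
      rw [h.2 _ (sdiff_subset.trans hCG) e (hCG he)] at h1
      obtain ⟨C', hC', h2, h3⟩ := hD.exists_isFrameCircuit
        (hfin.subset (sdiff_subset.trans hCG)) (sdiff_subset.trans hCG) (hCG he) (by simp) h1
      rw [insert_sdiff_singleton, insert_eq_of_mem he] at hC'
      exact ⟨C', hC', h2, h3⟩
    have hdep : ∀ C, ψ.IsFrameCircuit C → ∀ e ∈ C, e ∈ N.closure (C \ {e}) := by
      intro C hC e he
      rw [h.2 _ (sdiff_subset.trans hC.subset) e (hC.subset he)]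
      exact hD.inClosure_of_isFrameCircuit hC he
    have hdep' : ∀ C, ψ.IsFrameCircuit C → ¬ N.Indep C := by
      intro C hC hi
      obtain ⟨e, he, -⟩ := hD.exists_indep_sdiff_singleton h hC
      exact hi.notMem_closure_sdiff_of_mem he (hdep C hC e he)
    constructor
    · intro hC
      obtain ⟨e, he⟩ := hC.nonempty
      obtain ⟨C', hC', h2, h3⟩ := hcirc C hC e he
      rwa [← hC.eq_of_not_indep_subset (hdep' C' h3) hC']
    · intro hC
      obtain ⟨e, he, hi⟩ := hD.exists_indep_sdiff_singleton h hC
      have hCE : C ⊆ N.E := h.1 ▸ hC.subset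
      have hu := hi.fundCircuit_isCircuit (hdep C hC e he) (by simp)
      have huC : N.fundCircuit e (C \ {e}) ⊆ C := by
        refine (N.fundCircuit_subset_insert e _).trans ?_
        rw [insert_sdiff_singleton, insert_eq_of_mem he]
      convert hu
      refine (subset_antisymm huC fun f hf => ?_).symm
      -- If `f` were outside the fundamental circuit of `e`, then `C \ {e, f}` would span `e`. As `C
      -- \ {f}` spans `f`, so would `C \ {e, f}`, against the independence of `C \ {e}`.
      by_contra hfu
      have hne : e ≠ f := fun h => hfu (h ▸ N.mem_fundCircuit e _)
      have hef : e ∈ N.closure ((C \ {e}) \ {f}) := by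
        refine N.closure_subset_closure ?_
          (hu.mem_closure_sdiff_singleton_of_mem (N.mem_fundCircuit e _))
        exact fun a ha => ⟨⟨huC ha.1, ha.2⟩, fun h => hfu (h ▸ ha.1)⟩
      have h1 := hdep C hC f hf
      have h2 : insert e ((C \ {e}) \ {f}) = C \ {f} := by grind
      rw [← h2, Matroid.closure_insert_eq_of_mem_closure hef] at h1
      exact hi.notMem_closure_sdiff_of_mem ⟨hf, hne.symm⟩ h1

end ArrowData.Orients

end FrameMatroid

end GainGraph

namespace GainGraph

open Set

/-! ### Coherent sets -/

section Coherent

variable {V E Γ : Type*} [Group Γ] {Γ₁ : Subgroup Γ} {𝒜 : Set (Subgroup Γ)}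
  {D : ArrowData V E Γ} {X Y : Set E} {x y z : V} {g h : Γ} {e f : E}

theorem mem_map_conj {A : Subgroup Γ} :
    h ∈ A.map (MulAut.conj g).toMonoidHom ↔ g⁻¹ * h * g ∈ A := by
  rw [Subgroup.mem_map]
  constructor
  · rintro ⟨a, ha, rfl⟩
    simpa [mul_assoc] using ha
  · intro h'
    exact ⟨_, h', by simp [mul_assoc]⟩

/-- The trivial group and the groups in `𝒜` that meet `Γ₁` trivially. -/
def IsAdmissible (Γ₁ : Subgroup Γ) (𝒜 : Set (Subgroup Γ)) (B : Subgroup Γ) : Prop :=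
  B = ⊥ ∨ (B ∈ 𝒜 ∧ Disjoint B Γ₁)

namespace IsFrobeniusPartition

theorem eq_of_mem (hP : IsFrobeniusPartition Γ₁ 𝒜) {A B : Subgroup Γ}
    (hA : A ∈ insert Γ₁ 𝒜) (hB : B ∈ insert Γ₁ 𝒜) (hg : g ≠ 1) (hgA : g ∈ A) (hgB : g ∈ B) :
    A = B :=
  (hP.partition g hg).unique ⟨hA, hgA⟩ ⟨hB, hgB⟩

/-- The definition does not exclude `Γ₁ ∈ 𝒜`; an element outside `Γ₁` rules out `A = Γ₁`. -/
theorem disjoint_of_mem (hP : IsFrobeniusPartition Γ₁ 𝒜) {A : Subgroup Γ} (hA : A ∈ 𝒜)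
    (hg : g ∉ Γ₁) (hgA : g ∈ A) : Disjoint A Γ₁ := by
  rw [Subgroup.disjoint_def]
  intro u hu hu'
  by_contra h1
  exact hg (hP.eq_of_mem (.inr hA) (.inl rfl) h1 hu hu' ▸ hgA)

theorem exists_mem (hP : IsFrobeniusPartition Γ₁ 𝒜) (hg : g ∉ Γ₁) :
    ∃ A ∈ 𝒜, g ∈ A ∧ Disjoint A Γ₁ := by
  obtain ⟨A, ⟨hA, hgA⟩, -⟩ := hP.partition g fun h => hg (h ▸ Γ₁.one_mem)
  rcases hA with rfl | hA
  · exact absurd hgA hg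
  · exact ⟨A, hA, hgA, hP.disjoint_of_mem hA hg hgA⟩

theorem isAdmissible_conj (hP : IsFrobeniusPartition Γ₁ 𝒜) {B : Subgroup Γ}
    (hB : IsAdmissible Γ₁ 𝒜 B) (g : Γ) : IsAdmissible Γ₁ 𝒜 (B.map (MulAut.conj g).toMonoidHom) := by
  rcases hB with rfl | ⟨hB, hd⟩
  · exact .inl (Subgroup.map_bot _)
  · refine .inr ⟨hP.conj_mem B hB g, ?_⟩
    rw [Subgroup.disjoint_def] at hd ⊢
    intro u hu hu'
    rw [mem_map_conj] at hu
    have := hd hu (by simpa using hP.normal.conj_mem u hu' g⁻¹)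
    simpa [mul_assoc] using congrArg (fun k => g * k * g⁻¹) this

theorem eq_of_isAdmissible (hP : IsFrobeniusPartition Γ₁ 𝒜) {A B : Subgroup Γ} (hA : A ∈ 𝒜)
    (hB : IsAdmissible Γ₁ 𝒜 B) (hg : g ≠ 1) (hgA : g ∈ A) (hgB : g ∈ B) : B = A := by
  rcases hB with rfl | ⟨hB, -⟩
  · exact absurd (Subgroup.mem_bot.1 hgB) hg
  · exact hP.eq_of_mem (.inr hB) (.inr hA) hg hgB hgA

end IsFrobeniusPartition

theorem IsAdmissible.eq_one {B : Subgroup Γ} (hB : IsAdmissible Γ₁ 𝒜 B) (hg : g ∈ B)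
    (hg' : g ∈ Γ₁) : g = 1 := by
  rcases hB with rfl | ⟨-, hd⟩
  · exact Subgroup.mem_bot.1 hg
  · exact Subgroup.disjoint_def.1 hd hg hg'

theorem IsAdmissible.mem_of_ne {B : Subgroup Γ} (hB : IsAdmissible Γ₁ 𝒜 B) (hg : g ∈ B)
    (hg1 : g ≠ 1) : B ∈ 𝒜 ∧ Disjoint B Γ₁ :=
  hB.resolve_left fun h => hg1 (Subgroup.mem_bot.1 (h ▸ hg))

namespace ArrowData

/-- The values of the closed walks at `x` are in an admissible group. -/
def CoherentAt (Γ₁ : Subgroup Γ) (𝒜 : Set (Subgroup Γ)) (D : ArrowData V E Γ) (X : Set E) (x : V) :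
    Prop :=
  ∃ B, IsAdmissible Γ₁ 𝒜 B ∧ ∀ g, D.Conn X x g x → g ∈ B

/-- A set is coherent if it is coherent at all vertices. -/
def Coherent (Γ₁ : Subgroup Γ) (𝒜 : Set (Subgroup Γ)) (D : ArrowData V E Γ) (X : Set E) : Prop :=
  ∀ x, D.CoherentAt Γ₁ 𝒜 X x

/-- Admissible groups are closed under conjugation, so coherence needs checking at one vertex per
component. -/
theorem CoherentAt.of_conn (hP : IsFrobeniusPartition Γ₁ 𝒜) (hx : D.CoherentAt Γ₁ 𝒜 X x)
    (hc : D.Conn X y g x) : D.CoherentAt Γ₁ 𝒜 X y := by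
  obtain ⟨B, hB, hxB⟩ := hx
  refine ⟨_, hP.isAdmissible_conj hB g, fun k hk => mem_map_conj.2 (hxB _ ?_)⟩
  exact (hc.symm.trans hk).trans hc

theorem coherent_empty : D.Coherent Γ₁ 𝒜 ∅ :=
  fun _ => ⟨⊥, .inl rfl, fun _ hg => Subgroup.mem_bot.2 (hg.eq_of_isolated (by simp)).2⟩

theorem Conn.of_insert (hf : D.Conn X (D.src f) (D.gn f) (D.tgt f))
    (h : D.Conn (insert f X) x g y) : D.Conn X x g y := by
  simpa using h.map id 1 (MonoidHom.id Γ) (D' := D) (X' := X) fun e he => by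
    rcases mem_insert_iff.1 he with rfl | he
    · simpa using hf
    · simpa using arrow he

theorem Conn.of_insert_or (h : D.Conn (insert f X) x g y) :
    D.Conn X x g y ∨ ∃ k, D.Conn (insert f X) x k (D.src f) := by
  induction h with
  | refl x => exact .inl (.refl x)
  | fwd he _ ih =>
    rcases mem_insert_iff.1 he with rfl | he'
    · exact .inr ⟨1, .refl _⟩
    · exact ih.imp (fun h => .fwd he' h) fun ⟨k, hk⟩ => ⟨_, .fwd he hk⟩
  | bwd he _ ih =>
    rcases mem_insert_iff.1 he with rfl | he'
    · exact .inr ⟨_, .arrow_inv he⟩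
    · exact ih.imp (fun h => .bwd he' h) fun ⟨k, hk⟩ => ⟨_, .bwd he hk⟩

/-- The values of the closed walks at an end of a new edge `f` are in `B` if those of the closed
walks through `f` and two walks of the old graph are. -/
theorem Conn.mem_of_insert {B : Subgroup Γ} (h₁ : ∀ g, D.Conn X (D.src f) g (D.src f) → g ∈ B)
    (h₂ : ∀ g, D.Conn X (D.tgt f) g (D.tgt f) → D.gn f * g * (D.gn f)⁻¹ ∈ B)
    (h₃ : ∀ g, D.Conn X (D.src f) g (D.tgt f) → g * (D.gn f)⁻¹ ∈ B)
    (h : D.Conn (insert f X) (D.src f) g (D.src f)) : g ∈ B := by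
  -- Normal form of a walk ending at the source of `f`: a walk `k` of `X` up to the first use of
  -- `f`, followed by a part that contributes an element of `B` when based at that source.
  have key : ∀ {x g y}, D.Conn (insert f X) x g y → y = D.src f → ∃ b ∈ B, ∃ k,
      (D.Conn X x k (D.src f) ∧ g = k * b) ∨
        (D.Conn X x k (D.tgt f) ∧ g = k * (D.gn f)⁻¹ * b) := by
    intro x g y h
    induction h with
    | refl x =>
      rintro rfl
      exact ⟨1, B.one_mem, 1, .inl ⟨.refl _, by simp⟩⟩
    | @fwd e g z he _ ih =>
      intro hz
      obtain ⟨b, hb, k, hk⟩ := ih hz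
      rcases mem_insert_iff.1 he with rfl | he
      · rcases hk with ⟨hk, rfl⟩ | ⟨hk, rfl⟩
        · refine ⟨D.gn e * k * b, B.mul_mem ?_ hb, 1, .inl ⟨.refl _, by group⟩⟩
          simpa using B.inv_mem (h₃ _ hk.symm)
        · refine ⟨D.gn e * k * (D.gn e)⁻¹ * b, B.mul_mem (h₂ _ hk) hb, 1,
            .inl ⟨.refl _, by group⟩⟩
      · refine ⟨b, hb, D.gn e * k, hk.imp (fun h => ⟨.fwd he h.1, ?_⟩)
          (fun h => ⟨.fwd he h.1, ?_⟩)⟩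
        · rw [h.2]; group
        · rw [h.2]; group
    | @bwd e g z he _ ih =>
      intro hz
      obtain ⟨b, hb, k, hk⟩ := ih hz
      rcases mem_insert_iff.1 he with rfl | he
      · rcases hk with ⟨hk, rfl⟩ | ⟨hk, rfl⟩
        · exact ⟨k * b, B.mul_mem (h₁ _ hk) hb, 1, .inr ⟨.refl _, by group⟩⟩
        · exact ⟨k * (D.gn e)⁻¹ * b, B.mul_mem (h₃ _ hk) hb, 1, .inr ⟨.refl _, by group⟩⟩
      · refine ⟨b, hb, (D.gn e)⁻¹ * k, hk.imp (fun h => ⟨.bwd he h.1, ?_⟩)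
          (fun h => ⟨.bwd he h.1, ?_⟩)⟩
        · rw [h.2]; group
        · rw [h.2]; group
  obtain ⟨b, hb, k, ⟨hk, rfl⟩ | ⟨hk, rfl⟩⟩ := key h rfl
  · exact B.mul_mem (h₁ _ hk) hb
  · exact B.mul_mem (h₃ _ hk) hb

theorem Coherent.insert (hP : IsFrobeniusPartition Γ₁ 𝒜) (hX : D.Coherent Γ₁ 𝒜 X)
    (hf : D.CoherentAt Γ₁ 𝒜 (insert f X) (D.src f)) : D.Coherent Γ₁ 𝒜 (insert f X) := by
  intro z
  by_cases hz : ∃ k, D.Conn (Insert.insert f X) z k (D.src f)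
  · obtain ⟨k, hk⟩ := hz
    exact hf.of_conn hP hk
  · obtain ⟨B, hB, hzB⟩ := hX z
    exact ⟨B, hB, fun g hg => hzB g (hg.of_insert_or.resolve_right hz)⟩

theorem unbalanced_mapHom [Γ₁.Normal] :
    (D.mapHom (QuotientGroup.mk' Γ₁)).Unbalanced X x ↔ ∃ g, g ∉ Γ₁ ∧ D.Conn X x g x := by
  simp only [Unbalanced, conn_mapHom]
  constructor
  · rintro ⟨_, hk, g, rfl, hg⟩
    exact ⟨g, fun h => hk ((QuotientGroup.eq_one_iff g).2 h), hg⟩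
  · rintro ⟨g, hg, hc⟩
    exact ⟨_, fun h => hg ((QuotientGroup.eq_one_iff g).1 h), g, rfl, hc⟩

/-- If `X` connects the ends of `f`, then both are balanced modulo `Γ₁`, hence balanced by
coherence; the new closed walks are generated by one through `f`, whose value is outside `Γ₁` and so
in a group of `𝒜`. If not, one end has only trivial closed walk values, and the group at the other
end can be used. -/
theorem coherentAt_of_not_inClosure [Γ₁.Normal] (hP : IsFrobeniusPartition Γ₁ 𝒜)
    (hX : D.Coherent Γ₁ 𝒜 X) (hf : ¬ (D.mapHom (QuotientGroup.mk' Γ₁)).InClosure X f) :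
    D.CoherentAt Γ₁ 𝒜 (insert f X) (D.src f) := by
  rw [InClosure, not_or, conn_mapHom] at hf
  obtain ⟨hf₁, hf₂⟩ := hf
  have hf₁' : ∀ g, D.Conn X (D.src f) g (D.tgt f) → g * (D.gn f)⁻¹ ∉ Γ₁ := by
    intro g hg h
    refine hf₁ ⟨g, ?_, hg⟩
    have := (QuotientGroup.eq_one_iff _).2 h
    rw [QuotientGroup.mk_mul, QuotientGroup.mk_inv, mul_inv_eq_one] at this
    exact this
  -- An admissible group meets `Γ₁` trivially, so balance over `Γ ⧸ Γ₁` implies balance over `Γ`.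
  have htriv : ∀ x, ¬ (D.mapHom (QuotientGroup.mk' Γ₁)).Unbalanced X x →
      ∀ g, D.Conn X x g x → g = 1 := by
    intro x hx g hg
    rw [unbalanced_mapHom] at hx
    push Not at hx
    obtain ⟨B, hB, hxB⟩ := hX x
    exact hB.eq_one (hxB g hg) (not_imp_comm.1 (hx g) (not_not.2 hg))
  change ¬ ((D.mapHom (QuotientGroup.mk' Γ₁)).Unbalanced X (D.src f) ∧
    (D.mapHom (QuotientGroup.mk' Γ₁)).Unbalanced X (D.tgt f)) at hf₂
  by_cases hc : ∃ g, D.Conn X (D.src f) g (D.tgt f)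
  · obtain ⟨k, hk⟩ := hc
    have h₁ : ∀ g, D.Conn X (D.src f) g (D.src f) → g = 1 := by
      rcases not_and_or.1 hf₂ with h | h
      · exact htriv _ h
      · intro g hg
        have h2 := htriv _ h _ ((hk.symm.trans hg).trans hk)
        calc g = k * (k⁻¹ * g * k) * k⁻¹ := by group
          _ = 1 := by rw [h2]; group
    obtain ⟨A, hA, hkA, hd⟩ := hP.exists_mem (hf₁' k hk)
    refine ⟨A, .inr ⟨hA, hd⟩, fun g => Conn.mem_of_insert ?_ ?_ ?_⟩
    · intro g hg
      rw [h₁ g hg]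
      exact A.one_mem
    · intro g hg
      have : k * g * k⁻¹ = 1 := h₁ _ ((hk.trans hg).trans hk.symm)
      obtain rfl : g = 1 := by simpa using this
      simp [A.one_mem]
    · intro g hg
      have : g * k⁻¹ = 1 := h₁ _ (hg.trans hk.symm)
      rw [mul_inv_eq_one.1 this]
      exact hkA
  · rcases not_and_or.1 hf₂ with h | h
    · obtain ⟨B, hB, htB⟩ := hX (D.tgt f)
      refine ⟨_, hP.isAdmissible_conj hB (D.gn f), fun g => Conn.mem_of_insert ?_ ?_ ?_⟩
      · intro g hg
        rw [htriv _ h g hg]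
        exact Subgroup.one_mem _
      · intro g hg
        rw [mem_map_conj]
        simpa [mul_assoc] using htB g hg
      · exact fun g hg => absurd ⟨g, hg⟩ hc
    · obtain ⟨B, hB, hsB⟩ := hX (D.src f)
      refine ⟨B, hB, fun g => Conn.mem_of_insert hsB ?_ ?_⟩
      · intro g hg
        rw [htriv _ h g hg]
        simp [B.one_mem]
      · exact fun g hg => absurd ⟨g, hg⟩ hc

end ArrowData

end Coherent

/-! ### Coherent sets and the linear class -/

section LinearClass

variable {V E Γ : Type*} [Group Γ] {Γ₁ : Subgroup Γ} {𝒜 : Set (Subgroup Γ)}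
  {G : Graph V E} {ψ : GainFunction G Γ} {D : ArrowData V E Γ} {X C : Set E}

theorem GainFunction.walkGain_quotient [Γ₁.Normal] {x y : V} (W : Walk G x y) :
    (ψ.quotient Γ₁).walkGain W = QuotientGroup.mk' Γ₁ (ψ.walkGain W) := by
  induction W with
  | nil => exact (map_one _).symm
  | cons e h W ih =>
    rw [walkGain, walkGain, ih, map_mul]
    rfl

/-- Theta graphs and handcuffs are not cycles. -/
theorem not_isCycle_of_isTheta_or_isHandcuff (hC : IsTheta G C ∨ IsHandcuff G C) :
    ¬ IsCycle G C := by
  rintro ⟨a, O, hO, rfl⟩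
  -- Each of these graphs properly contains a cycle, but no cycle does.
  rcases hC with ⟨x, y, P, Q, R, hne, hP, hQ, hR, hPQ, hPR, hQR, hC⟩ | hC
  · have h1 := hO.edgeSet_eq_of_subset (hQR.isSimpleClosed hQ hR hne)
      (by rw [hC, Walk.edgeSet_append, Walk.edgeSet_reverse]; grind)
    cases P with
    | nil => exact hne rfl
    | cons p hp P =>
      have hp' : p ∈ (Walk.cons p hp P).edgeSet := by simp
      have hp'' : p ∈ O.edgeSet := hC ▸ .inl (.inl hp')
      rw [← h1, Walk.edgeSet_append, Walk.edgeSet_reverse] at hp''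
      rcases hp'' with h | h
      · exact Set.disjoint_left.1 hPQ.1 hp' h
      · exact Set.disjoint_left.1 hPR.1 hp' h
  · obtain ⟨x, y, U, W, P, hU, hW, hP, hC, hUW, -⟩ := hC.exists_walks
    have h1 := hO.edgeSet_eq_of_subset hU (by rw [hC]; grind)
    obtain ⟨e, he⟩ := List.exists_mem_of_ne_nil _ hW.1
    refine Set.disjoint_left.1 hUW ?_ (show e ∈ W.edgeSet from he)
    rw [h1, hC]
    exact .inl (.inr he)

namespace ArrowData.Orients

theorem exists_conn_of_isTheta_or_isHandcuff (hD : D.Orients ψ)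
    (hC : IsTheta G C ∨ IsHandcuff G C) :
    C.Nonempty ∧ ∃ x, ∀ e ∈ C, ∀ v, G.Inc e v → ∃ g, D.Conn C x g v := by
  have hw : ∀ {x y : V} (W : Walk G x y), W.edgeSet ⊆ C → ∀ e ∈ W.edgeSet, ∀ v, G.Inc e v →
      ∃ g, D.Conn C x g v := by
    rintro x y W hW e he v ⟨u, hv⟩
    obtain ⟨g, hg⟩ := (hD.conn_of_mem_vertices hW (Walk.mem_vertices_of_isLink he hv)).1
    exact ⟨_, hg.symm⟩
  rcases hC with ⟨x, y, P, Q, R, hne, -, -, -, -, -, -, rfl⟩ | hC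
  · constructor
    · cases P with
      | nil => exact absurd rfl hne
      | cons p => exact ⟨p, by simp⟩
    · refine ⟨x, ?_⟩
      rintro e ((he | he) | he)
      exacts [hw P (by grind) e he, hw Q (by grind) e he, hw R (by grind) e he]
  · obtain ⟨x, y, U, W, P, hU, hW, hP, rfl, -⟩ := hC.exists_walks
    constructor
    · obtain ⟨e, he⟩ := List.exists_mem_of_ne_nil _ hW.1
      exact ⟨e, .inl (.inr he)⟩
    · refine ⟨x, ?_⟩
      rintro e ((he | he) | he) v hv
      · exact hw U (by grind) e he v hv
      · obtain ⟨g, hg⟩ := hw W (by grind) e he v hv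
        exact ⟨_, (hD.conn_walk P (by grind)).trans hg⟩
      · exact hw P (by grind) e he v hv

/-- A cycle balanced modulo `Γ₁` has value in `B ∩ Γ₁ = 1`. A theta graph or handcuff is connected,
so switching along walks from a base vertex turns its gains into closed walk values in `B`; an
unbalanced closed walk shows that `B` is not trivial. -/
theorem mem_linearClass_of_coherent [Γ₁.Normal] (hD : D.Orients ψ)
    (hX : D.Coherent Γ₁ 𝒜 X) (hCX : C ⊆ X) (hC : (ψ.quotient Γ₁).IsFrameCircuit C) :
    C ∈ ψ.linearClass Γ₁ 𝒜 := by
  classical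
  refine ⟨hC, ?_⟩
  rcases hC with ⟨x, W, hW, rfl, h1⟩ | ⟨hC, hb⟩
  · left
    refine ⟨x, W, hW, rfl, ?_⟩
    rw [GainFunction.walkGain_quotient] at h1
    obtain ⟨B, hB, hxB⟩ := hX x
    exact hB.eq_one (hxB _ (hD.conn_walk W hCX)) ((QuotientGroup.eq_one_iff _).1 h1)
  · right
    refine ⟨hC.symm, ?_⟩
    obtain ⟨⟨e, he⟩, x, hx⟩ := hD.exists_conn_of_isTheta_or_isHandcuff hC
    have hCG : C ⊆ G.edgeSet := GainFunction.IsFrameCircuit.subset (.inr ⟨hC, hb⟩)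
    have hl := (hD e (hCG he)).1
    obtain ⟨u, hu, huc⟩ := unbalanced_mapHom.1
      ((hD.quotient Γ₁).unbalanced_of_mem_circuit hC hb he hl.inc_left)
    obtain ⟨g₀, hg₀⟩ := hx e he _ hl.inc_left
    obtain ⟨B, hB, hxB⟩ := hX x
    have hu' : g₀ * u * g₀⁻¹ ∈ B :=
      hxB _ (((hg₀.trans (huc.mono sdiff_subset)).trans hg₀.symm).mono hCX)
    have hBA := hB.mem_of_ne hu' fun h => hu (by
      obtain rfl : u = 1 := by simpa using h
      exact Γ₁.one_mem)
    -- The inverse of the value of a chosen walk from `x` to `v`: a switched gain is the value of a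
    -- closed walk at `x`. The value 1 at unreachable vertices plays no role.
    let η : V → Γ := fun v => if h : ∃ g, D.Conn C x g v then h.choose⁻¹ else 1
    have hη : ∀ v, (∃ g, D.Conn C x g v) → D.Conn C x (η v)⁻¹ v := by
      intro v hv
      simp only [η, dif_pos hv, inv_inv]
      exact hv.choose_spec
    refine ⟨η, B, hBA.1, ?_⟩
    rintro _ ⟨f, hf, a, b, hab, rfl⟩
    have h2 := ((hη a (hx f hf a hab.inc_left)).trans (hD.conn_link hab hf)).trans
      (hη b (hx f hf b hab.inc_right)).symm
    rw [inv_inv] at h2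
    exact hxB _ (h2.mono hCX)

/-- Edges are added one by one. If `f` is spanned, it lies in a circuit `C` of the linear class. If
`C` is balanced, `f` adds no walk values. Otherwise the switched gains of `C` lie in `A`, and since
`C \ {f}` still has nontrivial closed walks at both ends of `f`, the groups there are the
corresponding conjugates of `A`. Malnormality handles old walks between the ends. -/
theorem coherent_of_forall_mem_linearClass [hN : Γ₁.Normal] (hP : IsFrobeniusPartition Γ₁ 𝒜)
    (hD : D.Orients ψ) (hfin : X.Finite) (hXG : X ⊆ G.edgeSet)
    (hX : ∀ C ⊆ X, (ψ.quotient Γ₁).IsFrameCircuit C → C ∈ ψ.linearClass Γ₁ 𝒜) :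
    D.Coherent Γ₁ 𝒜 X := by
  induction X, hfin using Set.Finite.induction_on with
  | empty => exact coherent_empty
  | @insert f Y hfY hY ih =>
    have hYG := (subset_insert _ _).trans hXG
    have hf := hXG (mem_insert _ _)
    have hYc := ih hYG fun C hC => hX C (hC.trans (subset_insert _ _))
    by_cases hcl : (D.mapHom (QuotientGroup.mk' Γ₁)).InClosure Y f
    swap
    · exact hYc.insert hP (coherentAt_of_not_inClosure hP hYc hcl)
    obtain ⟨C, hCY, hfC, hC⟩ := (hD.quotient Γ₁).exists_isFrameCircuit hY hYG hf hfY hcl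
    have hCY' : C \ {f} ⊆ Y := sdiff_singleton_subset_iff.2 hCY
    obtain ⟨-, hC' | ⟨hC', η, A, hA, hηA⟩⟩ := hX C hCY hC
    · intro x
      obtain ⟨B, hB, hxB⟩ := hYc x
      exact ⟨B, hB, fun g hg =>
        hxB g (((hD.conn_of_isBalancedCycle hC' hfC).mono hCY').of_insert hg)⟩
    rcases hC with ⟨x, W, hW, hWC, -⟩ | ⟨-, hb⟩
    · exact absurd ⟨x, W, hW, hWC⟩ (not_isCycle_of_isTheta_or_isHandcuff hC'.symm)
    have hl := (hD f hf).1
    have hgain : ∀ e ∈ C, (η (D.src e))⁻¹ * D.gn e * η (D.tgt e) ∈ A := by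
      intro e he
      obtain ⟨h1, h2⟩ := hD e (hXG (hCY he))
      exact h2 ▸ hηA ⟨e, he, _, _, h1, rfl⟩
    have key : ∀ v, G.Inc f v → ∃ u, u ≠ 1 ∧ (η v)⁻¹ * u * η v ∈ A ∧ D.Conn Y v u v ∧
        ∀ g, D.Conn Y v g v → (η v)⁻¹ * g * η v ∈ A := by
      intro v hv
      obtain ⟨u, hu, huc⟩ := unbalanced_mapHom.1
        ((hD.quotient Γ₁).unbalanced_of_mem_circuit hC'.symm hb hfC hv)
      have hu1 : u ≠ 1 := fun h => hu (h ▸ Γ₁.one_mem)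
      have huA := huc.switch_mem A η fun e he => hgain e he.1
      obtain ⟨B, hB, hvB⟩ := hYc v
      have := hP.eq_of_isAdmissible (hP.conj_mem A hA (η v)) hB hu1 (mem_map_conj.2 huA)
        (hvB u (huc.mono hCY'))
      exact ⟨u, hu1, huA, huc.mono hCY', fun g hg => mem_map_conj.1 (this ▸ hvB g hg)⟩
    have hdA : Disjoint A Γ₁ := by
      obtain ⟨u, hu, huc⟩ := unbalanced_mapHom.1
        ((hD.quotient Γ₁).unbalanced_of_mem_circuit hC'.symm hb hfC hl.inc_left)
      refine hP.disjoint_of_mem hA (fun h => hu ?_)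
        (huc.switch_mem A η fun e he => hgain e he.1)
      simpa [mul_assoc] using hN.conj_mem _ h (η (D.src f))
    obtain ⟨-, -, -, -, hs⟩ := key _ hl.inc_left
    obtain ⟨u, hu1, huA, huc, ht⟩ := key _ hl.inc_right
    refine hYc.insert hP ⟨_, hP.isAdmissible_conj (.inr ⟨hA, hdA⟩) (η (D.src f)), fun g =>
      Conn.mem_of_insert ?_ ?_ ?_⟩
    · exact fun g hg => mem_map_conj.2 (hs g hg)
    · intro g hg
      rw [mem_map_conj]
      convert A.mul_mem (A.mul_mem (hgain f hfC) (ht g hg)) (A.inv_mem (hgain f hfC)) using 1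
      group
    · intro k hk
      rw [mem_map_conj]
      -- After switching, `k` conjugates a nontrivial element of `A` into `A`, so it lies in `A`.
      have hq : (η (D.src f))⁻¹ * k * η (D.tgt f) ∈ A := by
        by_contra hq
        have h1 := hs _ ((hk.trans huc).trans hk.symm)
        have := hP.malnormal A hA _ (fun h => hq (inv_inv ((η (D.src f))⁻¹ * k * η (D.tgt f)) ▸
          A.inv_mem h)) _ huA (by convert h1 using 1; group)
        exact hu1 (by
          simpa [mul_assoc] using congrArg (fun a => η (D.tgt f) * a * (η (D.tgt f))⁻¹) this)
      convert A.mul_mem hq (A.inv_mem (hgain f hfC)) using 1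
      group

end ArrowData.Orients

end LinearClass

/-! ### Lift matroids in terms of arrows -/

section Lift

variable {V E Γ : Type*} [Group Γ] {Γ₁ : Subgroup Γ} {𝒜 : Set (Subgroup Γ)}
  {G : Graph V E} {ψ : GainFunction G Γ} {D : ArrowData V E Γ}

open Classical in
/-- `M` is the lift matroid of the labelled arrows in `F`. -/
def ArrowData.IsLiftOf (Γ₁ : Subgroup Γ) [Γ₁.Normal] (𝒜 : Set (Subgroup Γ)) (D : ArrowData V E Γ)
    (F : Set E) (M : Matroid E) : Prop :=
  ∃ N : Matroid E, (D.mapHom (QuotientGroup.mk' Γ₁)).IsFrameOf F N ∧ M.E = F ∧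
    ∀ X ⊆ F, M.eRk X = if D.Coherent Γ₁ 𝒜 X then N.eRk X else N.eRk X + 1

theorem ArrowData.Orients.isLiftMatroid_iff [Γ₁.Normal] (hP : IsFrobeniusPartition Γ₁ 𝒜)
    (hD : D.Orients ψ) (hfin : G.edgeSet.Finite) {M : Matroid E} :
    ψ.IsLiftMatroid Γ₁ 𝒜 M ↔ D.IsLiftOf Γ₁ 𝒜 G.edgeSet M := by
  refine exists_congr fun N => ?_
  rw [(hD.quotient Γ₁).isFrameMatroid_iff hfin]
  refine and_congr_right fun hN => and_congr_right fun _ => forall₂_congr fun X hX => ?_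
  have hN' := ((hD.quotient Γ₁).isFrameMatroid_iff hfin).2 hN
  have : (∀ C ⊆ X, N.IsCircuit C → C ∈ ψ.linearClass Γ₁ 𝒜) ↔ D.Coherent Γ₁ 𝒜 X := by
    simp only [hN'.2]
    exact ⟨hD.coherent_of_forall_mem_linearClass hP (hfin.subset hX) hX,
      fun h C hC => hD.mem_linearClass_of_coherent h hC⟩
  by_cases h : D.Coherent Γ₁ 𝒜 X
  · rw [if_pos h, if_pos (this.2 h)]
  · rw [if_neg h, if_neg fun h' => h (this.1 h')]

end Lift

end GainGraph

namespace GainGraph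

open Set
open scoped Matroid

/-! ### Minors of lift matroids -/

section MatroidRank

variable {α : Type*} {M : Matroid α} {X : Set α} {e : α}

theorem eRk_contract_singleton_add_one (he : M.IsNonloop e) (hX : X ⊆ M.E \ {e}) :
    (M ／ {e}).eRk X + 1 = M.eRk (insert e X) := by
  obtain ⟨J, hJ⟩ := (M ／ {e}).exists_isBasis X hX
  have h := he.indep.union_isBasis_union_of_contract_isBasis hJ
  have heJ : e ∉ J := fun h => (hX (hJ.subset h)).2 rfl
  rw [← union_singleton, ← h.encard_eq_eRk, ← hJ.encard_eq_eRk, union_singleton,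
    encard_insert_of_notMem heJ]

end MatroidRank

namespace ArrowData

variable {V E Δ : Type*} [Group Δ] {D : ArrowData V E Δ} {F S X : Set E} {N : Matroid E} {e f : E}
  {x y z v : V} {g q a : Δ}

theorem IsFrameOf.delete (h : D.IsFrameOf F N) (S : Set E) : D.IsFrameOf (F \ S) (N ＼ S) := by
  obtain ⟨rfl, h⟩ := h
  refine ⟨rfl, fun X hX f hf => ?_⟩
  rw [N.delete_closure_eq_of_disjoint (disjoint_sdiff_left.mono_left hX), mem_sdiff,
    h X (hX.trans sdiff_subset) f hf.1]
  exact and_iff_left hf.2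

theorem IsFrameOf.contract {D' : ArrowData V E Δ} (h : D.IsFrameOf F N)
    (h' : ∀ X ⊆ F \ {e}, ∀ f ∈ F \ {e}, D'.InClosure X f ↔ D.InClosure (insert e X) f)
    (he : e ∈ F) : D'.IsFrameOf (F \ {e}) (N ／ {e}) := by
  obtain ⟨rfl, h⟩ := h
  refine ⟨rfl, fun X hX f hf => ?_⟩
  rw [N.contract_closure_eq, union_singleton, mem_sdiff, h' X hX f hf,
    h _ (insert_subset he (hX.trans sdiff_subset)) f hf.1]
  exact and_iff_left hf.2

/-- `q` is the gain of an orientation from `x` to `z` of an edge in `X`. -/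
def Step (D : ArrowData V E Δ) (X : Set E) (x : V) (q : Δ) (z : V) : Prop :=
  ∃ e ∈ X, (x = D.src e ∧ z = D.tgt e ∧ q = D.gn e) ∨ (x = D.tgt e ∧ z = D.src e ∧ q = (D.gn e)⁻¹)

theorem Step.conn (h : D.Step X x q z) : D.Conn X x q z := by
  obtain ⟨e, he, ⟨rfl, rfl, rfl⟩ | ⟨rfl, rfl, rfl⟩⟩ := h
  exacts [.arrow he, .arrow_inv he]

/-- Treats the two directions of an arrow as one case. -/
theorem Conn.step_induction {P : V → Δ → V → Prop} (refl : ∀ x, P x 1 x)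
    (step : ∀ {x q z g y}, D.Step X x q z → P z g y → P x (q * g) y) (h : D.Conn X x g y) :
    P x g y := by
  induction h with
  | refl => exact refl _
  | fwd he _ ih => exact step ⟨_, he, .inl ⟨rfl, rfl, rfl⟩⟩ ih
  | bwd he _ ih => exact step ⟨_, he, .inr ⟨rfl, rfl, rfl⟩⟩ ih

theorem Step.of_insert (h : D.Step (insert e X) x q z) :
    D.Step X x q z ∨ D.Step {e} x q z := by
  obtain ⟨f, hf, h⟩ := h
  rcases mem_insert_iff.1 hf with rfl | hf
  exacts [.inr ⟨f, rfl, h⟩, .inl ⟨f, hf, h⟩]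

/-! ### Contracting a link -/

open Classical in
/-- The retraction of the vertices that maps the last vertex of `e` to the first one. -/
noncomputable def merge (D : ArrowData V E Δ) (e : E) (x : V) : V :=
  if x = D.tgt e then D.src e else x

open Classical in
/-- The switching function that makes the gain of `e` trivial. -/
noncomputable def mergeGain (D : ArrowData V E Δ) (e : E) (x : V) : Δ :=
  if x = D.tgt e then (D.gn e)⁻¹ else 1

/-- The labelled arrows after contracting the link `e`. -/
noncomputable def contractLink (D : ArrowData V E Δ) (e : E) : ArrowData V E Δ where
  src f := D.merge e (D.src f)
  tgt f := D.merge e (D.tgt f)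
  gn f := (D.mergeGain e (D.src f))⁻¹ * D.gn f * D.mergeGain e (D.tgt f)

/-- Contraction commutes with reduction modulo `Γ₁`, so the frame part can be checked over the
quotient. -/
theorem contractLink_mapHom {Δ' : Type*} [Group Δ'] (φ : Δ →* Δ') :
    (D.contractLink e).mapHom φ = (D.mapHom φ).contractLink e := by
  have h : ∀ x, (D.mapHom φ).mergeGain e x = φ (D.mergeGain e x) := by
    intro x
    simp only [mergeGain, apply_ite φ, map_inv, map_one]
    rfl
  have h' : ∀ f, φ (D.gn f) = (D.mapHom φ).gn f := fun _ => rfl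
  simp only [contractLink, mapHom, map_mul, map_inv, ← h]
  rfl

theorem conn_merge (he : e ∈ X) : D.Conn X (D.merge e x) (D.mergeGain e x)⁻¹ x := by
  unfold merge mergeGain
  split_ifs with h
  · rw [inv_inv, h]
    exact .arrow he
  · simpa using Conn.refl (D := D) (X := X) x

/-- Each vertex is joined to its image under `merge` by a walk using at most `e`, with value the
inverse of `mergeGain`. -/
theorem conn_contractLink (hne : D.src e ≠ D.tgt e) :
    (D.contractLink e).Conn X (D.merge e x)
      ((D.mergeGain e x)⁻¹ * g * D.mergeGain e y) (D.merge e y) ↔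
      D.Conn (insert e X) x g y := by
  constructor
  · intro h
    have h1 : D.Conn (insert e X) (D.merge e x) ((D.mergeGain e x)⁻¹ * g * D.mergeGain e y)
        (D.merge e y) := by
      simpa using h.map id 1 (MonoidHom.id Δ) (D' := D) (X' := insert e X) fun f hf => by
        have := ((conn_merge (D := D) (x := D.src f) (mem_insert e X)).trans
          (.arrow (mem_insert_of_mem e hf))).trans
          (conn_merge (D := D) (x := D.tgt f) (mem_insert e X)).symm
        simpa [contractLink] using this
    convert ((conn_merge (D := D) (x := x) (mem_insert e X)).symm.trans h1).trans
      (conn_merge (D := D) (x := y) (mem_insert e X)) using 1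
    group
  · intro h
    refine h.map (D.merge e) (D.mergeGain e) (MonoidHom.id Δ) fun f hf => ?_
    rcases mem_insert_iff.1 hf with rfl | hf
    · simpa [merge, mergeGain, hne] using Conn.refl (D := D.contractLink f) (X := X) (D.src f)
    · exact .arrow hf

theorem unbalanced_contractLink (hne : D.src e ≠ D.tgt e) :
    (D.contractLink e).Unbalanced X (D.merge e x) ↔ D.Unbalanced (insert e X) x := by
  constructor
  · rintro ⟨g, hg, hc⟩
    refine ⟨D.mergeGain e x * g * (D.mergeGain e x)⁻¹, fun h => hg (by simpa using h),
      (conn_contractLink hne).1 ?_⟩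
    convert hc using 1
    group
  · rintro ⟨g, hg, hc⟩
    refine ⟨_, fun h => hg ?_, (conn_contractLink hne).2 hc⟩
    calc g = D.mergeGain e x * ((D.mergeGain e x)⁻¹ * g * D.mergeGain e x) *
          (D.mergeGain e x)⁻¹ := by group
      _ = 1 := by rw [h]; group

theorem inClosure_contractLink (hne : D.src e ≠ D.tgt e) :
    (D.contractLink e).InClosure X f ↔ D.InClosure (insert e X) f :=
  or_congr (conn_contractLink hne)
    (and_congr (unbalanced_contractLink hne) (unbalanced_contractLink hne))

/-! ### Contracting an unbalanced loop -/

open Classical in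
/-- The labelled arrows after contracting an unbalanced loop `e`: links at the vertex `v` of `e`
become loops at their other ends, and the other loops at `v` get the gains `b`. -/
noncomputable def contractLoop (D : ArrowData V E Δ) (e : E) (b : E → Δ) : ArrowData V E Δ where
  src f := if D.src f = D.src e then D.tgt f else D.src f
  tgt f := if D.tgt f = D.src e then D.src f else D.tgt f
  gn f := if D.src f = D.src e then
      if D.tgt f = D.src e then b f else (D.gn f)⁻¹ * D.gn e * D.gn f
    else if D.tgt f = D.src e then D.gn f * D.gn e * (D.gn f)⁻¹ else D.gn f

theorem contractLoop_mapHom {Δ' : Type*} [Group Δ'] (φ : Δ →* Δ') {b : E → Δ} :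
    (D.contractLoop e b).mapHom φ = (D.mapHom φ).contractLoop e (φ ∘ b) := by
  simp only [contractLoop, mapHom, Function.comp, apply_ite φ, map_mul, map_inv]
  rfl

section Loop

variable {b : E → Δ}

theorem conn_contractLoop_of_step (h : D.Step X x q z) (hx : x ≠ D.src e) (hz : z ≠ D.src e) :
    (D.contractLoop e b).Conn X x q z := by
  obtain ⟨f, hf, ⟨rfl, rfl, rfl⟩ | ⟨rfl, rfl, rfl⟩⟩ := h
  · simpa [contractLoop, hx, hz] using Conn.arrow (D := D.contractLoop e b) hf
  · simpa [contractLoop, hx, hz] using Conn.arrow_inv (D := D.contractLoop e b) hf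

theorem conn_contractLoop_of_step_left (h : D.Step X x q (D.src e)) (hx : x ≠ D.src e) :
    (D.contractLoop e b).Conn X x (q * D.gn e * q⁻¹) x := by
  obtain ⟨f, hf, ⟨rfl, h, rfl⟩ | ⟨rfl, h, rfl⟩⟩ := h
  · simpa [contractLoop, hx, ← h] using Conn.arrow (D := D.contractLoop e b) hf
  · simpa [contractLoop, hx, ← h] using Conn.arrow (D := D.contractLoop e b) hf

theorem Step.symm (h : D.Step X x q z) : D.Step X z q⁻¹ x := by
  obtain ⟨f, hf, ⟨rfl, rfl, rfl⟩ | ⟨rfl, rfl, rfl⟩⟩ := h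
  · exact ⟨f, hf, .inr ⟨rfl, rfl, rfl⟩⟩
  · exact ⟨f, hf, .inl ⟨rfl, rfl, inv_inv _⟩⟩

/-- A new loop at the other end of a link `f` stands for the walk along `f` to `v`, around `e`, and
back. -/
theorem Conn.of_contractLoop (he : D.src e = D.tgt e)
    (hb : ∀ f ∈ X, D.src f = D.src e → D.tgt f = D.src e → b f = 1)
    (h : (D.contractLoop e b).Conn X x g y) : D.Conn (insert e X) x g y := by
  have hloop : D.Conn (insert e X) (D.src e) (D.gn e) (D.src e) := by
    have := Conn.arrow (D := D) (mem_insert e X)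
    rwa [← he] at this
  simpa using h.map id 1 (MonoidHom.id Δ) (D' := D) (X' := insert e X) fun f hf => by
    have hf' := Conn.arrow (D := D) (mem_insert_of_mem e hf)
    by_cases h1 : D.src f = D.src e <;> by_cases h2 : D.tgt f = D.src e
    · simpa [contractLoop, h1, h2, hb f hf h1 h2] using Conn.refl (D := D) (D.src e)
    · rw [h1] at hf'
      simpa [contractLoop, h1, h2] using (hf'.symm.trans hloop).trans hf'
    · rw [h2] at hf'
      simpa [contractLoop, h1, h2] using (hf'.trans hloop).trans hf'.symm
    · simpa [contractLoop, h1, h2] using hf'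

/-- A walk avoiding `v` is unchanged. A walk reaching `v` from elsewhere enters along a link, which
has become a loop with nontrivial gain. -/
theorem Conn.contractLoop_or (he : D.src e = D.tgt e) (ha : D.gn e ≠ 1)
    (h : D.Conn (insert e X) x g y) : x = D.src e ∨ (D.contractLoop e b).Unbalanced X x ∨
      (y ≠ D.src e ∧ (D.contractLoop e b).Conn X x g y) := by
  refine h.step_induction (P := fun x g y => x = D.src e ∨ (D.contractLoop e b).Unbalanced X x ∨
      (y ≠ D.src e ∧ (D.contractLoop e b).Conn X x g y)) ?_ ?_
  · intro x
    by_cases hx : x = D.src e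
    exacts [.inl hx, .inr (.inr ⟨hx, .refl x⟩)]
  · intro x q z g y hs ih
    by_cases hx : x = D.src e
    · exact .inl hx
    right
    have hs : D.Step X x q z := by
      rcases hs.of_insert with hs | ⟨f, rfl, ⟨rfl, -⟩ | ⟨rfl, -⟩⟩
      exacts [hs, absurd rfl hx, absurd he.symm hx]
    by_cases hz : z = D.src e
    · subst hz
      left
      refine ⟨_, fun h => ha ?_, conn_contractLoop_of_step_left hs hx⟩
      simpa using h
    · have hc := conn_contractLoop_of_step (b := b) hs hx hz
      rcases ih.resolve_left hz with h | ⟨hy, h⟩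
      · exact .inl (h.of_conn hc)
      · exact .inr ⟨hy, hc.trans h⟩

theorem unbalanced_contractLoop (he : D.src e = D.tgt e) (ha : D.gn e ≠ 1)
    (hb : ∀ f ∈ X, D.src f = D.src e → D.tgt f = D.src e → b f = 1) (hx : x ≠ D.src e) :
    (D.contractLoop e b).Unbalanced X x ↔ D.Unbalanced (insert e X) x := by
  constructor
  · rintro ⟨g, hg, hc⟩
    exact ⟨g, hg, hc.of_contractLoop he hb⟩
  · rintro ⟨g, hg, hc⟩
    rcases (hc.contractLoop_or he ha (b := b)).resolve_left hx with h | h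
    exacts [h, ⟨g, hg, h.2⟩]

/-- The loop `e` makes `v` unbalanced, so a link from `v` to `w` is spanned iff `w` is unbalanced;
the same holds for the loop at `w` replacing it. All `b f` are trivial because this is applied over
`Γ ⧸ Γ₁`. -/
theorem inClosure_contractLoop (he : D.src e = D.tgt e) (ha : D.gn e ≠ 1)
    (hb : ∀ f, b f = 1) :
    (D.contractLoop e b).InClosure X f ↔ D.InClosure (insert e X) f := by
  have hv : D.Unbalanced (insert e X) (D.src e) := by
    refine ⟨D.gn e, ha, ?_⟩
    have := Conn.arrow (D := D) (mem_insert e X)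
    rwa [← he] at this
  have hunb : ∀ {x}, x ≠ D.src e →
      ((D.contractLoop e b).Unbalanced X x ↔ D.Unbalanced (insert e X) x) := fun hx =>
    unbalanced_contractLoop he ha (fun f _ _ _ => hb f) hx
  have hlink : ∀ {w k} (_ : w ≠ D.src e),
      ((D.contractLoop e b).Conn X w (k⁻¹ * D.gn e * k) w ∨
        ((D.contractLoop e b).Unbalanced X w ∧ (D.contractLoop e b).Unbalanced X w)) ↔
      (D.Conn (insert e X) (D.src e) k w ∨
        (D.Unbalanced (insert e X) (D.src e) ∧ D.Unbalanced (insert e X) w)) := by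
    intro w k hw
    rw [and_self, hunb hw]
    constructor
    · rintro (h | h)
      · refine .inr ⟨hv, (hunb hw).1 ⟨_, fun h => ha ?_, h⟩⟩
        calc D.gn e = k * (k⁻¹ * D.gn e * k) * k⁻¹ := by group
          _ = 1 := by rw [h]; group
      · exact .inr ⟨hv, h⟩
    · rintro (h | h)
      · exact .inr (hv.of_conn h.symm)
      · exact .inr h.2
  by_cases h1 : D.src f = D.src e <;> by_cases h2 : D.tgt f = D.src e
  · refine iff_of_true (.inl ?_) (.inr ⟨h1 ▸ hv, h2 ▸ hv⟩)
    simpa [contractLoop, h1, h2, hb f] using Conn.refl (D := D.contractLoop e b) (D.src e)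
  · have := hlink (k := D.gn f) h2
    simpa [InClosure, contractLoop, h1, h2] using this
  · have := hlink (k := (D.gn f)⁻¹) h1
    rw [inv_inv] at this
    have h3 : D.Conn (insert e X) (D.src e) (D.gn f)⁻¹ (D.src f) ↔
        D.Conn (insert e X) (D.src f) (D.gn f) (D.src e) :=
      ⟨fun h => by simpa using h.symm, fun h => h.symm⟩
    rw [h3, and_comm (a := D.Unbalanced (insert e X) (D.src e))] at this
    simpa [InClosure, contractLoop, h1, h2] using this
  · have h3 : (D.contractLoop e b).InClosure X f ↔
        (D.contractLoop e b).Conn X (D.src f) (D.gn f) (D.tgt f) ∨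
          ((D.contractLoop e b).Unbalanced X (D.src f) ∧
            (D.contractLoop e b).Unbalanced X (D.tgt f)) := by
      simp [InClosure, contractLoop, h1, h2]
    rw [h3, hunb h1, hunb h2]
    refine ⟨fun h => h.imp_left fun h => h.of_contractLoop he fun f _ _ _ => hb f, fun h => ?_⟩
    rcases h with h | h
    · have h4 := (h.contractLoop_or he ha (b := b)).resolve_left h1
      have h5 := (h.symm.contractLoop_or he ha (b := b)).resolve_left h2
      rw [hunb h1] at h4
      rw [hunb h2] at h5
      rcases h4 with h4 | h4
      · rcases h5 with h5 | h5
        · exact .inr ⟨h4, h5⟩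
        · exact .inl (by simpa using h5.2.symm)
      · exact .inl h4.2
    · exact .inr h

end Loop

end ArrowData

/-! ### Coherence and lift matroids under contraction -/

section Lift

variable {V E Γ : Type*} [Group Γ] {Γ₁ : Subgroup Γ} {𝒜 : Set (Subgroup Γ)}
  {D : ArrowData V E Γ} {F X : Set E} {M : Matroid E} {e f : E} {x y : V} {g : Γ}

namespace ArrowData

/-- Closed walk values agree away from the last vertex of `e`, which is isolated after contraction
and connected to the first one before. -/
theorem coherent_contractLink (hP : IsFrobeniusPartition Γ₁ 𝒜) (hne : D.src e ≠ D.tgt e) :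
    (D.contractLink e).Coherent Γ₁ 𝒜 X ↔ D.Coherent Γ₁ 𝒜 (insert e X) := by
  have key : ∀ x, x ≠ D.tgt e → ∀ g, (D.contractLink e).Conn X x g x ↔
      D.Conn (insert e X) x g x := by
    intro x hx g
    have := conn_contractLink (X := X) (g := g) (x := x) (y := x) hne
    simpa [merge, mergeGain, hx] using this
  constructor
  · intro h x
    have h1 : ∀ x, x ≠ D.tgt e → D.CoherentAt Γ₁ 𝒜 (insert e X) x := by
      intro x hx
      obtain ⟨B, hB, hxB⟩ := h x
      exact ⟨B, hB, fun g hg => hxB g ((key x hx g).2 hg)⟩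
    by_cases hx : x = D.tgt e
    · rw [hx]
      exact (h1 _ hne).of_conn hP (.arrow_inv (mem_insert e X))
    · exact h1 x hx
  · intro h x
    by_cases hx : x = D.tgt e
    · refine ⟨⊥, .inl rfl, fun g hg => Subgroup.mem_bot.2 (hg.eq_of_isolated fun f _ => ?_).2⟩
      subst hx
      have : ∀ y, D.merge e y ≠ D.tgt e := by
        intro y
        unfold merge
        split_ifs with hy
        exacts [hne, hy]
      exact ⟨this _, this _⟩
    · obtain ⟨B, hB, hxB⟩ := h x
      exact ⟨B, hB, fun g hg => hxB g ((key x hx g).1 hg)⟩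

/-- If the contraction is coherent, loops at `v` have gains in `A`, since a nontrivial `b f ∈ Γ₁` is
in no admissible group; the conjugates of the gain of `e` carried by the former links then force all
closed walks at `v` into `A`. Conversely, the group at `v` contains the gain of `e`, so it is `A`;
hence loops at `v` get gain 1, and walks after contraction are walks before it. -/
theorem coherent_contractLoop [Γ₁.Normal] (hP : IsFrobeniusPartition Γ₁ 𝒜) {b : E → Γ}
    (he : D.src e = D.tgt e) (ha : D.gn e ∉ Γ₁) {A : Subgroup Γ} (hA : A ∈ 𝒜) (haA : D.gn e ∈ A)
    (hbΓ : ∀ f, b f ∈ Γ₁)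
    (hb : ∀ f ∈ X, D.src f = D.src e → D.tgt f = D.src e → (b f = 1 ↔ D.gn f ∈ A)) :
    (D.contractLoop e b).Coherent Γ₁ 𝒜 X ↔ D.Coherent Γ₁ 𝒜 (insert e X) := by
  have ha1 : D.gn e ≠ 1 := fun h => ha (h ▸ Γ₁.one_mem)
  have hloop : D.Conn (insert e X) (D.src e) (D.gn e) (D.src e) := by
    have := Conn.arrow (D := D) (mem_insert e X)
    rwa [← he] at this
  constructor
  · intro h
    have hb' : ∀ f ∈ X, D.src f = D.src e → D.tgt f = D.src e → D.gn f ∈ A := by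
      intro f hf h1 h2
      rw [← hb f hf h1 h2]
      obtain ⟨B, hB, hvB⟩ := h (D.src e)
      refine hB.eq_one (hvB _ ?_) (hbΓ f)
      simpa [contractLoop, h1, h2] using Conn.arrow (D := D.contractLoop e b) hf
    -- For a walk from `x ≠ v` to `v` with value `g`, the contraction remembers the coset `gA` by a
    -- closed walk at `x` conjugating the gain of `e` by an element of that coset.
    have main : ∀ {x g y}, D.Conn (insert e X) x g y → y = D.src e →
        (x = D.src e ∧ g ∈ A) ∨ (x ≠ D.src e ∧ ∃ α ∈ A,
          (D.contractLoop e b).Conn X x (g * α * D.gn e * (g * α)⁻¹) x) := by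
      intro x g y h'
      refine h'.step_induction (P := fun x g y => y = D.src e → (x = D.src e ∧ g ∈ A) ∨
        (x ≠ D.src e ∧ ∃ α ∈ A,
          (D.contractLoop e b).Conn X x (g * α * D.gn e * (g * α)⁻¹) x)) ?_ ?_
      · exact fun x hx => .inl ⟨hx, A.one_mem⟩
      · intro x q z g y hs ih hy
        rcases hs.of_insert with hs | ⟨f, rfl, hf⟩
        · by_cases hx : x = D.src e
          · refine .inl ⟨hx, ?_⟩
            rcases ih hy with ⟨hz, hg⟩ | ⟨hz, α, hα, hc⟩
            · refine A.mul_mem ?_ hg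
              obtain ⟨f, hf, ⟨h1, h2, rfl⟩ | ⟨h1, h2, rfl⟩⟩ := hs
              · exact hb' f hf (h1 ▸ hx) (h2 ▸ hz)
              · exact A.inv_mem (hb' f hf (h2 ▸ hz) (h1 ▸ hx))
            · subst hx
              have hc' := conn_contractLoop_of_step_left (b := b) hs.symm hz
              rw [inv_inv] at hc'
              obtain ⟨B, hB, hzB⟩ := h z
              have h1 := hzB _ hc'
              have h2 := hzB _ hc
              have hne : q⁻¹ * D.gn e * q ≠ 1 := fun h => ha1 (by
                calc D.gn e = q * (q⁻¹ * D.gn e * q) * q⁻¹ := by group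
                  _ = 1 := by rw [h]; group)
              -- Coherence at `z` puts both conjugates of the gain of `e` into `q⁻¹Aq`, so `q * g *
              -- α ∈ A` by malnormality.
              have hBA := hP.eq_of_isAdmissible (hP.conj_mem A hA q⁻¹) hB hne
                (mem_map_conj.2 (by simpa [mul_assoc] using haA)) h1
              rw [hBA, mem_map_conj, inv_inv] at h2
              by_contra hqg
              refine ha1 (hP.malnormal A hA (q * g * α)⁻¹ (fun h3 => hqg ?_) _ haA ?_)
              · have := A.mul_mem (A.inv_mem h3) (A.inv_mem hα)
                simpa using this
              · convert h2 using 1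
                group
          · refine .inr ⟨hx, ?_⟩
            rcases ih hy with ⟨hz, hg⟩ | ⟨hz, α, hα, hc⟩
            · subst hz
              refine ⟨g⁻¹, A.inv_mem hg, ?_⟩
              simpa using conn_contractLoop_of_step_left (b := b) hs hx
            · have hs' := conn_contractLoop_of_step (b := b) hs hx hz
              refine ⟨α, hα, ?_⟩
              convert (hs'.trans hc).trans hs'.symm using 1
              group
        · have hx : x = D.src f := hf.elim (fun h => h.1) fun h => h.1.trans he.symm
          have hz : z = D.src f := hf.elim (fun h => h.2.1.trans he.symm) fun h => h.2.1
          have hq : q ∈ A := by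
            rcases hf with ⟨-, -, rfl⟩ | ⟨-, -, rfl⟩
            exacts [haA, A.inv_mem haA]
          rcases ih hy with ⟨-, hg⟩ | ⟨h, -⟩
          · exact .inl ⟨hx, A.mul_mem hq hg⟩
          · exact absurd hz h
    have hv : D.CoherentAt Γ₁ 𝒜 (insert e X) (D.src e) := by
      refine ⟨A, .inr ⟨hA, hP.disjoint_of_mem hA ha haA⟩, fun g hg => ?_⟩
      rcases main hg rfl with h | h
      exacts [h.2, absurd rfl h.1]
    intro x
    by_cases hx : ∃ k, D.Conn (insert e X) x k (D.src e)
    · obtain ⟨k, hk⟩ := hx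
      exact hv.of_conn hP hk
    · obtain ⟨B, hB, hxB⟩ := h x
      refine ⟨B, hB, fun g hg => hxB g ?_⟩
      have : ∀ {x g y}, D.Conn (insert e X) x g y →
          (∃ k, D.Conn (insert e X) x k (D.src e)) ∨ (D.contractLoop e b).Conn X x g y := by
        intro x g y h
        refine h.step_induction (P := fun x g y =>
          (∃ k, D.Conn (insert e X) x k (D.src e)) ∨ (D.contractLoop e b).Conn X x g y) ?_ ?_
        · exact fun x => .inr (.refl x)
        · intro x q z g y hs ih
          rcases ih with ⟨k, hk⟩ | ih
          · exact .inl ⟨_, hs.conn.trans hk⟩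
          · by_cases hx : x = D.src e
            · exact .inl ⟨1, hx ▸ .refl _⟩
            by_cases hz : z = D.src e
            · exact .inl ⟨q, hz ▸ hs.conn⟩
            rcases hs.of_insert with hs | ⟨f, rfl, ⟨h, -⟩ | ⟨h, -⟩⟩
            · exact .inr ((conn_contractLoop_of_step hs hx hz).trans ih)
            · exact absurd h hx
            · exact absurd (h.trans he.symm) hx
      exact (this hg).resolve_left hx
  · intro h x
    obtain ⟨B, hB, hvB⟩ := h (D.src e)
    obtain rfl := hP.eq_of_isAdmissible hA hB ha1 haA (hvB _ hloop)
    obtain ⟨B', hB', hxB'⟩ := h x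
    refine ⟨B', hB', fun g hg => hxB' g (hg.of_contractLoop he fun f hf h1 h2 => ?_)⟩
    rw [hb f hf h1 h2]
    apply hvB
    have := Conn.arrow (D := D) (mem_insert_of_mem e hf)
    rwa [h1, h2] at this

variable [Γ₁.Normal]

theorem IsLiftOf.delete (h : D.IsLiftOf Γ₁ 𝒜 F M) (S : Set E) :
    D.IsLiftOf Γ₁ 𝒜 (F \ S) (M ＼ S) := by
  obtain ⟨N, hN, hE, hr⟩ := h
  refine ⟨N ＼ S, hN.delete S, by rw [Matroid.delete_ground, hE], fun X hX => ?_⟩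
  rw [Matroid.delete_eq_restrict, Matroid.delete_eq_restrict, Matroid.restrict_eRk_eq _ (hE ▸ hX),
    Matroid.restrict_eRk_eq _ (hN.1 ▸ hX)]
  exact hr X (hX.trans sdiff_subset)

/-- The edge `e` is a nonloop of both `N` and `M`, so contracting it lowers both ranks by one and
preserves their difference. -/
theorem IsLiftOf.contract_of_not_inClosure (hP : IsFrobeniusPartition Γ₁ 𝒜)
    {D' : ArrowData V E Γ} (h : D.IsLiftOf Γ₁ 𝒜 F M) (he : e ∈ F)
    (hcl : ¬ (D.mapHom (QuotientGroup.mk' Γ₁)).InClosure ∅ e)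
    (h₁ : ∀ X ⊆ F \ {e}, ∀ f ∈ F \ {e}, (D'.mapHom (QuotientGroup.mk' Γ₁)).InClosure X f ↔
      (D.mapHom (QuotientGroup.mk' Γ₁)).InClosure (insert e X) f)
    (h₂ : ∀ X ⊆ F \ {e}, D'.Coherent Γ₁ 𝒜 X ↔ D.Coherent Γ₁ 𝒜 (insert e X)) :
    D'.IsLiftOf Γ₁ 𝒜 (F \ {e}) (M ／ {e}) := by
  obtain ⟨N, hN, hE, hr⟩ := h
  have hNe : N.IsNonloop e := by
    rw [Matroid.isNonloop_iff_notMem_loops (hN.1.symm ▸ he), Matroid.loops,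
      hN.2 ∅ (empty_subset _) e he]
    exact hcl
  have hce : D.Coherent Γ₁ 𝒜 {e} := by
    rw [← insert_empty_eq]
    exact coherent_empty.insert hP (coherentAt_of_not_inClosure hP coherent_empty hcl)
  have hMe : M.IsNonloop e := by
    rw [← Matroid.eRk_singleton_eq_one_iff, hr _ (singleton_subset_iff.2 he), if_pos hce]
    exact hNe.eRk_eq
  refine ⟨N ／ {e}, hN.contract h₁ he, by rw [Matroid.contract_ground, hE], fun X hX => ?_⟩
  have e1 := eRk_contract_singleton_add_one hMe (hE ▸ hX)
  have e2 := eRk_contract_singleton_add_one hNe (hN.1 ▸ hX)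
  rw [hr _ (insert_subset he (hX.trans sdiff_subset)), ← e2] at e1
  refine WithTop.add_right_cancel ENat.one_ne_top (e1.trans ?_)
  by_cases hc : D.Coherent Γ₁ 𝒜 (insert e X)
  · rw [if_pos hc, if_pos ((h₂ X hX).2 hc)]
    rfl
  · rw [if_neg hc, if_neg (mt (h₂ X hX).1 hc)]
    rfl

theorem IsLiftOf.contract_link (hP : IsFrobeniusPartition Γ₁ 𝒜) (h : D.IsLiftOf Γ₁ 𝒜 F M)
    (he : e ∈ F) (hne : D.src e ≠ D.tgt e) :
    (D.contractLink e).IsLiftOf Γ₁ 𝒜 (F \ {e}) (M ／ {e}) := by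
  refine h.contract_of_not_inClosure hP he ?_ (fun X hX f hf => ?_)
    fun X hX => coherent_contractLink hP hne
  · rintro (h | ⟨⟨g, hg, hc⟩, -⟩)
    · exact hne (h.eq_of_isolated (by simp)).1
    · exact hg (hc.eq_of_isolated (by simp)).2
  · rw [contractLink_mapHom]
    exact inClosure_contractLink hne

theorem IsLiftOf.contract_loop (hP : IsFrobeniusPartition Γ₁ 𝒜)
    (hnt : IsNontrivialPartition (insert Γ₁ 𝒜) → Γ₁ ≠ ⊥) (h : D.IsLiftOf Γ₁ 𝒜 F M)
    (he : e ∈ F) (hl : D.src e = D.tgt e) (ha : D.gn e ∉ Γ₁) :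
    ∃ D' : ArrowData V E Γ, D'.IsLiftOf Γ₁ 𝒜 (F \ {e}) (M ／ {e}) := by
  classical
  obtain ⟨A, hA, haA, hd⟩ := hP.exists_mem ha
  have ha1 : D.gn e ≠ 1 := fun h => ha (h ▸ Γ₁.one_mem)
  -- If some `g` is outside `A`, then `A` and the member containing `g` are two nontrivial groups,
  -- so `Γ₁` is nontrivial. If `A` is everything, no loop needs `c`, and 1 will do.
  have hc : ∃ c ∈ Γ₁, ∀ g : Γ, g ∉ A → c ≠ 1 := by
    by_cases hAt : ∀ g, g ∈ A
    · exact ⟨1, Γ₁.one_mem, fun g hg => absurd (hAt g) hg⟩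
    push Not at hAt
    obtain ⟨g, hg⟩ := hAt
    obtain ⟨K, ⟨hK, hgK⟩, -⟩ := hP.partition g fun h => hg (h ▸ A.one_mem)
    have := hnt ⟨A, .inr hA, K, hK, fun h => hg (h ▸ hgK),
      fun h => ha1 (Subgroup.mem_bot.1 (h ▸ haA)),
      fun h => hg ((Subgroup.mem_bot.1 (h ▸ hgK) : g = 1) ▸ A.one_mem)⟩
    obtain ⟨c, hc, hc1⟩ := Γ₁.bot_or_exists_ne_one.resolve_left this
    exact ⟨c, hc, fun _ _ => hc1⟩
  obtain ⟨c, hcΓ, hc⟩ := hc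
  let b : E → Γ := fun f => if D.gn f ∈ A then 1 else c
  have hbΓ : ∀ f, b f ∈ Γ₁ := by
    intro f
    simp only [b]
    split_ifs
    exacts [Γ₁.one_mem, hcΓ]
  have hb : ∀ f, b f = 1 ↔ D.gn f ∈ A := by
    intro f
    simp only [b]
    split_ifs with hf
    · exact iff_of_true rfl hf
    · exact iff_of_false (hc _ hf) hf
  have hπ : (D.mapHom (QuotientGroup.mk' Γ₁)).gn e ≠ 1 := fun h =>
    ha ((QuotientGroup.eq_one_iff _).1 h)
  refine ⟨D.contractLoop e b, h.contract_of_not_inClosure hP he ?_ (fun X hX f hf => ?_)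
    fun X hX => coherent_contractLoop hP hl ha hA haA hbΓ fun f _ _ _ => hb f⟩
  · rintro (h | ⟨⟨g, hg, hc⟩, -⟩)
    · exact hπ (h.eq_of_isolated (by simp)).2
    · exact hg (hc.eq_of_isolated (by simp)).2
  · rw [contractLoop_mapHom]
    exact inClosure_contractLoop hl hπ fun f => (QuotientGroup.eq_one_iff _).2 (hbΓ f)

theorem inClosure_mapHom_iff {Δ Δ' : Type*} [Group Δ] [Group Δ'] {D : ArrowData V E Δ}
    {φ : Δ →* Δ'} (hφ : Function.Injective φ) : (D.mapHom φ).InClosure X f ↔ D.InClosure X f := by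
  have hc : ∀ {x g y}, (D.mapHom φ).Conn X x (φ g) y ↔ D.Conn X x g y := by
    intro x g y
    rw [conn_mapHom]
    exact ⟨fun ⟨k, hk, h⟩ => hφ hk ▸ h, fun h => ⟨g, rfl, h⟩⟩
  have hu : ∀ {x}, (D.mapHom φ).Unbalanced X x ↔ D.Unbalanced X x := by
    intro x
    constructor
    · rintro ⟨_, hk, h⟩
      obtain ⟨g, rfl, h⟩ := conn_mapHom.1 h
      exact ⟨g, fun h0 => hk (h0 ▸ map_one φ), hc.1 h⟩
    · rintro ⟨g, hg, h⟩
      exact ⟨φ g, fun h => hg (hφ (h.trans (map_one φ).symm)), hc.2 h⟩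
  exact or_congr hc (and_congr hu hu)

/-- Contracting an element of `Γ₁` gives the frame matroid, which is the lift matroid for gains in
a complement of `Γ₁`. -/
theorem IsLiftOf.contract_of_mem (h : D.IsLiftOf Γ₁ 𝒜 F M) (he : e ∈ F)
    (hl : D.src e = D.tgt e) (ha : D.gn e ∈ Γ₁) (ha1 : D.gn e ≠ 1) (φ : Γ ⧸ Γ₁ →* Γ)
    (hφ : Function.Injective ((QuotientGroup.mk' Γ₁).comp φ))
    (hadm : ∃ B, IsAdmissible Γ₁ 𝒜 B ∧ φ.range ≤ B) :
    (D.mapHom (φ.comp (QuotientGroup.mk' Γ₁))).IsLiftOf Γ₁ 𝒜 (F \ {e}) (M ／ {e}) := by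
  obtain ⟨N, hN, hE, hr⟩ := h
  -- The gain of `e` is a nontrivial closed walk value in `Γ₁`, which no admissible group contains.
  -- Thus `e` has rank 1 in `M` although it is a loop of `N`.
  have hnc : ∀ X, ¬ D.Coherent Γ₁ 𝒜 (insert e X) := by
    intro X hX
    obtain ⟨B, hB, hvB⟩ := hX (D.src e)
    refine ha1 (hB.eq_one (hvB _ ?_) ha)
    have := Conn.arrow (D := D) (mem_insert e X)
    rwa [← hl] at this
  have hNe : e ∈ N.closure ∅ := by
    rw [hN.2 ∅ (empty_subset _) e he]
    left
    have : (D.mapHom (QuotientGroup.mk' Γ₁)).gn e = 1 := (QuotientGroup.eq_one_iff _).2 ha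
    rw [this, show (D.mapHom (QuotientGroup.mk' Γ₁)).tgt e = D.src e from hl.symm]
    exact .refl _
  have hNins : ∀ X, N.eRk (insert e X) = N.eRk X := by
    intro X
    rw [← N.eRk_closure_eq, Matroid.closure_insert_eq_of_mem_closure
      (N.closure_subset_closure (empty_subset X) hNe), N.eRk_closure_eq]
  have hMe : M.IsNonloop e := by
    rw [← Matroid.eRk_singleton_eq_one_iff, hr _ (singleton_subset_iff.2 he), ← insert_empty_eq,
      if_neg (hnc ∅), hNins, Matroid.eRk_empty, zero_add]
  have hco : ∀ X, (D.mapHom (φ.comp (QuotientGroup.mk' Γ₁))).Coherent Γ₁ 𝒜 X := by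
    intro X x
    obtain ⟨B, hB, hφB⟩ := hadm
    refine ⟨B, hB, fun g hg => ?_⟩
    obtain ⟨k, rfl, -⟩ := conn_mapHom.1 hg
    exact hφB ⟨_, rfl⟩
  have hN' := hN.delete {e}
  -- The rank 1 lost by contracting `e` is exactly the increment for incoherent sets, so `M ／ {e}`
  -- has the rank function of `N ＼ {e}`.
  refine ⟨N ＼ {e}, ⟨hN'.1, fun X hX f hf => ?_⟩, by rw [Matroid.contract_ground, hE],
    fun X hX => ?_⟩
  · rw [hN'.2 X hX f hf, ← inClosure_mapHom_iff hφ]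
    rfl
  · rw [if_pos (hco X), Matroid.delete_eq_restrict, Matroid.restrict_eRk_eq _ (hN.1 ▸ hX)]
    refine WithTop.add_right_cancel ENat.one_ne_top
      ((eRk_contract_singleton_add_one hMe (hE ▸ hX)).trans ?_)
    rw [hr _ (insert_subset he (hX.trans sdiff_subset)), if_neg (hnc X), hNins]
    rfl

/-- Such an edge is a loop of `N` and is coherent on its own, hence a loop of `M`. -/
theorem IsLiftOf.contract_eq_delete (h : D.IsLiftOf Γ₁ 𝒜 F M) (he : e ∈ F)
    (hl : D.src e = D.tgt e) (ha : D.gn e = 1) : M ／ {e} = M ＼ {e} := by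
  obtain ⟨N, hN, hE, hr⟩ := h
  have hc : ∀ {Δ : Type _} [Group Δ] (D' : ArrowData V E Δ), D'.src e = D'.tgt e → D'.gn e = 1 →
      D'.Conn ∅ (D'.src e) (D'.gn e) (D'.tgt e) := by
    intro Δ _ D' h1 h2
    rw [h2, ← h1]
    exact .refl _
  have hNe : e ∈ N.closure ∅ := by
    rw [hN.2 ∅ (empty_subset _) e he]
    exact .inl (hc _ hl (by simp [mapHom, ha]))
  have hco : D.Coherent Γ₁ 𝒜 {e} := by
    intro x
    refine ⟨⊥, .inl rfl, fun g hg => Subgroup.mem_bot.2 ?_⟩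
    rw [← insert_empty_eq] at hg
    exact (((hc D hl ha).of_insert hg).eq_of_isolated (by simp)).2
  apply Matroid.contract_eq_delete_of_subset_loops
  have hes : {e} ⊆ M.E := singleton_subset_iff.2 (hE ▸ he)
  rw [← Matroid.eRk_eq_zero_iff hes, hr _ (singleton_subset_iff.2 he), if_pos hco,
    Matroid.eRk_eq_zero_iff (singleton_subset_iff.2 (hN.1.symm ▸ he))]
  exact singleton_subset_iff.2 hNe

theorem IsLiftOf.contract_singleton (hP : IsFrobeniusPartition Γ₁ 𝒜)
    (hnt : IsNontrivialPartition (insert Γ₁ 𝒜) → Γ₁ ≠ ⊥) (φ : Γ ⧸ Γ₁ →* Γ)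
    (hφ : Function.Injective ((QuotientGroup.mk' Γ₁).comp φ))
    (hadm : ∃ B, IsAdmissible Γ₁ 𝒜 B ∧ φ.range ≤ B)
    (h : D.IsLiftOf Γ₁ 𝒜 F M) (he : e ∈ F) :
    ∃ D' : ArrowData V E Γ, D'.IsLiftOf Γ₁ 𝒜 (F \ {e}) (M ／ {e}) := by
  by_cases hl : D.src e = D.tgt e
  · by_cases ha : D.gn e ∈ Γ₁
    · by_cases ha1 : D.gn e = 1
      · exact ⟨D, h.contract_eq_delete he hl ha1 ▸ h.delete {e}⟩
      · exact ⟨_, h.contract_of_mem he hl ha ha1 φ hφ hadm⟩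
    · exact h.contract_loop hP hnt he hl ha
  · exact ⟨_, h.contract_link hP he hl⟩

theorem IsLiftOf.contract (hP : IsFrobeniusPartition Γ₁ 𝒜)
    (hnt : IsNontrivialPartition (insert Γ₁ 𝒜) → Γ₁ ≠ ⊥) (φ : Γ ⧸ Γ₁ →* Γ)
    (hφ : Function.Injective ((QuotientGroup.mk' Γ₁).comp φ))
    (hadm : ∃ B, IsAdmissible Γ₁ 𝒜 B ∧ φ.range ≤ B)
    (h : D.IsLiftOf Γ₁ 𝒜 F M) {S : Set E} (hfin : S.Finite) (hS : S ⊆ F) :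
    ∃ D' : ArrowData V E Γ, D'.IsLiftOf Γ₁ 𝒜 (F \ S) (M ／ S) := by
  induction S, hfin using Set.Finite.induction_on with
  | empty => exact ⟨D, by simpa using h⟩
  | @insert e S heS _ ih =>
    obtain ⟨heF, hSF⟩ := insert_subset_iff.1 hS
    obtain ⟨D', hD'⟩ := ih hSF
    obtain ⟨D'', hD''⟩ := hD'.contract_singleton hP hnt φ hφ hadm (e := e) ⟨heF, heS⟩
    refine ⟨D'', ?_⟩
    rw [Matroid.contract_contract, union_singleton] at hD''
    convert hD'' using 1
    grind

end ArrowData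

end Lift

end GainGraph

namespace GainGraph

open Set
open scoped Matroid

/-! ### Complements of `Γ₁` -/

section Group

variable {Γ : Type*} [Group Γ] {Γ₁ : Subgroup Γ} {𝒜 : Set (Subgroup Γ)}

/-- The nonidentity elements of the conjugates of `A`. -/
def nontrivialConjugates (A : Subgroup Γ) : Set Γ := {k | ∃ g, ∃ a ∈ A, a ≠ 1 ∧ g * a * g⁻¹ = k}

/-- Different left cosets of `A` give conjugates meeting only in the identity, so the set has `[Γ :
A] * (|A| - 1)` elements. -/
theorem IsMalnormal.ncard_nontrivialConjugates [Finite Γ] {A : Subgroup Γ} (hA : IsMalnormal A) :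
    (nontrivialConjugates A).ncard + A.index = Nat.card Γ := by
  let Φ : (Γ ⧸ A) × {a : A // a ≠ 1} → Γ := fun p => p.1.out * (p.2.1 : Γ) * p.1.out⁻¹
  have hinj : Function.Injective Φ := by
    rintro ⟨q, ⟨⟨a, ha⟩, ha1⟩⟩ ⟨r, ⟨⟨b, hb⟩, hb1⟩⟩ h
    change q.out * a * q.out⁻¹ = r.out * b * r.out⁻¹ at h
    have hqr : q = r := by
      rw [← QuotientGroup.out_eq' q, ← QuotientGroup.out_eq' r, QuotientGroup.eq]
      by_contra hqr
      refine ha1 (Subtype.ext (hA _ hqr a ha ?_))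
      convert hb using 1
      calc (q.out⁻¹ * r.out)⁻¹ * a * (q.out⁻¹ * r.out)
          = r.out⁻¹ * (q.out * a * q.out⁻¹) * r.out := by group
        _ = b := by rw [h]; group
    subst hqr
    obtain rfl : a = b := by simpa using h
    rfl
  have hrange : range Φ = nontrivialConjugates A := by
    ext k
    constructor
    · rintro ⟨⟨q, ⟨⟨a, ha⟩, ha1⟩⟩, rfl⟩
      exact ⟨q.out, a, ha, fun h => ha1 (Subtype.ext h), rfl⟩
    · rintro ⟨g, a, ha, ha1, rfl⟩
      obtain ⟨⟨h, hh⟩, hg⟩ := QuotientGroup.mk_out_eq_mul A g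
      refine ⟨⟨(g : Γ ⧸ A), ⟨⟨h⁻¹ * a * h, A.mul_mem (A.mul_mem (A.inv_mem hh) ha) hh⟩, ?_⟩⟩, ?_⟩
      · intro h1
        have h1 : h⁻¹ * a * h = 1 := congrArg Subtype.val h1
        refine ha1 ?_
        calc a = h * (h⁻¹ * a * h) * h⁻¹ := by group
          _ = 1 := by rw [h1]; group
      · change (g : Γ ⧸ A).out * (h⁻¹ * a * h) * (g : Γ ⧸ A).out⁻¹ = g * a * g⁻¹
        rw [hg]
        change (g * h) * (h⁻¹ * a * h) * (g * h)⁻¹ = g * a * g⁻¹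
        group
  have hcard : Nat.card {a : A // a ≠ 1} + 1 = Nat.card A := by
    have := Set.ncard_add_ncard_compl ({1} : Set A)
    rw [ncard_singleton, add_comm] at this
    exact this
  rw [← hrange, ← Set.image_univ, Set.ncard_image_of_injective _ hinj, Set.ncard_univ,
    Nat.card_prod, ← A.index_mul_card, ← hcard]
  rw [Subgroup.index]
  ring

namespace IsFrobeniusPartition

/-- Conjugates of a nontrivial member of `𝒜` contain at least half of `|Γ|` nonidentity elements, so
two nonconjugate members would need more than `|Γ| - 1` such elements. Hence the conjugates of `A`
cover the complement of `Γ₁`, and comparing cardinalities gives the bound. -/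
theorem card_le_of_finite [Finite Γ] (hP : IsFrobeniusPartition Γ₁ 𝒜) {A : Subgroup Γ}
    (hA : A ∈ 𝒜) {g : Γ} (hgA : g ∈ A) (hg1 : g ≠ 1) : A.index ≤ Nat.card Γ₁ := by
  have hhalf : ∀ (B : Subgroup Γ) (b : Γ), b ∈ B → b ≠ 1 → 2 * B.index ≤ Nat.card Γ := by
    intro B b hb hb1
    have : Nontrivial B := ⟨⟨b, hb⟩, 1, fun h => hb1 (congrArg Subtype.val h)⟩
    have h2 := Finite.one_lt_card (α := B)
    rw [← B.index_mul_card]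
    nlinarith
  have hA' := (hP.malnormal A hA).ncard_nontrivialConjugates
  have hsub : (Γ₁ : Set Γ)ᶜ ⊆ nontrivialConjugates A := by
    intro b hb
    by_contra hbA
    obtain ⟨B, hB, hbB, -⟩ := hP.exists_mem hb
    have hb1 : b ≠ 1 := fun h => hb (h ▸ Γ₁.one_mem)
    have hB' := (hP.malnormal B hB).ncard_nontrivialConjugates
    have hdisj : Disjoint (nontrivialConjugates A) (nontrivialConjugates B) := by
      rw [Set.disjoint_left]
      rintro k ⟨h, a, ha, ha1, rfl⟩ ⟨h', b', hb', hb1', heq⟩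
      have hBA : B = A.map (MulAut.conj (h'⁻¹ * h)).toMonoidHom := by
        refine hP.eq_of_mem (.inr hB) (.inr (hP.conj_mem A hA _)) hb1' hb' (mem_map_conj.2 ?_)
        convert ha using 1
        calc (h'⁻¹ * h)⁻¹ * b' * (h'⁻¹ * h) = h⁻¹ * (h' * b' * h'⁻¹) * h := by group
          _ = a := by rw [heq]; group
      rw [hBA, mem_map_conj] at hbB
      exact hbA ⟨h'⁻¹ * h, _, hbB, fun h1 => hb1 (by
        calc b = (h'⁻¹ * h) * ((h'⁻¹ * h)⁻¹ * b * (h'⁻¹ * h)) * (h'⁻¹ * h)⁻¹ := by group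
          _ = 1 := by rw [h1]; group), by group⟩
    have hone : nontrivialConjugates A ∪ nontrivialConjugates B ⊆ ({1} : Set Γ)ᶜ := by
      rintro k (⟨h, a, -, ha1, rfl⟩ | ⟨h, a, -, ha1, rfl⟩) hk <;>
      · exact ha1 (by simpa using hk)
    have h1 := Set.ncard_le_ncard hone
    rw [Set.ncard_union_eq hdisj] at h1
    have h2 := Set.ncard_add_ncard_compl ({1} : Set Γ)
    rw [ncard_singleton] at h2
    have h3 := hhalf A g hgA hg1
    have h4 := hhalf B b hbB hb1
    omega
  have h1 := Set.ncard_le_ncard hsub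
  have h2 := Set.ncard_add_ncard_compl (Γ₁ : Set Γ)
  have h3 : (Γ₁ : Set Γ).ncard = Nat.card Γ₁ := rfl
  omega

/-- A finite group with a Frobenius partition satisfies the hypotheses on the partition. -/
theorem of_finite [Finite Γ] [Γ₁.Normal] (hP : IsFrobeniusPartition Γ₁ 𝒜) :
    (IsNontrivialPartition (insert Γ₁ 𝒜) → Γ₁ ≠ ⊥) ∧
      (Subsingleton (Γ ⧸ Γ₁) ∨ ∃ A ∈ 𝒜, Nonempty (Γ ⧸ Γ₁ ≃* A)) := by
  by_cases htop : Γ₁ = ⊤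
  · refine ⟨?_, .inl (by rw [htop]; exact QuotientGroup.subsingleton_quotient_top)⟩
    rintro ⟨H, -, -, -, -, hH, -⟩ hbot
    exact hH (le_bot_iff.1 (hbot ▸ htop ▸ le_top))
  obtain ⟨g, hg⟩ : ∃ g, g ∉ Γ₁ := by
    by_contra! h
    exact htop ((Subgroup.eq_top_iff' _).2 h)
  have hg1 : g ≠ 1 := fun h => hg (h ▸ Γ₁.one_mem)
  obtain ⟨A, hA, hgA, hd⟩ := hP.exists_mem hg
  have hle := hP.card_le_of_finite hA hgA hg1
  constructor
  · rintro ⟨H, hH, K, hK, hHK, hH1, hK1⟩ rfl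
    rw [Subgroup.card_bot] at hle
    -- With `Γ₁` trivial the index of `A` is 1, so `A` is the only nontrivial member.
    have hA1 : A = ⊤ := Subgroup.index_eq_one.1
      (le_antisymm hle (Nat.one_le_iff_ne_zero.2 A.index_ne_zero_of_finite))
    have key : ∀ H ∈ insert ⊥ 𝒜, H ≠ ⊥ → H = A := by
      intro H hH hH1
      obtain ⟨u, hu, hu1⟩ := H.bot_or_exists_ne_one.resolve_left hH1
      exact hP.eq_of_mem hH (.inr hA) hu1 hu (hA1 ▸ Subgroup.mem_top u)
    exact hHK ((key H hH hH1).trans (key K hK hK1).symm)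
  · right
    -- `A` embeds in the quotient, and the index bound makes the quotient no larger than `A`.
    refine ⟨A, hA, ⟨(MulEquiv.ofBijective ((QuotientGroup.mk' Γ₁).comp A.subtype) ?_).symm⟩⟩
    refine Function.Injective.bijective_of_nat_card_le ?_ ?_
    · rw [injective_iff_map_eq_one]
      rintro ⟨a, ha⟩ h
      exact Subtype.ext (Subgroup.disjoint_def.1 hd ha ((QuotientGroup.eq_one_iff a).1 h))
    · have h1 := Γ₁.index_mul_card
      rw [← A.index_mul_card] at h1
      have h2 : 0 < Nat.card Γ₁ := Nat.card_pos
      change Γ₁.index ≤ Nat.card A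
      nlinarith

/-- If `Γ/Γ₁` is trivial or isomorphic to a group in `𝒜`, then it has a section, up to an
automorphism, in an admissible group. -/
theorem exists_section [hN : Γ₁.Normal] (hP : IsFrobeniusPartition Γ₁ 𝒜)
    (h : Subsingleton (Γ ⧸ Γ₁) ∨ ∃ A ∈ 𝒜, Nonempty (Γ ⧸ Γ₁ ≃* A)) :
    ∃ φ : Γ ⧸ Γ₁ →* Γ, Function.Injective ((QuotientGroup.mk' Γ₁).comp φ) ∧
      ∃ B, IsAdmissible Γ₁ 𝒜 B ∧ φ.range ≤ B := by
  by_cases hs : Subsingleton (Γ ⧸ Γ₁)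
  · refine ⟨1, Function.injective_of_subsingleton _, ⊥, .inl rfl, ?_⟩
    rintro _ ⟨x, rfl⟩
    exact Subgroup.mem_bot.2 rfl
  obtain ⟨A, hA, ⟨ι⟩⟩ := h.resolve_left hs
  -- Otherwise `A = Γ₁` is nontrivial, normal and malnormal, hence all of `Γ`, and the quotient is
  -- trivial.
  have hd : Disjoint A Γ₁ := by
    by_contra hd
    rw [Subgroup.disjoint_def] at hd
    push Not at hd
    obtain ⟨u, huA, huΓ, hu1⟩ := hd
    obtain rfl := hP.eq_of_mem (.inr hA) (.inl rfl) hu1 huA huΓ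
    refine hs ⟨fun x y => ?_⟩
    have htriv : ∀ x : Γ ⧸ A, x = 1 := by
      intro x
      obtain ⟨g, rfl⟩ := QuotientGroup.mk_surjective x
      rw [QuotientGroup.eq_one_iff]
      by_contra hg
      exact hu1 (hP.malnormal A hA g hg u huA (by simpa using hN.conj_mem u huΓ g⁻¹))
    rw [htriv x, htriv y]
  refine ⟨A.subtype.comp ι.toMonoidHom, ?_, A, .inr ⟨hA, hd⟩, ?_⟩
  · rw [injective_iff_map_eq_one]
    intro x hx
    have h1 := Subgroup.disjoint_def.1 hd (ι x).2 ((QuotientGroup.eq_one_iff _).1 hx)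
    exact ι.map_eq_one_iff.1 (Subtype.ext h1)
  · rintro _ ⟨x, rfl⟩
    exact (ι x).2

end IsFrobeniusPartition

end Group

/-! ### Isomorphisms and minors -/

section Iso

variable {ι κ : Type*}

theorem IsIsomorphic.contract_delete {M : Matroid ι} {M₀ : Matroid κ} (f : M.E ≃ M₀.E)
    (hf : ∀ I : Set M.E, M.Indep (Subtype.val '' I) ↔ M₀.Indep (Subtype.val '' (f '' I)))
    (I S : Set M.E) (hI : M.Indep (Subtype.val '' I)) :
    IsIsomorphic (M ／ (Subtype.val '' I) ＼ (Subtype.val '' S))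
      (M₀ ／ (Subtype.val '' (f '' I)) ＼ (Subtype.val '' (f '' S))) := by
  have hI₀ := (hf I).1 hI
  have hE : ∀ x : M.E, x.1 ∈ (M ／ (Subtype.val '' I) ＼ (Subtype.val '' S)).E ↔
      (f x).1 ∈ (M₀ ／ (Subtype.val '' (f '' I)) ＼ (Subtype.val '' (f '' S))).E := by
    intro x
    simp [Subtype.val_injective.mem_set_image]
  let g : (M ／ (Subtype.val '' I) ＼ (Subtype.val '' S)).E ≃
      (M₀ ／ (Subtype.val '' (f '' I)) ＼ (Subtype.val '' (f '' S))).E :=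
    { toFun := fun x => ⟨(f ⟨x.1, x.2.1.1⟩).1, (hE _).1 x.2⟩
      invFun := fun y => ⟨(f.symm ⟨y.1, y.2.1.1⟩).1, (hE _).2 (by
        rw [f.apply_symm_apply]
        exact y.2)⟩
      left_inv := fun x => by
        apply Subtype.ext
        exact congrArg (fun z : M.E => z.1) (f.symm_apply_apply ⟨x.1, x.2.1.1⟩)
      right_inv := fun y => by
        apply Subtype.ext
        exact congrArg (fun z : M₀.E => z.1) (f.apply_symm_apply ⟨y.1, y.2.1.1⟩) }
  refine ⟨g, fun J => ?_⟩
  let K : Set M.E := {x | ∃ y ∈ J, y.1 = x.1}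
  have h1 : Subtype.val '' J = Subtype.val '' K := by
    ext a
    constructor
    · rintro ⟨y, hy, rfl⟩
      exact ⟨⟨y.1, y.2.1.1⟩, ⟨y, hy, rfl⟩, rfl⟩
    · rintro ⟨x, ⟨y, hy, hyx⟩, rfl⟩
      exact ⟨y, hy, hyx⟩
  have h2 : Subtype.val '' (g '' J) = Subtype.val '' (f '' K) := by
    ext a
    constructor
    · rintro ⟨_, ⟨y, hy, rfl⟩, rfl⟩
      exact ⟨_, ⟨⟨y.1, y.2.1.1⟩, ⟨y, hy, rfl⟩, rfl⟩, rfl⟩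
    · rintro ⟨_, ⟨⟨x, hx⟩, ⟨y, hy, rfl⟩, rfl⟩, rfl⟩
      exact ⟨_, ⟨y, hy, rfl⟩, rfl⟩
  rw [h1, h2, Matroid.delete_indep_iff, Matroid.delete_indep_iff, hI.contract_indep_iff,
    hI₀.contract_indep_iff, ← image_union, ← image_union, ← image_union, ← hf]
  simp only [disjoint_image_iff Subtype.val_injective, disjoint_image_iff f.injective]

theorem IsIsomorphic.exists_of_isMinor {M N : Matroid ι} {M₀ : Matroid κ}
    (h : IsIsomorphic M M₀) (hNM : N.IsMinor M) :
    ∃ C S, C ⊆ M₀.E ∧ IsIsomorphic N (M₀ ／ C ＼ S) := by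
  obtain ⟨f, hf⟩ := h
  obtain ⟨C, S, hC, hS, -, rfl⟩ := hNM.exists_eq_contract_delete_disjoint
  obtain ⟨I, hI⟩ := M.exists_isBasis C hC
  -- Contracting a basis of `C` and deleting the rest gives the same matroid. Independence in a
  -- contraction by an independent set is directly expressed by independence in `M`, which the
  -- isomorphism preserves.
  rw [hI.contract_eq_contract_delete, Matroid.delete_delete]
  obtain ⟨I', rfl⟩ : ∃ I' : Set M.E, Subtype.val '' I' = I :=
    ⟨_, Subtype.image_preimage_coe _ _ |>.trans (inter_eq_right.2 hI.indep.subset_ground)⟩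
  have hS' : C \ (Subtype.val '' I') ∪ S ⊆ M.E := union_subset (sdiff_subset.trans hC) hS
  obtain ⟨S', hS'⟩ : ∃ S' : Set M.E, Subtype.val '' S' = C \ (Subtype.val '' I') ∪ S :=
    ⟨_, Subtype.image_preimage_coe _ _ |>.trans (inter_eq_right.2 hS')⟩
  rw [← hS']
  exact ⟨_, _, Subtype.coe_image_subset _ _, IsIsomorphic.contract_delete f hf I' S' hI.indep⟩

end Iso

/-! ### Gain graphs of labelled arrows -/

section OfArrows

variable {V E Δ : Type*} [Group Δ]

/-- The graph underlying the labelled arrows in `F`. -/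
def ArrowData.toGraph (D : ArrowData V E Δ) (F : Set E) : Graph V E where
  vertexSet := D.src '' F ∪ D.tgt '' F
  IsLink e x y := e ∈ F ∧ ((x = D.src e ∧ y = D.tgt e) ∨ (x = D.tgt e ∧ y = D.src e))
  edgeSet := F
  isLink_symm _ _ := ⟨fun _ _ h => ⟨h.1, h.2.symm.imp And.symm And.symm⟩⟩
  eq_or_eq_of_isLink_of_isLink := by grind
  edge_mem_iff_exists_isLink e := ⟨fun h => ⟨_, _, h, .inl ⟨rfl, rfl⟩⟩, fun ⟨_, _, h, _⟩ => h⟩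
  left_mem_of_isLink := by
    rintro e x y ⟨he, ⟨rfl, rfl⟩ | ⟨rfl, rfl⟩⟩
    exacts [.inl ⟨e, he, rfl⟩, .inr ⟨e, he, rfl⟩]

open Classical in
/-- The gain function of the labelled arrows in `F`. -/
noncomputable def ArrowData.toGain (D : ArrowData V E Δ) (F : Set E) :
    GainFunction (D.toGraph F) Δ where
  gain e x y := if x = D.src e ∧ y = D.tgt e then D.gn e else (D.gn e)⁻¹
  gain_symm := by
    rintro e x y ⟨-, ⟨rfl, rfl⟩ | ⟨rfl, rfl⟩⟩ hne
    · simp [hne.symm]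
    · simp [hne]

theorem ArrowData.orients_toGain (D : ArrowData V E Δ) (F : Set E) : D.Orients (D.toGain F) :=
  fun _ he => ⟨⟨he, .inl ⟨rfl, rfl⟩⟩, if_pos ⟨rfl, rfl⟩⟩

end OfArrows

/-! ### From gain graphs to arrows and back -/

theorem exists_isLiftOf {V E : Type} {Γ : Type v} [Group Γ] {Γ₁ : Subgroup Γ} [Γ₁.Normal]
    {𝒜 : Set (Subgroup Γ)} (hP : IsFrobeniusPartition Γ₁ 𝒜) {G : Graph V E}
    {ψ : GainFunction G Γ} {M : Matroid E} (hfin : G.edgeSet.Finite)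
    (h : ψ.IsLiftMatroid Γ₁ 𝒜 M) :
    ∃ (V' : Type) (D : ArrowData V' E Γ), D.IsLiftOf Γ₁ 𝒜 G.edgeSet M := by
  -- Arrow data assigns ends even to non-edges, so an empty vertex type is replaced by `Unit`.
  rcases isEmpty_or_nonempty V with hV | hV
  · have hE : G.edgeSet = ∅ := by
      ext e
      refine iff_of_false (fun he => ?_) (by simp)
      obtain ⟨x, -⟩ := Graph.exists_isLink_of_mem_edgeSet he
      exact hV.elim x
    obtain ⟨N, hN, hM, -⟩ := h
    refine ⟨Unit, ⟨fun _ => (), fun _ => (), fun _ => 1⟩, N, ⟨hN.1, fun X _ e he => ?_⟩, hM,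
      fun X hX => ?_⟩
    · rw [hE] at he
      exact he.elim
    · rw [hE] at hX
      rw [subset_empty_iff.1 hX, if_pos ArrowData.coherent_empty, Matroid.eRk_empty,
        Matroid.eRk_empty]
  · obtain ⟨D, hD⟩ := exists_orients ψ
    exact ⟨V, D, (hD.isLiftMatroid_iff hP hfin).1 h⟩

theorem isMinorClosed_memClass {Γ : Type v} [Group Γ] {Γ₁ : Subgroup Γ} [Γ₁.Normal]
    {𝒜 : Set (Subgroup Γ)} (hP : IsFrobeniusPartition Γ₁ 𝒜)
    (hnt : IsNontrivialPartition (insert Γ₁ 𝒜) → Γ₁ ≠ ⊥)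
    (hq : Subsingleton (Γ ⧸ Γ₁) ∨ ∃ A ∈ 𝒜, Nonempty (Γ ⧸ Γ₁ ≃* A)) :
    IsMinorClosed.{u} (MemClass.{u, v} Γ₁ 𝒜) := by
  rintro ι M N ⟨V, E, G, ψ, M₀, -, hfin, hψ, hiso⟩ hNM
  obtain ⟨φ, hφ, hadm⟩ := hP.exists_section hq
  obtain ⟨C, S, hC, hN⟩ := hiso.exists_of_isMinor hNM
  obtain ⟨V', D, hD⟩ := exists_isLiftOf hP hfin hψ
  have hE : M₀.E = G.edgeSet := hψ.choose_spec.2.1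
  rw [hE] at hC
  obtain ⟨D', hD'⟩ := hD.contract hP hnt φ hφ hadm (hfin.subset hC) hC
  have hD'' := hD'.delete S
  have hfin' : ((G.edgeSet \ C) \ S).Finite := hfin.subset (sdiff_subset.trans sdiff_subset)
  -- Only ends of arrows are vertices of the new graph, so its vertex set is finite.
  exact ⟨V', E, D'.toGraph ((G.edgeSet \ C) \ S), D'.toGain _, _,
    (hfin'.image _).union (hfin'.image _), hfin',
    ((D'.orients_toGain _).isLiftMatroid_iff hP hfin').2 hD'', hN⟩

end GainGraph

theorem mainTheorem3 {Γ : Type v} [Group Γ] (Γ₁ : Subgroup Γ) [Γ₁.Normal]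
    (𝒜 : Set (Subgroup Γ)) (hP : GainGraph.IsFrobeniusPartition Γ₁ 𝒜) :
    ((GainGraph.IsNontrivialPartition (insert Γ₁ 𝒜) → Γ₁ ≠ ⊥) →
      (Subsingleton (Γ ⧸ Γ₁) ∨ ∃ A ∈ 𝒜, Nonempty (Γ ⧸ Γ₁ ≃* A)) →
        GainGraph.IsMinorClosed.{u} (GainGraph.MemClass.{u, v} Γ₁ 𝒜)) ∧
    (Finite Γ → GainGraph.IsMinorClosed.{u} (GainGraph.MemClass.{u, v} Γ₁ 𝒜)) := by
  refine ⟨fun hnt hq => GainGraph.isMinorClosed_memClass hP hnt hq, fun _ => ?_⟩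
  exact GainGraph.isMinorClosed_memClass hP hP.of_finite.1 hP.of_finite.2
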